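/- Definitions. A cellular pseudomanifold is a finite lattice $M$ with least element $\mathbf 0\neq$ greatest element $\mathbf 1$, such that: all maximal chains from $\mathbf 0$ to $x$ have the same length $\rho(x)$, for every $x\in M$; for $x<z$ with $\rho(z)=\rho(x)+2$ there are exactly two $y$ with $x<y<z$; and for $x<z$ with $\rho(z)>\rho(x)+2$ the graph on $\{y\in[x,z]:\rho(y)=\rho(z)-1\}$, in which $y,y'$ are adjacent iff $\rho(y\wedge y')=\rho(z)-2$, is connected. Its vertices, edges and facets are the elements of rank $1$, $2$ and $\rho(\mathbf 1)-1$ respectively; its dimension is $d=\rho(\mathbf 1)-2$, and its excess is $n-d-2$, where $n$ is the number of vertices. Isomorphisms are order isomorphisms. For vertices $x,y$ write $x\sim y$ if $x=y$ or some automorphism of $M$ interchanges $x$ and $y$ and fixes all other vertices. $M$ is reducible if there is a $\sim$-equivalence class $A$ such that no facet lies above all vertices of $A$; $M$ is neighbourly if any two distinct vertices lie below a common edge. $M$ is a polytopal sphere if it is isomorphic to the lattice of all closed faces (including $\emptyset$ and the polytope itself) of a convex polytope. For $c\ge -1$, $S^{\,c}_{c+2}$ is the lattice of all subsets of a set of size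 $c+2$. The direct product $M\otimes N$ is $M\times N$ with the componentwise order, and the join $M\ast N$ is the sub-poset of $M\otimes N$ of all $(\alpha,\beta)$ with either both $\alpha\neq\mathbf 1$ and $\beta\neq\mathbf 1$, or $\alpha=\mathbf 1$ and $\beta=\mathbf 1$. Statement. Let $d$ be an integer. Up to isomorphism, the reducible neighbourly cellular pseudomanifolds of excess $2$ and dimension $d$ are exactly $$S^{\,b_1}_{b_1+2}\ast S^{\,b_2}_{b_2+2}\ast S^{\,b_3}_{b_3+2}\quad\text{with } 1\le b_1\le b_2\le b_3,\ b_1+b_2+b_3=d-2,$$ and $$\bigl((S^{\,d_1}_{d_1+2}\ast S^{\,d_2}_{d_2+2})\otimes S^{\,d_3}_{d_3+2}\bigr)\ast S^{\,d_4}_{d_4+2}\quad\text{with } 1\le d_1\le d_2,\ -1\le d_3,\ 1\le d_4,\ d_1+d_2+d_3+d_4=d-4.$$ These are mutually non-isomorphic polytopal spheres. The number of isomorphism classes is finite, and for $d\ge 2$ it equals $$\left\lfloor\frac{(d^2-6d+10)(2d-7)+9}{24}\right\rfloor .$$ -/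

import Mathlib

universe u v

namespace CellPM

section Basic

variable (M : Type u) [PartialOrder M]

variable {M} in
/-- The rank `ρ(x)`: the largest length `r` of a chain `x₀ < ⋯ < x_r = x`. -/
noncomputable def rank (x : M) : ℕ := (Order.height x).toNat

variable {M} in
/-- The graph `Λ([x, z])` of the interval `[x, z]`. The rank function of the interval is
`ρ - ρ(x)`, so its vertices are the `y ∈ [x, z]` with `ρ(y) = ρ(z) - 1`; two of them are
adjacent if and only if their meet has rank `ρ(z) - 2`. -/
def facetGraph (x z : M) : SimpleGraph {y : M // x ≤ y ∧ y ≤ z ∧ rank y + 1 = rank z} where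
  Adj s t := s ≠ t ∧ ∃ m : M, IsGLB {s.1, t.1} m ∧ rank m + 2 = rank z
  symm := ⟨fun s t h => ⟨h.1.symm, by
    obtain ⟨m, hm, hr⟩ := h.2
    exact ⟨m, by rwa [Set.pair_comm], hr⟩⟩⟩
  loopless := ⟨fun _ h => h.1 rfl⟩

/-- A cellular pseudomanifold: a finite ranked lattice (with at least the two trivial faces) in
which every interval of length 2 has exactly two inner elements and `Λ([x, z])` is connected for
every longer interval. -/
structure IsCellularPseudomanifold : Prop where
  finite : Finite M
  nontrivial : Nontrivial M
  exists_inf : ∀ x y : M, ∃ m, IsGLB {x, y} m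
  exists_sup : ∀ x y : M, ∃ j, IsLUB {x, y} j
  /-- All maximal chains `0 = x₀ < ⋯ < x_r = x` joining `0` to `x` have length `ρ(x)`. -/
  ranked : ∀ (x : M) (p : LTSeries M), IsBot p.head → p.last = x →
    (∀ i : Fin p.length, p i.castSucc ⋖ p i.succ) → p.length = rank x
  diamond : ∀ x z : M, x < z → rank z = rank x + 2 → {y : M | x < y ∧ y < z}.ncard = 2
  connected : ∀ x z : M, x < z → rank x + 2 < rank z → (facetGraph x z).Connected

variable {M}

/-- Vertices are the faces of dimension `0`, that is, of rank `1`. -/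
def IsVertex (v : M) : Prop := rank v = 1

/-- The shadow of a face: the set of its vertices. -/
def shadow (f : M) : Set M := {v | IsVertex v ∧ v ≤ f}

/-- `x ∼ y` for vertices `x`, `y`: either `x = y`, or the transposition of `x` and `y` (which
fixes every other vertex) is an automorphism. -/
def VertexSim (x y : M) : Prop :=
  x = y ∨ ∃ φ : M ≃o M, φ x = y ∧ φ y = x ∧ ∀ v : M, IsVertex v → v ≠ x → v ≠ y → φ v = v

/-- The `∼`-equivalence class of the vertex `x`. -/
def simClass (x : M) : Set M := {y | IsVertex y ∧ VertexSim x y}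

variable (M)

/-- Neighbourly: any two distinct vertices lie in a common edge (a face of rank `2`). -/
def Neighbourly : Prop :=
  ∀ x y : M, IsVertex x → IsVertex y → x ≠ y → ∃ e : M, rank e = 2 ∧ x ≤ e ∧ y ≤ e

/-- Isomorphic to the boundary complex of a polytope. A polytope in `ℝⁿ` is the convex hull `X` of
finitely many points, with non-empty interior. Its closed faces are the intersections of `X` with
its supporting hyperplanes together with `∅` and `X` itself; these are exactly the exposed subsets
of `X`, ordered by inclusion. -/
def Polytopal : Prop :=
  ∃ (n : ℕ) (S : Set (EuclideanSpace ℝ (Fin n))), S.Finite ∧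
    (interior (convexHull ℝ S)).Nonempty ∧
    Nonempty (M ≃o {F : Set (EuclideanSpace ℝ (Fin n)) // IsExposed ℝ (convexHull ℝ S) F})

variable [OrderTop M]

/-- The dimension of `M`, namely `dim 1 - 1 = ρ(1) - 2`. -/
noncomputable def dim : ℤ := (rank (⊤ : M) : ℤ) - 2

/-- The excess `n - d - 2`, with `n` the number of vertices and `d` the dimension. -/
noncomputable def excess : ℤ := ({v : M | IsVertex v}.ncard : ℤ) - dim M - 2

variable {M} in
/-- Facets are the faces of rank `ρ(1) - 1`. -/
def IsFacet (f : M) : Prop := rank f + 1 = rank (⊤ : M)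

/-- Reducible: some `∼`-equivalence class of vertices is not contained in the shadow of any
facet. -/
def Reducible : Prop :=
  ∃ x : M, IsVertex x ∧ ∀ f : M, IsFacet f → ¬ simClass x ⊆ shadow f

/-- `M` is a reducible neighbourly cellular pseudomanifold of excess `2` and dimension `d`. -/
structure IsReducibleNeighbourlyExcessTwo (d : ℤ) : Prop where
  isCellularPseudomanifold : IsCellularPseudomanifold M
  reducible : Reducible M
  neighbourly : Neighbourly M
  excess_eq : excess M = 2
  dim_eq : dim M = d

end Basic

section Constructions

/-- The standard sphere `S^d_{d+2}` (`d ≥ -1`): all subsets of a set with `d + 2` elements. -/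
abbrev StdSphere (d : ℤ) : Type := Finset (Fin (d + 2).toNat)

/-- The direct product `M₁ ⊗ M₂`: the product poset with the componentwise order. -/
abbrev DirectProduct (M : Type u) (N : Type v) : Type (max u v) := M × N

/-- The join `M₁ ∗ M₂`: the sub-poset of `M₁ ⊗ M₂` of all `(α, β)` where either both or none of
`α`, `β` equals `1`. -/
def Join (M : Type u) (N : Type v) [PartialOrder M] [OrderTop M] [PartialOrder N] [OrderTop N] :
    Type (max u v) :=
  {p : DirectProduct M N // p.1 = ⊤ ↔ p.2 = ⊤}

variable (M : Type u) (N : Type v) [PartialOrder M] [OrderTop M] [PartialOrder N] [OrderTop N]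

instance : PartialOrder (Join M N) :=
  inferInstanceAs (PartialOrder {p : DirectProduct M N // p.1 = ⊤ ↔ p.2 = ⊤})

instance : OrderTop (Join M N) where
  top := ⟨(⊤, ⊤), iff_of_true rfl rfl⟩
  le_top p := (le_top : p.1 ≤ ⊤)

/-- `S^{b₁}_{b₁+2} ∗ S^{b₂}_{b₂+2} ∗ S^{b₃}_{b₃+2}`. -/
abbrev FamilyOne (b₁ b₂ b₃ : ℤ) : Type :=
  Join (Join (StdSphere b₁) (StdSphere b₂)) (StdSphere b₃)

/-- `((S^{d₁}_{d₁+2} ∗ S^{d₂}_{d₂+2}) ⊗ S^{d₃}_{d₃+2}) ∗ S^{d₄}_{d₄+2}`. -/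
abbrev FamilyTwo (d₁ d₂ d₃ d₄ : ℤ) : Type :=
  Join (DirectProduct (Join (StdSphere d₁) (StdSphere d₂)) (StdSphere d₃)) (StdSphere d₄)

/-- The parameters of the first family in dimension `d`. -/
def ParamsOne (d b₁ b₂ b₃ : ℤ) : Prop :=
  1 ≤ b₁ ∧ b₁ ≤ b₂ ∧ b₂ ≤ b₃ ∧ b₁ + b₂ + b₃ = d - 2

/-- The parameters of the second family in dimension `d`. -/
def ParamsTwo (d d₁ d₂ d₃ d₄ : ℤ) : Prop :=
  1 ≤ d₁ ∧ d₁ ≤ d₂ ∧ -1 ≤ d₃ ∧ 1 ≤ d₄ ∧ d₁ + d₂ + d₃ + d₄ = d - 4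

end Constructions

section Counting

/-- A partially ordered type with a largest element, bundled. -/
structure TopPoset : Type (u + 1) where
  carrier : Type u
  [partialOrder : PartialOrder carrier]
  [orderTop : OrderTop carrier]

attribute [instance] TopPoset.partialOrder TopPoset.orderTop

/-- Isomorphism of posets. -/
instance isoSetoid : Setoid TopPoset.{u} where
  r M N := Nonempty (M.carrier ≃o N.carrier)
  iseqv :=
    { refl := fun _ => ⟨OrderIso.refl _⟩
      symm := fun ⟨e⟩ => ⟨e.symm⟩
      trans := fun ⟨e⟩ ⟨f⟩ => ⟨e.trans f⟩ }

/-- The isomorphism classes of reducible neighbourly cellular pseudomanifolds of excess `2` and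
dimension `d`. -/
def isoClasses (d : ℤ) : Set (Quotient isoSetoid.{u}) :=
  {q | ∃ M : TopPoset.{u}, IsReducibleNeighbourlyExcessTwo M.carrier d ∧ Quotient.mk _ M = q}

end Counting

end CellPM

/-! The diamond property makes every face the join of its vertices and the meet of the facets above
it. So the lattice can be rebuilt from its cofacets, the sets of vertices missed by a facet: the
vertex sets of faces are exactly the sets whose complement is a union of cofacets
(`IsGradedPM.closedFor_cofacets_iff`). A face of rank r has at least r vertices, so excess 2 leaves
at most three vertices in a cofacet.

Let A be a class of interchangeable vertices that lies in no facet. Swapping two members of A moves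
a facet across a ridge. The diamond property then shows that a facet cannot contain one vertex of A
and miss two (`missing_unique`), and strong connectivity shows that every facet contains some vertex
of A (`exists_mem_le_facet`). Hence a cofacet has exactly one vertex in A, which may be exchanged
for any other: cofacets are the sets {a} ∪ D with a in A arbitrary and D from a fixed family of sets
of one or two vertices outside A. The one-element D give the vertices of colour 3. The two-element D
are the edges of a graph. A three-element cofacet belongs to a simplicial facet, and the diamond
property at its ridges says that each vertex outside A and not of colour 3 is adjacent to exactly
one end of every edge it does not lie on. Such a graph is complete bipartite, with sides coloured 1
and 2, while A has colour 0 (`exists_coloring`). There is an edge, since otherwise the facets would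
be simplices, and those miss three vertices. Neighbourliness forces at least three vertices of each
colour 0, 1, 2.

So M is a `Model n`, given by four class sizes; n 3 = 0 yields the first family and n 3 > 0 the
second. Conversely, products and joins of pseudomanifolds are pseudomanifolds, and the models
visibly have the required properties. The cofacets of sizes two and three let the class sizes be
read off from the lattice, up to the evident symmetries, which gives non-isomorphism. Polytopality
holds because a join is the face lattice of a free sum of polytopes and a product that of their
geometric join. The count is a sum of elementary partition counts. -/

namespace CellPM

/-! ### Cellular pseudomanifolds in terms of the covering relation -/

section Graded

/-- Adjacency of two elements covered by `z` and above `x`: they cover a common element. -/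
def FacetAdj {M : Type*} [PartialOrder M] (x z s t : M) : Prop :=
  x ≤ s ∧ s ⋖ z ∧ x ≤ t ∧ t ⋖ z ∧ ∃ m, m ⋖ s ∧ m ⋖ t

/-- A purely order-theoretic description of cellular pseudomanifolds. -/
structure IsGradedPM (M : Type*) [PartialOrder M] : Prop where
  finite : Finite M
  nontrivial : Nontrivial M
  exists_inf : ∀ x y : M, ∃ m, IsGLB {x, y} m
  exists_sup : ∀ x y : M, ∃ j, IsLUB {x, y} j
  exists_grading : ∃ r : M → ℕ, ∀ x y, x ⋖ y → r y = r x + 1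
  exists_other : ∀ x y z : M, x ⋖ y → y ⋖ z →
    ∃ y', y' ≠ y ∧ x < y' ∧ y' < z ∧ ∀ t, x < t → t < z → t = y ∨ t = y'
  connected : ∀ x z s t : M, x ≤ s → s ⋖ z → x ≤ t → t ⋖ z →
    Relation.ReflTransGen (FacetAdj x z) s t

theorem IsGradedPM.of_orderIso {M N : Type*} [PartialOrder M] [PartialOrder N] (e : M ≃o N)
    (h : IsGradedPM M) : IsGradedPM N where
  finite := have := h.finite; Finite.of_equiv M e.toEquiv
  nontrivial := have := h.nontrivial; e.symm.toEquiv.nontrivial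
  exists_inf x y := by
    obtain ⟨m, hm⟩ := h.exists_inf (e.symm x) (e.symm y)
    refine ⟨e m, ?_⟩
    have := (e.isGLB_image').2 hm
    simpa [Set.image_pair] using this
  exists_sup x y := by
    obtain ⟨m, hm⟩ := h.exists_sup (e.symm x) (e.symm y)
    refine ⟨e m, ?_⟩
    have := (e.isLUB_image').2 hm
    simpa [Set.image_pair] using this
  exists_grading := by
    obtain ⟨r, hr⟩ := h.exists_grading
    exact ⟨fun x => r (e.symm x), fun x y hxy => hr _ _ ((apply_covBy_apply_iff e.symm).2 hxy)⟩
  exists_other x y z hxy hyz := by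
    obtain ⟨y', h1, h2, h3, h4⟩ := h.exists_other _ _ _
      ((apply_covBy_apply_iff e.symm).2 hxy) ((apply_covBy_apply_iff e.symm).2 hyz)
    refine ⟨e y', fun h => h1 (by simp [← h]), e.symm_apply_lt.1 h2, e.lt_symm_apply.1 h3, ?_⟩
    intro t ht ht'
    rcases h4 (e.symm t) (e.symm.lt_iff_lt.2 ht) (e.symm.lt_iff_lt.2 ht') with h | h
    · exact .inl (e.symm.injective h)
    · exact .inr (by simp [← h])
  connected x z s t hs hs' ht ht' := by
    have := h.connected (e.symm x) (e.symm z) (e.symm s) (e.symm t) (e.symm.le_iff_le.2 hs)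
      ((apply_covBy_apply_iff e.symm).2 hs') (e.symm.le_iff_le.2 ht)
      ((apply_covBy_apply_iff e.symm).2 ht')
    have := this.lift (p := FacetAdj x z) e (by
      rintro a b ⟨h1, h2, h3, h4, m, h5, h6⟩
      refine ⟨e.symm_apply_le.1 h1, ?_, e.symm_apply_le.1 h3, ?_, e m,
        (apply_covBy_apply_iff e).2 h5, (apply_covBy_apply_iff e).2 h6⟩
      · simpa using (apply_covBy_apply_iff e).2 h2
      · simpa using (apply_covBy_apply_iff e).2 h4)
    simpa [Function.onFun] using this

variable {M : Type*} [PartialOrder M]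

theorem height_lt_top_of_finite [Finite M] (x : M) : Order.height x < ⊤ := by
  have : Order.height x ≤ (Nat.card M : ℕ) := by
    refine Order.height_le fun p _ => ?_
    have : Fintype M := Fintype.ofFinite M
    rw [Nat.card_eq_fintype_card]
    exact_mod_cast p.length_lt_card.le
  exact this.trans_lt (ENat.natCast_lt_top _)

theorem rank_lt_rank [Finite M] {x y : M} (h : x < y) : rank x < rank y := by
  have := Order.height_strictMono h (height_lt_top_of_finite x)
  rw [← ENat.natCast_toNat (height_lt_top_of_finite x).ne,
    ← ENat.natCast_toNat (height_lt_top_of_finite y).ne] at this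
  exact_mod_cast this

theorem rank_le_rank [Finite M] {x y : M} (h : x ≤ y) : rank x ≤ rank y := by
  rcases h.eq_or_lt with rfl | h
  · rfl
  · exact (rank_lt_rank h).le

theorem eq_of_le_of_rank_le [Finite M] {x y : M} (h : x ≤ y) (h' : rank y ≤ rank x) : x = y := by
  rcases h.eq_or_lt with rfl | h
  · rfl
  · exact absurd (rank_lt_rank h) (by omega)

theorem rank_orderIso {N : Type*} [PartialOrder N] (e : M ≃o N) (x : M) :
    rank (e x) = rank x := by
  rw [rank, Order.height_orderIso, rank]

theorem rank_of_isBot {x : M} (h : IsBot x) : rank x = 0 := by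
  have : Order.height x = 0 := Order.height_eq_zero.2 h.isMin
  simp [rank, this]

/-- A grading need not vanish at the bottom, hence the term `r b`. One inequality follows a longest
chain up to `x`, along which `r` strictly increases; the other descends from `x` by covers, each
costing `r` exactly one and the rank at least one. -/
theorem rank_add_grading [Finite M] {b : M} (hb : IsBot b) {r : M → ℕ}
    (hr : ∀ x y, x ⋖ y → r y = r x + 1) (x : M) : rank x + r b = r x := by
  have hmono : ∀ x y, x < y → r x < r y := by
    intro x y
    induction y using WellFoundedLT.induction with
    | ind y ih =>
      intro hxy
      obtain ⟨w, hw, hwy⟩ := exists_le_covBy_of_lt hxy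
      have h1 := hr _ _ hwy
      rcases hw.eq_or_lt with rfl | hw
      · omega
      · have := ih w hwy.lt hw
        omega
  have hle : r b + rank x ≤ r x := by
    obtain ⟨p, hp, hl⟩ := Order.exists_series_of_height_eq_coe x
      (ENat.natCast_toNat (height_lt_top_of_finite x).ne).symm
    have : ∀ i : ℕ, ∀ hi : i < p.length + 1, r b + i ≤ r (p ⟨i, hi⟩) := by
      intro i
      induction i with
      | zero =>
        intro hi
        rcases (hb (p ⟨0, hi⟩)).eq_or_lt with h | h
        · rw [← h]; rfl
        · have := hmono _ _ h
          omega
      | succ i ih =>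
        intro hi
        have h1 := ih (by omega)
        have h2 := hmono _ _ (p.step ⟨i, by omega⟩)
        have h3 : r (p ⟨i, by omega⟩) < r (p ⟨i + 1, hi⟩) := h2
        omega
    have h1 := this p.length (by omega)
    have h2 : p ⟨p.length, by omega⟩ = x := hp
    rw [h2, hl] at h1
    exact h1
  have hge : ∀ x, r x ≤ r b + rank x := by
    intro x
    induction x using WellFoundedLT.induction with
    | ind x ih =>
      rcases (hb x).eq_or_lt with h | h
      · rw [← h]; omega
      · obtain ⟨w, hw, hwy⟩ := exists_le_covBy_of_lt h
        have h1 := hr _ _ hwy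
        have h2 := ih w hwy.lt
        have h3 := rank_lt_rank hwy.lt
        omega
  have := hge x
  omega

theorem exists_isBot [Finite M] [Nonempty M] (h : ∀ x y : M, ∃ m, IsGLB {x, y} m) :
    ∃ b : M, IsBot b := by
  obtain ⟨b, hb⟩ := Set.finite_univ.exists_minimal (Set.univ_nonempty (α := M))
  refine ⟨b, fun x => ?_⟩
  obtain ⟨m, hm⟩ := h x b
  have h1 : m ≤ x := hm.1 (by simp)
  have h2 : m ≤ b := hm.1 (by simp)
  have h3 : b ≤ m := hb.2 trivial h2
  exact h3.trans h1

theorem covBy_iff_of_rank [Finite M] (hr : ∀ x y : M, x ⋖ y → rank y = rank x + 1) {x y : M} :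
    x ⋖ y ↔ x ≤ y ∧ rank x + 1 = rank y := by
  refine ⟨fun hxy => ⟨hxy.le, (hr _ _ hxy).symm⟩, fun ⟨hle, hr⟩ => ?_⟩
  have hlt : x < y := lt_of_le_of_ne hle (by rintro rfl; omega)
  refine ⟨hlt, fun c hxc hcy => ?_⟩
  have := rank_lt_rank hxc
  have := rank_lt_rank hcy
  omega

namespace IsGradedPM

variable (h : IsGradedPM M)
include h

theorem exists_isBot : ∃ b : M, IsBot b := by
  have := h.finite
  have := h.nontrivial
  exact CellPM.exists_isBot h.exists_inf

theorem rank_of_covBy {x y : M} (hxy : x ⋖ y) : rank y = rank x + 1 := by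
  have := h.finite
  obtain ⟨b, hb⟩ := h.exists_isBot
  obtain ⟨r, hr⟩ := h.exists_grading
  have h1 := rank_add_grading hb hr x
  have h2 := rank_add_grading hb hr y
  have := hr _ _ hxy
  omega

theorem covBy_iff {x y : M} : x ⋖ y ↔ x ≤ y ∧ rank x + 1 = rank y :=
  have := h.finite
  covBy_iff_of_rank fun _ _ => h.rank_of_covBy

end IsGradedPM

theorem covBy_snoc {p : LTSeries M} (hc : ∀ i : Fin p.length, p i.castSucc ⋖ p i.succ) {y : M}
    (hy : p.last ⋖ y) (i : Fin (p.snoc y hy.lt).length) :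
    (p.snoc y hy.lt) i.castSucc ⋖ (p.snoc y hy.lt) i.succ := by
  have key : ∀ a b c d : M, a = c → b = d → c ⋖ d → a ⋖ b := by
    rintro a b _ _ rfl rfl h
    exact h
  refine Fin.lastCases (n := p.length) ?_ (fun j => ?_) i
  · exact key _ _ _ _ (RelSeries.snoc_castSucc p y hy.lt (Fin.last _))
      (RelSeries.last_snoc' p y hy.lt) hy
  · exact key _ _ _ _ (RelSeries.snoc_castSucc p y hy.lt j.castSucc)
      (RelSeries.snoc_castSucc p y hy.lt j.succ) (hc j)

/-- The chain condition concerns only saturated chains that start at the bottom. Such a chain is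
built up to `x` and prolonged by `y`; both lengths are then ranks. -/
theorem IsCellularPseudomanifold.rank_of_covBy (h : IsCellularPseudomanifold M) {x y : M}
    (hxy : x ⋖ y) : rank y = rank x + 1 := by
  have := h.finite
  have := h.nontrivial
  obtain ⟨b, hb⟩ := exists_isBot h.exists_inf
  have key : ∀ x : M, ∃ p : LTSeries M, IsBot p.head ∧ p.last = x ∧
      ∀ i : Fin p.length, p i.castSucc ⋖ p i.succ := by
    intro x
    induction x using WellFoundedLT.induction with
    | ind x ih =>
      rcases (hb x).eq_or_lt with hx | hx
      · exact ⟨RelSeries.singleton _ b, hb, hx, fun i => i.elim0⟩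
      · obtain ⟨w, -, hwx⟩ := exists_le_covBy_of_lt hx
        obtain ⟨p, hp, hl, hc⟩ := ih w hwx.lt
        rw [← hl] at hwx
        exact ⟨p.snoc x hwx.lt, by simpa using hp, by simp, covBy_snoc hc hwx⟩
  obtain ⟨p, hp, hl, hc⟩ := key x
  have h1 := h.ranked x p hp hl hc
  rw [← hl] at hxy
  have h2 := h.ranked y (p.snoc y hxy.lt) (by simpa using hp) (by simp) (covBy_snoc hc hxy)
  rw [← h1, ← h2]
  rfl

theorem IsCellularPseudomanifold.isGradedPM (h : IsCellularPseudomanifold M) :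
    IsGradedPM M where
  finite := h.finite
  nontrivial := h.nontrivial
  exists_inf := h.exists_inf
  exists_sup := h.exists_sup
  exists_grading := ⟨rank, fun _ _ => h.rank_of_covBy⟩
  exists_other x y z hxy hyz := by
    have h1 := h.rank_of_covBy hxy
    have h2 := h.rank_of_covBy hyz
    have h3 := h.diamond x z (hxy.lt.trans hyz.lt) (by omega)
    obtain ⟨a, b, hab, hset⟩ := Set.ncard_eq_two.1 h3
    have hy : y ∈ {y : M | x < y ∧ y < z} := ⟨hxy.lt, hyz.lt⟩
    have ha : a ∈ {y : M | x < y ∧ y < z} := by rw [hset]; simp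
    have hb : b ∈ {y : M | x < y ∧ y < z} := by rw [hset]; simp
    have hall : ∀ t, x < t → t < z → t = a ∨ t = b := fun t h1 h2 => by
      have : t ∈ {y : M | x < y ∧ y < z} := ⟨h1, h2⟩
      rw [hset] at this
      simpa using this
    rcases hall y hy.1 hy.2 with rfl | rfl
    · exact ⟨b, hab.symm, hb.1, hb.2, hall⟩
    · exact ⟨a, hab, ha.1, ha.2, fun t h1 h2 => (hall t h1 h2).symm⟩
  connected x z s t hs hsz ht htz := by
    have := h.finite
    have cov : ∀ {x y : M}, x ⋖ y ↔ x ≤ y ∧ rank x + 1 = rank y :=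
      covBy_iff_of_rank fun _ _ => h.rank_of_covBy
    have h1 := h.rank_of_covBy hsz
    have h2 := h.rank_of_covBy htz
    have h3 := rank_le_rank hs
    -- In intervals of length one or two connectivity is automatic: `s` and `t` both equal `x`, or
    -- both cover it.
    rcases (by omega : rank x = rank s ∨ rank x + 1 = rank s ∨ rank x + 2 < rank z) with hr | hr | hr
    · rw [← eq_of_le_of_rank_le hs (by omega), ← eq_of_le_of_rank_le ht (by omega)]
    · exact .single ⟨hs, hsz, ht, htz, x, cov.2 ⟨hs, hr⟩, cov.2 ⟨ht, by omega⟩⟩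
    · have hc := (h.connected x z (hs.trans_lt hsz.lt) hr).preconnected
        ⟨s, hs, hsz.le, h1.symm⟩ ⟨t, ht, htz.le, h2.symm⟩
      rw [SimpleGraph.reachable_iff_reflTransGen] at hc
      have := hc.lift (p := FacetAdj x z) Subtype.val (by
        rintro ⟨a, ha, ha', ha''⟩ ⟨b, hb, hb', hb''⟩ ⟨-, m, hm, hmr⟩
        have e1 : m ≤ a := hm.1 (by simp)
        have e2 : m ≤ b := hm.1 (by simp)
        have e3 : rank a + 1 = rank z := ha''
        have e4 : rank b + 1 = rank z := hb''
        have e5 : rank m + 2 = rank z := hmr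
        have e6 : rank m + 1 = rank a := by omega
        have e7 : rank m + 1 = rank b := by omega
        exact ⟨ha, cov.2 ⟨ha', e3⟩, hb, cov.2 ⟨hb', e4⟩, m, cov.2 ⟨e1, e6⟩, cov.2 ⟨e2, e7⟩⟩)
      exact this

/-- The meet lies between `m` and `s`, so it is one of them; if it were `s`, one coatom of `z` would
lie below another. -/
theorem isGLB_of_covBy {m s t z : M} (hinf : ∀ x y : M, ∃ m, IsGLB {x, y} m) (hst : s ≠ t)
    (hs : s ⋖ z) (ht : t ⋖ z) (hms : m ⋖ s) (hmt : m ⋖ t) : IsGLB {s, t} m := by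
  obtain ⟨g, hg⟩ := hinf s t
  have h1 : m ≤ g := hg.2 (by simp [hms.le, hmt.le])
  have h2 : g ≤ s := hg.1 (by simp)
  have h3 : g ≤ t := hg.1 (by simp)
  rcases hms.eq_or_eq h1 h2 with h | h
  · rwa [← h]
  · rw [h] at h3
    rcases hs.eq_or_eq h3 ht.le with h | h
    · exact absurd h.symm hst
    · exact absurd h ht.ne

theorem IsGradedPM.isCellularPseudomanifold (h : IsGradedPM M) :
    IsCellularPseudomanifold M where
  finite := h.finite
  nontrivial := h.nontrivial
  exists_inf := h.exists_inf
  exists_sup := h.exists_sup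
  ranked x p hp hl hc := by
    have : ∀ i : ℕ, ∀ hi : i < p.length + 1, rank (p ⟨i, hi⟩) = i := by
      intro i
      induction i with
      | zero => exact fun hi => rank_of_isBot hp
      | succ i ih =>
        intro hi
        have h1 : p ⟨i, by omega⟩ ⋖ p ⟨i + 1, hi⟩ := hc ⟨i, by omega⟩
        rw [h.rank_of_covBy h1, ih]
    rw [← hl]
    exact (this p.length (by omega)).symm
  diamond x z hxz hr := by
    have := h.finite
    obtain ⟨y, hxy, hyz⟩ := exists_le_covBy_of_lt hxz
    have h1 := h.rank_of_covBy hyz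
    have hxy : x ⋖ y := h.covBy_iff.2 ⟨hxy, by omega⟩
    obtain ⟨y', h2, h3, h4, h5⟩ := h.exists_other x y z hxy hyz
    refine Set.ncard_eq_two.2 ⟨y, y', h2.symm, ?_⟩
    ext t
    simp only [Set.mem_ofPred_eq, Set.mem_insert_iff, Set.mem_singleton_iff]
    refine ⟨fun ht => h5 t ht.1 ht.2, ?_⟩
    rintro (rfl | rfl)
    · exact ⟨hxy.lt, hyz.lt⟩
    · exact ⟨h3, h4⟩
  connected x z hxz hr := by
    have := h.finite
    have key : ∀ s t : M, ∀ hs : (x ≤ s ∧ s ≤ z ∧ rank s + 1 = rank z),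
        Relation.ReflTransGen (FacetAdj x z) s t →
        ∃ ht, (facetGraph x z).Reachable ⟨s, hs⟩ ⟨t, ht⟩ := by
      intro s t hs hst
      induction hst with
      | refl => exact ⟨hs, .refl _⟩
      | @tail a b _ hab ih =>
        obtain ⟨ha, hsa⟩ := ih
        obtain ⟨h1, h2, h3, h4, m, h5, h6⟩ := hab
        refine ⟨⟨h3, h4.le, (h.rank_of_covBy h4).symm⟩, ?_⟩
        -- `FacetAdj` admits equal elements, while the facet graph is loopless.
        by_cases e : a = b
        · subst e; exact hsa
        · refine hsa.trans (SimpleGraph.Adj.reachable ⟨fun h => e (congrArg Subtype.val h), m,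
            isGLB_of_covBy h.exists_inf e h2 h4 h5 h6, ?_⟩)
          have := h.rank_of_covBy h5
          have := h.rank_of_covBy h2
          omega
    obtain ⟨y, hxy, hyz⟩ := exists_le_covBy_of_lt hxz
    have : Nonempty {y : M // x ≤ y ∧ y ≤ z ∧ rank y + 1 = rank z} :=
      ⟨⟨y, hxy, hyz.le, (h.rank_of_covBy hyz).symm⟩⟩
    refine ⟨fun s t => ?_⟩
    obtain ⟨_, hr⟩ := key s.1 t.1 s.2 (h.connected x z s.1 t.1 s.2.1
      (h.covBy_iff.2 s.2.2) t.2.1 (h.covBy_iff.2 t.2.2))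
    exact hr

end Graded

end CellPM

namespace CellPM

/-! ### Simplices, products and joins are pseudomanifolds -/

section Closure

theorem isGradedPM_finset (α : Type*) [Finite α] [Nonempty α] : IsGradedPM (Finset α) := by
  classical
  have hcov : ∀ {s t : Finset α}, s ⋖ t ↔ ∃ a ∈ t, t.erase a = s :=
    fun {s t} => Finset.covBy_iff_exists_erase
  exact {
    finite := inferInstance
    nontrivial := inferInstance
    exists_inf := fun x y => ⟨x ⊓ y, isGLB_pair⟩
    exists_sup := fun x y => ⟨x ⊔ y, isLUB_pair⟩
    exists_grading := ⟨Finset.card, fun x y h => by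
      obtain ⟨a, ha, rfl⟩ := hcov.1 h
      rw [Finset.card_erase_add_one ha]⟩
    exists_other := by
      intro x y z hxy hyz
      obtain ⟨a, ha, rfl⟩ := hcov.1 hxy
      obtain ⟨b, hb, rfl⟩ := hcov.1 hyz
      have hab : a ≠ b := fun h => by simp [h] at ha
      have haz : a ∈ z := Finset.mem_of_mem_erase ha
      -- Here `y` is `z` without `b` and `x` is `z` without `a` and `b`, so the other middle element
      -- is `z` without `a`.
      refine ⟨z.erase a, ?_, ?_, Finset.erase_ssubset haz, ?_⟩
      · intro h
        have : a ∈ z.erase a := by rw [h]; exact ha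
        simp at this
      · rw [Finset.erase_right_comm]
        exact Finset.erase_ssubset (by simp [hb, hab.symm])
      · intro t h1 h2
        have h1' := Finset.subset_iff.1 h1.le
        have h2' := Finset.subset_iff.1 h2.le
        by_cases hat : a ∈ t
        · left
          have hbt : b ∉ t := by
            intro hbt
            refine h2.ne (Finset.Subset.antisymm h2.le fun c hc => ?_)
            by_cases hca : c = a
            · rwa [hca]
            by_cases hcb : c = b
            · rwa [hcb]
            exact h1' (by simp [hca, hcb, hc])
          ext c
          simp only [Finset.mem_erase]
          refine ⟨fun h => ⟨fun h' => hbt (h' ▸ h), h2' h⟩, fun ⟨h, h'⟩ => ?_⟩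
          by_cases hca : c = a
          · rwa [hca]
          exact h1' (by simp [hca, h, h'])
        · right
          have hbt : b ∈ t := by
            by_contra hbt
            refine h1.ne (Finset.Subset.antisymm h1.le fun c hc => ?_)
            simp only [Finset.mem_erase]
            exact ⟨fun h => hat (h ▸ hc), fun h => hbt (h ▸ hc), h2' hc⟩
          ext c
          simp only [Finset.mem_erase]
          refine ⟨fun h => ⟨fun h' => hat (h' ▸ h), h2' h⟩, fun ⟨h, h'⟩ => ?_⟩
          by_cases hcb : c = b
          · rwa [hcb]
          exact h1' (by simp [hcb, h, h'])
    connected := by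
      intro x z s t hs hsz ht htz
      by_cases hst : s = t
      · subst hst; exact .refl
      refine .single ⟨hs, hsz, ht, htz, ?_⟩
      obtain ⟨a, ha, rfl⟩ := hcov.1 hsz
      obtain ⟨b, hb, rfl⟩ := hcov.1 htz
      have hab : a ≠ b := fun h => hst (by rw [h])
      refine ⟨(z.erase a).erase b, hcov.2 ⟨b, by simp [hb, hab.symm], rfl⟩,
        hcov.2 ⟨a, by simp [ha, hab], Finset.erase_right_comm⟩⟩ }

variable {M N : Type*} [PartialOrder M] [PartialOrder N]

theorem isGLB_prod_pair {x y : M × N} {m₁ : M} {m₂ : N} (h₁ : IsGLB {x.1, y.1} m₁)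
    (h₂ : IsGLB {x.2, y.2} m₂) : IsGLB {x, y} (m₁, m₂) := by
  rw [isGLB_prod]
  simpa [Set.image_pair] using ⟨h₁, h₂⟩

theorem isLUB_prod_pair {x y : M × N} {m₁ : M} {m₂ : N} (h₁ : IsLUB {x.1, y.1} m₁)
    (h₂ : IsLUB {x.2, y.2} m₂) : IsLUB {x, y} (m₁, m₂) := by
  rw [isLUB_prod]
  simpa [Set.image_pair] using ⟨h₁, h₂⟩

/-- A cover in a product moves exactly one coordinate. So an interval of length two is a diamond of
one factor or a product of two covers, and two coatoms that lower different coordinates share a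
ridge at once. -/
theorem IsGradedPM.prod (hM : IsGradedPM M) (hN : IsGradedPM N) : IsGradedPM (M × N) where
  finite := have := hM.finite; have := hN.finite; inferInstance
  nontrivial := have := hM.nontrivial; have := hN.nontrivial; inferInstance
  exists_inf x y := by
    obtain ⟨m₁, h₁⟩ := hM.exists_inf x.1 y.1
    obtain ⟨m₂, h₂⟩ := hN.exists_inf x.2 y.2
    exact ⟨_, isGLB_prod_pair h₁ h₂⟩
  exists_sup x y := by
    obtain ⟨m₁, h₁⟩ := hM.exists_sup x.1 y.1
    obtain ⟨m₂, h₂⟩ := hN.exists_sup x.2 y.2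
    exact ⟨_, isLUB_prod_pair h₁ h₂⟩
  exists_grading := by
    obtain ⟨r, hr⟩ := hM.exists_grading
    obtain ⟨s, hs⟩ := hN.exists_grading
    refine ⟨fun x => r x.1 + s x.2, fun x y h => ?_⟩
    change r y.1 + s y.2 = r x.1 + s x.2 + 1
    rcases Prod.covBy_iff.1 h with ⟨h1, h2⟩ | ⟨h1, h2⟩
    · rw [hr _ _ h1, h2]; ring
    · rw [hs _ _ h1, h2]; ring
  exists_other := by
    rintro ⟨x₁, x₂⟩ ⟨y₁, y₂⟩ ⟨z₁, z₂⟩ hxy hyz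
    simp only [Prod.mk_covBy_mk_iff] at hxy hyz
    rcases hxy with ⟨h1, rfl⟩ | ⟨h1, rfl⟩ <;> rcases hyz with ⟨h2, rfl⟩ | ⟨h2, rfl⟩
    · obtain ⟨y', e1, e2, e3, e4⟩ := hM.exists_other _ _ _ h1 h2
      refine ⟨(y', x₂), by simpa using e1, by simpa using e2, by simpa using e3, ?_⟩
      rintro ⟨t₁, t₂⟩ ht ht'
      obtain rfl : t₂ = x₂ := le_antisymm ht'.le.2 ht.le.2
      simp only [Prod.mk_lt_mk_iff_left] at ht ht'
      simpa using e4 _ ht ht'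
    · refine ⟨(x₁, z₂), ?_, by simpa using h2.lt, by simpa using h1.lt, ?_⟩
      · simp [h1.lt.ne]
      · rintro ⟨t₁, t₂⟩ ht ht'
        have a1 := h1.eq_or_eq ht.le.1 ht'.le.1
        have a2 := h2.eq_or_eq ht.le.2 ht'.le.2
        rcases a1 with rfl | rfl <;> rcases a2 with rfl | rfl <;> simp at ht ht' ⊢
    · refine ⟨(z₁, x₂), ?_, by simpa using h2.lt, by simpa using h1.lt, ?_⟩
      · simp [h1.lt.ne]
      · rintro ⟨t₁, t₂⟩ ht ht'
        have a1 := h2.eq_or_eq ht.le.1 ht'.le.1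
        have a2 := h1.eq_or_eq ht.le.2 ht'.le.2
        rcases a1 with rfl | rfl <;> rcases a2 with rfl | rfl <;> simp at ht ht' ⊢
    · obtain ⟨y', e1, e2, e3, e4⟩ := hN.exists_other _ _ _ h1 h2
      refine ⟨(x₁, y'), by simpa using e1, by simpa using e2, by simpa using e3, ?_⟩
      rintro ⟨t₁, t₂⟩ ht ht'
      obtain rfl : t₁ = x₁ := le_antisymm ht'.le.1 ht.le.1
      simp only [Prod.mk_lt_mk_iff_right] at ht ht'
      simpa using e4 _ ht ht'
  connected := by
    rintro ⟨x₁, x₂⟩ ⟨z₁, z₂⟩ ⟨s₁, s₂⟩ ⟨t₁, t₂⟩ hs hsz ht htz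
    have hsz' := hsz
    have htz' := htz
    simp only [Prod.mk_covBy_mk_iff] at hsz htz
    rcases hsz with ⟨h1, rfl⟩ | ⟨h1, rfl⟩ <;> rcases htz with ⟨h2, h3⟩ | ⟨h2, h3⟩
    · subst h3
      refine (hM.connected x₁ z₁ s₁ t₁ hs.1 h1 ht.1 h2).lift (fun a => (a, t₂)) ?_
      rintro a b ⟨e1, e2, e3, e4, m, e5, e6⟩
      exact ⟨⟨e1, hs.2⟩, Prod.mk_covBy_mk_iff_left.2 e2, ⟨e3, hs.2⟩, Prod.mk_covBy_mk_iff_left.2 e4,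
        (m, t₂),
        Prod.mk_covBy_mk_iff_left.2 e5, Prod.mk_covBy_mk_iff_left.2 e6⟩
    · subst h3
      exact .single ⟨hs, hsz', ht, htz', (s₁, t₂), Prod.mk_covBy_mk_iff_right.2 h2,
        Prod.mk_covBy_mk_iff_left.2 h1⟩
    · subst h3
      exact .single ⟨hs, hsz', ht, htz', (t₁, s₂), Prod.mk_covBy_mk_iff_left.2 h2,
        Prod.mk_covBy_mk_iff_right.2 h1⟩
    · subst h3
      refine (hN.connected x₂ z₂ s₂ t₂ hs.2 h1 ht.2 h2).lift (fun a => (t₁, a)) ?_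
      rintro a b ⟨e1, e2, e3, e4, m, e5, e6⟩
      exact ⟨⟨hs.1, e1⟩, Prod.mk_covBy_mk_iff_right.2 e2, ⟨hs.1, e3⟩,
        Prod.mk_covBy_mk_iff_right.2 e4, (t₁, m),
        Prod.mk_covBy_mk_iff_right.2 e5, Prod.mk_covBy_mk_iff_right.2 e6⟩

section Join

variable [OrderTop M] [OrderTop N]

theorem Join.eq_top_iff {p : Join M N} : p = ⊤ ↔ p.1.1 = ⊤ := by
  constructor
  · rintro rfl; rfl
  · intro h
    exact Subtype.ext (Prod.ext h (p.2.1 h))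

theorem Join.eq_top_iff' {p : Join M N} : p = ⊤ ↔ p.1.2 = ⊤ :=
  Join.eq_top_iff.trans p.2

theorem Join.mem_of_lt {p q : M × N} (hq : q.1 = ⊤ ↔ q.2 = ⊤) (h : q.1 ≠ ⊤) (hpq : p ≤ q) :
    p.1 = ⊤ ↔ p.2 = ⊤ :=
  iff_of_false (ne_top_of_le_ne_top h hpq.1) (ne_top_of_le_ne_top (fun h' => h (hq.2 h')) hpq.2)

theorem Join.covBy_iff {s z : Join M N} (hz : z ≠ ⊤) : s ⋖ z ↔ s.1 ⋖ z.1 := by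
  have hz' : z.1.1 ≠ ⊤ := fun h => hz (Join.eq_top_iff.2 h)
  constructor
  · intro h
    refine ⟨h.lt, fun t h1 h2 => ?_⟩
    exact h.2 (c := ⟨t, Join.mem_of_lt z.2 hz' h2.le⟩) h1 h2
  · intro h
    exact ⟨h.lt, fun t h1 h2 => h.2 (c := t.1) h1 h2⟩

theorem Join.covBy_top_iff {s : Join M N} : s ⋖ ⊤ ↔ s.1.1 ⋖ ⊤ ∧ s.1.2 ⋖ ⊤ := by
  constructor
  · intro h
    have hs : s ≠ ⊤ := h.lt.ne
    have h1 : s.1.1 ≠ ⊤ := fun h => hs (Join.eq_top_iff.2 h)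
    have h2 : s.1.2 ≠ ⊤ := fun h => hs (Join.eq_top_iff'.2 h)
    refine ⟨⟨h1.lt_top, fun c hc hc' => ?_⟩, ⟨h2.lt_top, fun c hc hc' => ?_⟩⟩
    · let q : Join M N := ⟨(c, s.1.2), iff_of_false hc'.ne h2⟩
      refine h.2 (c := q) ?_ (lt_top_iff_ne_top.2 fun h => hc'.ne (Join.eq_top_iff.1 h))
      exact lt_of_le_of_ne (show s.1 ≤ (c, s.1.2) from ⟨hc.le, le_rfl⟩) (fun h => hc.ne (by rw [h]))
    · let q : Join M N := ⟨(s.1.1, c), iff_of_false h1 hc'.ne⟩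
      refine h.2 (c := q) ?_ (lt_top_iff_ne_top.2 fun h => hc'.ne (Join.eq_top_iff'.1 h))
      exact lt_of_le_of_ne (show s.1 ≤ (s.1.1, c) from ⟨le_rfl, hc.le⟩) (fun h => hc.ne (by rw [h]))
  · rintro ⟨h1, h2⟩
    refine ⟨lt_top_iff_ne_top.2 fun h => h1.lt.ne (Join.eq_top_iff.1 h), fun t ht ht' => ?_⟩
    have e1 : t.1.1 ≠ ⊤ := fun h => ht'.ne (Join.eq_top_iff.2 h)
    have e2 : t.1.2 ≠ ⊤ := fun h => ht'.ne (Join.eq_top_iff'.2 h)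
    have hle : s.1 ≤ t.1 := ht.le
    have e3 := (h1.eq_or_eq hle.1 le_top).resolve_right e1
    have e4 := (h2.eq_or_eq hle.2 le_top).resolve_right e2
    exact ht.ne (Subtype.ext (Prod.ext e3.symm e4.symm))

/-- The step from a pair of coatoms to the top raises both coordinates at once, so the top receives
one less than the sum. -/
theorem Join.exists_grading {r : M → ℕ} {s : N → ℕ} (hr : ∀ x y, x ⋖ y → r y = r x + 1)
    (hs : ∀ x y, x ⋖ y → s y = s x + 1) : ∃ g : Join M N → ℕ, (∀ x y, x ⋖ y → g y = g x + 1) ∧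
      g ⊤ = r ⊤ + s ⊤ - 1 ∧ ∀ x, x ≠ ⊤ → g x = r x.1.1 + s x.1.2 := by
  classical
  refine ⟨fun x => if x = ⊤ then r ⊤ + s ⊤ - 1 else r x.1.1 + s x.1.2, ?_, by simp, ?_⟩
  · intro x y h
    have hx : x ≠ ⊤ := h.lt.ne_top
    by_cases hy : y = ⊤
    · subst hy
      obtain ⟨h1, h2⟩ := Join.covBy_top_iff.1 h
      have := hr _ _ h1
      have := hs _ _ h2
      simp only [if_true, if_neg hx]
      omega
    · simp only [if_neg hy, if_neg hx]
      rcases Prod.covBy_iff.1 ((Join.covBy_iff hy).1 h) with ⟨h1, h2⟩ | ⟨h1, h2⟩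
      · rw [hr _ _ h1, h2]; ring
      · rw [hs _ _ h1, h2]; ring
  · intro x hx
    simp [hx]

/-- Below a proper element the join is just the product, so only intervals ending at the top need a
new argument. The coatoms of the join are the pairs of coatoms, which lets each coordinate be
treated separately. -/
theorem IsGradedPM.join (hM : IsGradedPM M) (hN : IsGradedPM N) : IsGradedPM (Join M N) where
  finite := have := hM.finite; have := hN.finite; Subtype.finite
  nontrivial := by
    have := hM.nontrivial
    have := hN.nontrivial
    obtain ⟨a, ha⟩ := exists_ne (⊤ : M)
    obtain ⟨b, hb⟩ := exists_ne (⊤ : N)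
    exact ⟨⟨⟨(a, b), iff_of_false ha hb⟩, ⊤, fun h => ha (Join.eq_top_iff.1 h)⟩⟩
  exists_inf x y := by
    obtain ⟨m₁, h₁⟩ := hM.exists_inf x.1.1 y.1.1
    obtain ⟨m₂, h₂⟩ := hN.exists_inf x.1.2 y.1.2
    have h := isGLB_prod_pair h₁ h₂
    have e1 : m₁ = ⊤ ↔ x.1.1 = ⊤ ∧ y.1.1 = ⊤ := by
      rw [← top_le_iff, le_isGLB_iff h₁]; simp [lowerBounds]
    have e2 : m₂ = ⊤ ↔ x.1.2 = ⊤ ∧ y.1.2 = ⊤ := by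
      rw [← top_le_iff, le_isGLB_iff h₂]; simp [lowerBounds]
    refine ⟨⟨(m₁, m₂), by rw [e1, e2, x.2, y.2]⟩, ⟨?_, ?_⟩⟩
    · rintro a (rfl | rfl)
      · exact h.1 (by simp)
      · exact h.1 (by simp)
    · intro b hb
      refine h.2 ?_
      rintro a (rfl | rfl)
      · exact hb (by simp)
      · exact hb (by simp)
  exists_sup x y := by
    obtain ⟨m₁, h₁⟩ := hM.exists_sup x.1.1 y.1.1
    obtain ⟨m₂, h₂⟩ := hN.exists_sup x.1.2 y.1.2
    have h := isLUB_prod_pair h₁ h₂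
    have hle : ∀ b ∈ upperBounds {x, y}, (m₁, m₂) ≤ b.1 := by
      intro b hb
      refine h.2 ?_
      rintro a (rfl | rfl)
      · exact hb (by simp)
      · exact hb (by simp)
    -- If one coordinate of the product supremum is improper, the only element of the join above it
    -- is the top.
    by_cases e : m₁ = ⊤ ∨ m₂ = ⊤
    · refine ⟨⊤, fun _ _ => le_top, fun b hb => ?_⟩
      have := hle b hb
      rcases e with rfl | rfl
      · exact (Join.eq_top_iff.2 (top_le_iff.1 this.1)).ge
      · exact (Join.eq_top_iff'.2 (top_le_iff.1 this.2)).ge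
    · push Not at e
      refine ⟨⟨(m₁, m₂), iff_of_false e.1 e.2⟩, ?_, hle⟩
      rintro a (rfl | rfl)
      · exact h.1 (by simp)
      · exact h.1 (by simp)
  exists_grading := by
    obtain ⟨r, hr⟩ := hM.exists_grading
    obtain ⟨s, hs⟩ := hN.exists_grading
    obtain ⟨g, hg, -⟩ := Join.exists_grading hr hs
    exact ⟨g, hg⟩
  exists_other := by
    intro x y z hxy hyz
    have hy : y ≠ ⊤ := hyz.lt.ne_top
    have hxy' := (Join.covBy_iff hy).1 hxy
    by_cases hz : z = ⊤
    · subst hz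
      obtain ⟨h1, h2⟩ := Join.covBy_top_iff.1 hyz
      rcases Prod.covBy_iff.1 hxy' with ⟨e1, e2⟩ | ⟨e1, e2⟩
      · obtain ⟨c, c1, c2, c3, c4⟩ := hM.exists_other _ _ _ e1 h1
        refine ⟨⟨(c, y.1.2), iff_of_false c3.ne h2.lt.ne⟩, ?_, ?_, ?_, ?_⟩
        · exact fun h => c1 (by rw [← h])
        · exact lt_of_le_of_ne (show x.1 ≤ (c, y.1.2) from ⟨c2.le, e2.le⟩)
            (fun h => c2.ne (by rw [h]))
        · exact lt_top_iff_ne_top.2 fun h => c3.ne (Join.eq_top_iff.1 h)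
        · intro t ht ht'
          have hle : x.1 ≤ t.1 := ht.le
          have a1 : t.1.1 ≠ ⊤ := fun h => ht'.ne (Join.eq_top_iff.2 h)
          have a2 : t.1.2 ≠ ⊤ := fun h => ht'.ne (Join.eq_top_iff'.2 h)
          have a3 := (h2.eq_or_eq (e2 ▸ hle.2) le_top).resolve_right a2
          have a4 : x.1.1 < t.1.1 := lt_of_le_of_ne hle.1
            fun h => ht.ne (Subtype.ext (Prod.ext h (e2.trans a3.symm)))
          exact (c4 _ a4 a1.lt_top).imp (fun h => Subtype.ext (Prod.ext h a3))
            (fun h => Subtype.ext (Prod.ext h a3))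
      · obtain ⟨c, c1, c2, c3, c4⟩ := hN.exists_other _ _ _ e1 h2
        refine ⟨⟨(y.1.1, c), iff_of_false h1.lt.ne c3.ne⟩, ?_, ?_, ?_, ?_⟩
        · exact fun h => c1 (by rw [← h])
        · exact lt_of_le_of_ne (show x.1 ≤ (y.1.1, c) from ⟨e2.le, c2.le⟩)
            (fun h => c2.ne (by rw [h]))
        · exact lt_top_iff_ne_top.2 fun h => c3.ne (Join.eq_top_iff'.1 h)
        · intro t ht ht'
          have hle : x.1 ≤ t.1 := ht.le
          have a1 : t.1.1 ≠ ⊤ := fun h => ht'.ne (Join.eq_top_iff.2 h)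
          have a2 : t.1.2 ≠ ⊤ := fun h => ht'.ne (Join.eq_top_iff'.2 h)
          have a3 := (h1.eq_or_eq (e2 ▸ hle.1) le_top).resolve_right a1
          have a4 : x.1.2 < t.1.2 := lt_of_le_of_ne hle.2
            fun h => ht.ne (Subtype.ext (Prod.ext (e2.trans a3.symm) h))
          exact (c4 _ a4 a2.lt_top).imp (fun h => Subtype.ext (Prod.ext a3 h))
            (fun h => Subtype.ext (Prod.ext a3 h))
    · have hz' : z.1.1 ≠ ⊤ := fun h => hz (Join.eq_top_iff.2 h)
      obtain ⟨y', h1, h2, h3, h4⟩ := (hM.prod hN).exists_other _ _ _ hxy'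
        ((Join.covBy_iff hz).1 hyz)
      refine ⟨⟨y', Join.mem_of_lt z.2 hz' h3.le⟩, fun h => h1 (by rw [← h]), h2, h3, ?_⟩
      intro t ht ht'
      exact (h4 t.1 ht ht').imp Subtype.ext Subtype.ext
  connected := by
    intro x z s t hs hsz ht htz
    by_cases hz : z = ⊤
    · subst hz
      obtain ⟨s1, s2⟩ := Join.covBy_top_iff.1 hsz
      obtain ⟨t1, t2⟩ := Join.covBy_top_iff.1 htz
      have hs' : x.1 ≤ s.1 := hs
      have ht' : x.1 ≤ t.1 := ht
      -- The walk of coatoms first changes the first coordinate with `s.1.2` fixed, then the second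
      -- with `t.1.1` fixed.
      have step1 : ∀ a, Relation.ReflTransGen (FacetAdj x.1.1 ⊤) s.1.1 a → ∃ ha,
          Relation.ReflTransGen (FacetAdj x ⊤) s ⟨(a, s.1.2), ha⟩ := by
        intro a h
        induction h with
        | refl => exact ⟨s.2, .refl⟩
        | tail _ hab ih =>
          obtain ⟨ha, ih⟩ := ih
          obtain ⟨h1, h2, h3, h4, m, h5, h6⟩ := hab
          refine ⟨iff_of_false h4.lt.ne s2.lt.ne, ih.tail ⟨⟨h1, hs'.2⟩,
            Join.covBy_top_iff.2 ⟨h2, s2⟩, ⟨h3, hs'.2⟩, Join.covBy_top_iff.2 ⟨h4, s2⟩,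
            ⟨(m, s.1.2), iff_of_false (h5.lt.trans h2.lt).ne s2.lt.ne⟩, ?_, ?_⟩⟩
          · exact (Join.covBy_iff fun h => h2.lt.ne (Join.eq_top_iff.1 h)).2
              (Prod.mk_covBy_mk_iff_left.2 h5)
          · exact (Join.covBy_iff fun h => h4.lt.ne (Join.eq_top_iff.1 h)).2
              (Prod.mk_covBy_mk_iff_left.2 h6)
      obtain ⟨hu, step1⟩ := step1 _ (hM.connected _ _ _ _ hs'.1 s1 ht'.1 t1)
      have step2 : ∀ a, Relation.ReflTransGen (FacetAdj x.1.2 ⊤) s.1.2 a → ∃ ha,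
          Relation.ReflTransGen (FacetAdj x ⊤) s ⟨(t.1.1, a), ha⟩ := by
        intro a h
        induction h with
        | refl => exact ⟨hu, step1⟩
        | tail _ hab ih =>
          obtain ⟨ha, ih⟩ := ih
          obtain ⟨h1, h2, h3, h4, m, h5, h6⟩ := hab
          refine ⟨iff_of_false t1.lt.ne h4.lt.ne, ih.tail ⟨⟨ht'.1, h1⟩,
            Join.covBy_top_iff.2 ⟨t1, h2⟩, ⟨ht'.1, h3⟩, Join.covBy_top_iff.2 ⟨t1, h4⟩,
            ⟨(t.1.1, m), iff_of_false t1.lt.ne (h5.lt.trans h2.lt).ne⟩, ?_, ?_⟩⟩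
          · exact (Join.covBy_iff fun h => h2.lt.ne (Join.eq_top_iff'.1 h)).2
              (Prod.mk_covBy_mk_iff_right.2 h5)
          · exact (Join.covBy_iff fun h => h4.lt.ne (Join.eq_top_iff'.1 h)).2
              (Prod.mk_covBy_mk_iff_right.2 h6)
      obtain ⟨_, step2⟩ := step2 _ (hN.connected _ _ _ _ hs'.2 s2 ht'.2 t2)
      exact step2
    · have hz' : z.1.1 ≠ ⊤ := fun h => hz (Join.eq_top_iff.2 h)
      have key : ∀ a, Relation.ReflTransGen (FacetAdj x.1 z.1) s.1 a → ∃ ha,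
          Relation.ReflTransGen (FacetAdj x z) s ⟨a, ha⟩ := by
        intro a h
        induction h with
        | refl => exact ⟨s.2, .refl⟩
        | tail _ hab ih =>
          obtain ⟨ha, ih⟩ := ih
          obtain ⟨h1, h2, h3, h4, m, h5, h6⟩ := hab
          have hne : ∀ {p : M × N} {hp}, p ⋖ z.1 → (show Join M N from ⟨p, hp⟩) ≠ ⊤ := fun hp h =>
            ne_top_of_le_ne_top hz' hp.le.1 (Join.eq_top_iff.1 h)
          exact ⟨Join.mem_of_lt z.2 hz' h4.le, ih.tail ⟨h1, (Join.covBy_iff hz).2 h2, h3,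
            (Join.covBy_iff hz).2 h4, ⟨m, Join.mem_of_lt z.2 hz' (h5.le.trans h2.le)⟩,
            (Join.covBy_iff (hne h2)).2 h5, (Join.covBy_iff (hne h4)).2 h6⟩⟩
      obtain ⟨_, h⟩ := key _ ((hM.prod hN).connected _ _ _ _ hs ((Join.covBy_iff hz).1 hsz) ht
        ((Join.covBy_iff hz).1 htz))
      exact h

end Join

section RankTop

theorem rank_top_prod [OrderTop M] [OrderTop N] (hM : IsGradedPM M) (hN : IsGradedPM N) :
    rank (⊤ : M × N) = rank (⊤ : M) + rank (⊤ : N) := by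
  have := hM.finite
  have := hN.finite
  obtain ⟨a, ha⟩ := hM.exists_isBot
  obtain ⟨b, hb⟩ := hN.exists_isBot
  have h : IsBot ((a, b) : M × N) := fun x => ⟨ha x.1, hb x.2⟩
  have := rank_add_grading h (r := fun x => rank x.1 + rank x.2) (fun x y h => by
    rcases Prod.covBy_iff.1 h with ⟨h1, h2⟩ | ⟨h1, h2⟩
    · simp only [hM.rank_of_covBy h1, h2]; ring
    · simp only [hN.rank_of_covBy h1, h2]; ring) ⊤
  simpa [rank_of_isBot ha, rank_of_isBot hb] using this

theorem rank_top_join [OrderTop M] [OrderTop N] (hM : IsGradedPM M) (hN : IsGradedPM N) :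
    rank (⊤ : Join M N) + 1 = rank (⊤ : M) + rank (⊤ : N) := by
  have := hM.finite
  have := hN.finite
  have := hM.nontrivial
  have := hN.nontrivial
  have := (hM.join hN).finite
  obtain ⟨a, ha⟩ := hM.exists_isBot
  obtain ⟨b, hb⟩ := hN.exists_isBot
  have ha' : a < ⊤ := by
    obtain ⟨c, hc⟩ := exists_ne (⊤ : M)
    exact (ha c).trans_lt hc.lt_top
  have hb' : b < ⊤ := by
    obtain ⟨c, hc⟩ := exists_ne (⊤ : N)
    exact (hb c).trans_lt hc.lt_top
  obtain ⟨g, h1, h2, h3⟩ := Join.exists_grading (M := M) (N := N)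
    (fun _ _ => hM.rank_of_covBy) (fun _ _ => hN.rank_of_covBy)
  let q : Join M N := ⟨(a, b), iff_of_false ha'.ne hb'.ne⟩
  have hq : IsBot q := fun x => ⟨ha x.1.1, hb x.1.2⟩
  have e1 := rank_add_grading hq h1 ⊤
  have e2 := h3 q (fun h => ha'.ne (Join.eq_top_iff.1 h))
  rw [h2, e2] at e1
  have e3 : rank q.1.1 = 0 := rank_of_isBot ha
  have e4 : rank q.1.2 = 0 := rank_of_isBot hb
  have := rank_lt_rank ha'
  have := rank_lt_rank hb'
  omega

theorem rank_top_finset (α : Type*) [Fintype α] : rank (⊤ : Finset α) = Fintype.card α := by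
  have h : IsBot (∅ : Finset α) := fun x => Finset.empty_subset x
  have := rank_add_grading h (r := Finset.card) (fun x y h => by
    classical
    obtain ⟨a, ha, rfl⟩ := Finset.covBy_iff_exists_erase.1 h
    rw [Finset.card_erase_add_one ha]) ⊤
  simpa using this

end RankTop

end Closure

end CellPM

namespace CellPM

/-! ### Set-theoretic models: faces as vertex sets described by four colours -/

section FaceSets

/-- The sets on a disjoint union whose two parts are faces. -/
def prodFaces {V W : Type*} (R : Set (Set V)) (Q : Set (Set W)) : Set (Set (V ⊕ W)) :=
  {S | Sum.inl ⁻¹' S ∈ R ∧ Sum.inr ⁻¹' S ∈ Q}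

/-- The sets on a disjoint union whose two parts are faces, both proper or both improper. -/
def joinFaces {V W : Type*} (R : Set (Set V)) (Q : Set (Set W)) : Set (Set (V ⊕ W)) :=
  {S | S ∈ prodFaces R Q ∧ (Sum.inl ⁻¹' S = Set.univ ↔ Sum.inr ⁻¹' S = Set.univ)}

/-- The sets `S` such that `S` contains all vertices of colour `1` iff it contains all vertices of
colour `2`, and contains all vertices of colour `0` iff it contains all the others. -/
def splitFaces {V : Type*} (κ : V → Fin 4) : Set (Set V) :=
  {S | ((∀ v, κ v = 1 → v ∈ S) ↔ (∀ v, κ v = 2 → v ∈ S)) ∧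
    ((∀ v, κ v = 0 → v ∈ S) ↔
      (∀ v, κ v = 1 → v ∈ S) ∧ (∀ v, κ v = 2 → v ∈ S) ∧ (∀ v, κ v = 3 → v ∈ S))}

/-- The split faces of the vertex set with `n i` vertices of colour `i`. -/
abbrev Model (n : Fin 4 → ℕ) : Type := splitFaces (Sigma.fst : (Σ i, Fin (n i)) → Fin 4)

variable {V W : Type*}

theorem preimage_mem_splitFaces_iff {κ : V → Fin 4} {κ' : W → Fin 4} (f : V ≃ W)
    (h : ∀ v, κ' (f v) = κ v) (S : Set W) : f ⁻¹' S ∈ splitFaces κ ↔ S ∈ splitFaces κ' := by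
  have key : ∀ i : Fin 4, (∀ v, κ v = i → f v ∈ S) ↔ (∀ w, κ' w = i → w ∈ S) := by
    intro i
    constructor
    · intro hS w hw
      have := hS (f.symm w) (by rw [← h, f.apply_symm_apply, hw])
      simpa using this
    · intro hS v hv
      exact hS _ (by rw [h, hv])
  simp only [splitFaces, Set.mem_ofPred_eq, Set.mem_preimage, key]

/-- A colour-preserving bijection of the vertices induces an isomorphism of the lattices. -/
def splitFacesCongr {κ : V → Fin 4} {κ' : W → Fin 4} (f : V ≃ W) (h : ∀ v, κ' (f v) = κ v) :
    splitFaces κ ≃o splitFaces κ' where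
  toFun S := ⟨f '' S, by
    rw [← preimage_mem_splitFaces_iff f h, Set.preimage_image_eq _ f.injective]; exact S.2⟩
  invFun S := ⟨f ⁻¹' S, (preimage_mem_splitFaces_iff f h S).2 S.2⟩
  left_inv S := Subtype.ext (Set.preimage_image_eq _ f.injective)
  right_inv S := Subtype.ext (Set.image_preimage_eq _ f.surjective)
  map_rel_iff' := Set.image_subset_image_iff f.injective

theorem nonempty_splitFaces_orderIso_of_card [Finite V] [Finite W] {κ : V → Fin 4}
    {κ' : W → Fin 4} (h : ∀ i, Nat.card {v // κ v = i} = Nat.card {w // κ' w = i}) :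
    Nonempty (splitFaces κ ≃o splitFaces κ') := by
  have e : ∀ i, Nonempty ({v // κ v = i} ≃ {w // κ' w = i}) := fun i =>
    Finite.card_eq.1 (h i)
  exact ⟨splitFacesCongr (Equiv.ofFiberEquiv fun i => (e i).some)
    (fun v => Equiv.ofFiberEquiv_map _ v)⟩

theorem card_sigma_fiber (n : Fin 4 → ℕ) (i : Fin 4) :
    Nat.card {v : Σ i, Fin (n i) // v.1 = i} = n i := by
  rw [Nat.card_congr (Equiv.sigmaSubtype (β := fun i => Fin (n i)) i)]
  simp

theorem nonempty_orderIso_model [Finite V] {κ : V → Fin 4} {n : Fin 4 → ℕ}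
    (h : ∀ i, Nat.card {v // κ v = i} = n i) : Nonempty (splitFaces κ ≃o Model n) :=
  nonempty_splitFaces_orderIso_of_card fun i => by rw [h, card_sigma_fiber]

variable {M N : Type*} [PartialOrder M] [PartialOrder N] {R : Set (Set V)} {Q : Set (Set W)}

/-- The order isomorphism of a product of face lattices with the lattice of pairs of faces. -/
def prodFacesIso (e : M ≃o R) (f : N ≃o Q) : M × N ≃o prodFaces R Q where
  toFun p := ⟨Sum.inl '' (e p.1 : Set V) ∪ Sum.inr '' (f p.2 : Set W), by
    simp [prodFaces, Set.preimage_image_eq _ Sum.inl_injective,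
      Set.preimage_image_eq _ Sum.inr_injective]⟩
  invFun S := (e.symm ⟨_, S.2.1⟩, f.symm ⟨_, S.2.2⟩)
  left_inv p := by
    apply Prod.ext
    · simp [Set.preimage_image_eq _ Sum.inl_injective]
    · simp [Set.preimage_image_eq _ Sum.inr_injective]
  right_inv S := by
    apply Subtype.ext
    ext (v | v) <;> simp
  map_rel_iff' := by
    rintro ⟨a, b⟩ ⟨c, d⟩
    rw [Prod.mk_le_mk, ← e.le_iff_le, ← f.le_iff_le]
    change Sum.inl '' (e a : Set V) ∪ Sum.inr '' (f b : Set W) ⊆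
      Sum.inl '' (e c : Set V) ∪ Sum.inr '' (f d : Set W) ↔
      (e a : Set V) ⊆ e c ∧ (f b : Set W) ⊆ f d
    constructor
    · intro h
      constructor
      · intro v hv
        simpa using h (Or.inl ⟨v, hv, rfl⟩)
      · intro v hv
        simpa using h (Or.inr ⟨v, hv, rfl⟩)
    · rintro ⟨h1, h2⟩
      exact Set.union_subset_union (Set.image_mono h1) (Set.image_mono h2)

theorem eq_top_iff_coe_eq_univ [OrderTop M] (hR : Set.univ ∈ R) (e : M ≃o R) (x : M) :
    x = ⊤ ↔ (e x : Set V) = Set.univ := by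
  rw [← top_le_iff, ← e.le_iff_le]
  have : e ⊤ = ⟨Set.univ, hR⟩ := by
    have h : e (e.symm ⟨Set.univ, hR⟩) ≤ e ⊤ := e.le_iff_le.2 le_top
    rw [e.apply_symm_apply] at h
    exact Subtype.ext (Set.univ_subset_iff.1 h)
  rw [this, ← Set.univ_subset_iff]
  rfl

/-- The order isomorphism of a join of face lattices with the lattice of matching pairs. -/
def joinFacesIso [OrderTop M] [OrderTop N] (hR : Set.univ ∈ R) (hQ : Set.univ ∈ Q)
    (e : M ≃o R) (f : N ≃o Q) : Join M N ≃o joinFaces R Q where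
  toFun p := ⟨(prodFacesIso e f p.1 : Set (V ⊕ W)), (prodFacesIso e f p.1).2, by
    have h := p.2
    rw [eq_top_iff_coe_eq_univ hR e, eq_top_iff_coe_eq_univ hQ f] at h
    simpa [prodFacesIso, Set.preimage_image_eq _ Sum.inl_injective,
      Set.preimage_image_eq _ Sum.inr_injective] using h⟩
  invFun S := ⟨(prodFacesIso e f).symm ⟨S.1, S.2.1⟩, by
    rw [eq_top_iff_coe_eq_univ hR e, eq_top_iff_coe_eq_univ hQ f]
    simpa [prodFacesIso] using S.2.2⟩
  left_inv p := by
    apply Subtype.ext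
    exact (prodFacesIso e f).symm_apply_apply p.1
  right_inv S := by
    apply Subtype.ext
    have := congrArg Subtype.val ((prodFacesIso e f).apply_symm_apply ⟨S.1, S.2.1⟩)
    exact this
  map_rel_iff' {p q} := (prodFacesIso e f).le_iff_le (x := p.1) (y := q.1)

theorem univ_mem_prodFaces (hR : Set.univ ∈ R) (hQ : Set.univ ∈ Q) :
    Set.univ ∈ prodFaces R Q := ⟨hR, hQ⟩

theorem univ_mem_joinFaces (hR : Set.univ ∈ R) (hQ : Set.univ ∈ Q) :
    Set.univ ∈ joinFaces R Q := ⟨⟨hR, hQ⟩, by simp⟩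

/-- Finite sets in a finite type are the same as sets. -/
noncomputable def finsetIso (α : Type*) [Finite α] :
    Finset α ≃o (Set.univ : Set (Set α)) where
  toFun s := ⟨s, trivial⟩
  invFun S := (Set.toFinite S.1).toFinset
  left_inv s := by simp
  right_inv S := by simp
  map_rel_iff' := by
    intro a b
    exact Finset.coe_subset

/-- The inner join ties fullness on colour 1 to fullness on colour 2, and the outer one ties these
to colour 0; colour 3 does not occur, so its condition is vacuous. -/
theorem familyOne_faces (α β γ : Type*) :
    joinFaces (joinFaces (Set.univ : Set (Set α)) (Set.univ : Set (Set β)))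
      (Set.univ : Set (Set γ)) =
      splitFaces (Sum.elim (Sum.elim (fun _ => 1) (fun _ => 2)) (fun _ => 0)) := by
  ext S
  simp [joinFaces, prodFaces, splitFaces, Set.eq_univ_iff_forall]
  tauto

theorem familyTwo_faces (α β γ δ : Type*) :
    joinFaces (prodFaces (joinFaces (Set.univ : Set (Set α)) (Set.univ : Set (Set β)))
      (Set.univ : Set (Set γ))) (Set.univ : Set (Set δ)) =
      splitFaces (Sum.elim (Sum.elim (Sum.elim (fun _ => 1) (fun _ => 2)) (fun _ => 3))
        (fun _ => 0)) := by
  ext S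
  simp [joinFaces, prodFaces, splitFaces, Set.eq_univ_iff_forall]
  tauto

/-- The vertex numbers of a member of the first family. -/
def numsOne (b₁ b₂ b₃ : ℤ) : Fin 4 → ℕ :=
  ![(b₃ + 2).toNat, (b₁ + 2).toNat, (b₂ + 2).toNat, 0]

/-- The vertex numbers of a member of the second family. -/
def numsTwo (d₁ d₂ d₃ d₄ : ℤ) : Fin 4 → ℕ :=
  ![(d₄ + 2).toNat, (d₁ + 2).toNat, (d₂ + 2).toNat, (d₃ + 2).toNat]

theorem card_fiber_sumElim {α β : Type*} [Finite α] [Finite β] (f : α → Fin 4) (g : β → Fin 4)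
    (i : Fin 4) : Nat.card {v // Sum.elim f g v = i} =
      Nat.card {a // f a = i} + Nat.card {b // g b = i} := by
  rw [← Nat.card_sum]
  exact Nat.card_congr Equiv.subtypeSum

theorem card_fiber_const (k : ℕ) (c i : Fin 4) :
    Nat.card {_v : Fin k // c = i} = if c = i then k else 0 := by
  split_ifs with h <;> simp [h]

theorem familyOne_orderIso (b₁ b₂ b₃ : ℤ) :
    Nonempty (FamilyOne b₁ b₂ b₃ ≃o Model (numsOne b₁ b₂ b₃)) := by
  have e := joinFacesIso (univ_mem_joinFaces (Set.mem_univ _) (Set.mem_univ _)) (Set.mem_univ _)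
    (joinFacesIso (Set.mem_univ _) (Set.mem_univ _) (finsetIso (Fin (b₁ + 2).toNat)) (finsetIso
      (Fin (b₂ + 2).toNat)))
    (finsetIso (Fin (b₃ + 2).toNat))
  rw [familyOne_faces] at e
  refine ⟨e.trans (nonempty_orderIso_model fun i => ?_).some⟩
  rw [card_fiber_sumElim, card_fiber_sumElim, card_fiber_const, card_fiber_const, card_fiber_const]
  fin_cases i <;> simp [numsOne]

theorem familyTwo_orderIso (d₁ d₂ d₃ d₄ : ℤ) :
    Nonempty (FamilyTwo d₁ d₂ d₃ d₄ ≃o Model (numsTwo d₁ d₂ d₃ d₄)) := by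
  have e := joinFacesIso (univ_mem_prodFaces (univ_mem_joinFaces (Set.mem_univ _) (Set.mem_univ _))
    (Set.mem_univ _)) (Set.mem_univ _)
    (prodFacesIso (joinFacesIso (Set.mem_univ _) (Set.mem_univ _) (finsetIso (Fin (d₁ + 2).toNat))
      (finsetIso (Fin (d₂ + 2).toNat))) (finsetIso (Fin (d₃ + 2).toNat)))
    (finsetIso (Fin (d₄ + 2).toNat))
  rw [familyTwo_faces] at e
  refine ⟨e.trans (nonempty_orderIso_model fun i => ?_).some⟩
  rw [card_fiber_sumElim, card_fiber_sumElim, card_fiber_sumElim, card_fiber_const,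
    card_fiber_const, card_fiber_const, card_fiber_const]
  fin_cases i <;> simp [numsTwo]

end FaceSets

end CellPM

namespace CellPM

/-! ### The combinatorics of cofacets: a complete bipartite graph -/

section Coloring

variable {V : Type*}

/-- A set is closed for a family if its complement is a union of members of the family. -/
def ClosedFor (𝒞 : Set (Set V)) (S : Set V) : Prop :=
  ∀ v, v ∉ S → ∃ C ∈ 𝒞, v ∈ C ∧ ∀ u ∈ C, u ∉ S

/-- By contraposition, the conditions of `splitFaces` say that colours 1 and 2 are missed together,
and that colour 0 is missed exactly when some other colour is. Hence the complement of a face is a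
union of sets {a, p} with colours 0, 3 and {a, x, y} with colours 0, 1, 2: these are the cofacets.
-/
theorem mem_splitFaces_iff (κ : V → Fin 4) (S : Set V) : S ∈ splitFaces κ ↔ ∀ v, v ∉ S →
    (∃ a p, κ a = 0 ∧ κ p = 3 ∧ a ∉ S ∧ p ∉ S ∧ (v = a ∨ v = p)) ∨
    (∃ a x y, κ a = 0 ∧ κ x = 1 ∧ κ y = 2 ∧ a ∉ S ∧ x ∉ S ∧ y ∉ S ∧ (v = a ∨ v = x ∨ v = y)) := by
  constructor
  · rintro ⟨h1, h2⟩ v hv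
    have n12 : (∃ v, κ v = 1 ∧ v ∉ S) ↔ (∃ v, κ v = 2 ∧ v ∉ S) := by
      have := not_congr h1
      push Not at this
      exact this
    have n0 : (∃ v, κ v = 0 ∧ v ∉ S) ↔
        ((∃ v, κ v = 1 ∧ v ∉ S) ∨ (∃ v, κ v = 2 ∧ v ∉ S) ∨ (∃ v, κ v = 3 ∧ v ∉ S)) := by
      have := not_congr h2
      simp only [not_and_or] at this
      push Not at this
      exact this
    have hc : κ v = 0 ∨ κ v = 1 ∨ κ v = 2 ∨ κ v = 3 := by omega
    rcases hc with hc | hc | hc | hc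
    · have h12 : (∃ v, κ v = 1 ∧ v ∉ S) → _ := fun h =>
        show (∃ a x y, κ a = 0 ∧ κ x = 1 ∧ κ y = 2 ∧ a ∉ S ∧ x ∉ S ∧ y ∉ S ∧
          (v = a ∨ v = x ∨ v = y)) from by
        obtain ⟨y, hy, hyS⟩ := n12.1 h
        obtain ⟨x, hx, hxS⟩ := h
        exact ⟨v, x, y, hc, hx, hy, hv, hxS, hyS, .inl rfl⟩
      rcases n0.1 ⟨v, hc, hv⟩ with h | h | ⟨p, hp, hpS⟩
      · exact .inr (h12 h)
      · exact .inr (h12 (n12.2 h))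
      · exact .inl ⟨v, p, hc, hp, hv, hpS, .inl rfl⟩
    · obtain ⟨y, hy, hyS⟩ := n12.1 ⟨v, hc, hv⟩
      obtain ⟨a, ha, haS⟩ := n0.2 (.inl ⟨v, hc, hv⟩)
      exact .inr ⟨a, v, y, ha, hc, hy, haS, hv, hyS, .inr (.inl rfl)⟩
    · obtain ⟨x, hx, hxS⟩ := n12.2 ⟨v, hc, hv⟩
      obtain ⟨a, ha, haS⟩ := n0.2 (.inr (.inl ⟨v, hc, hv⟩))
      exact .inr ⟨a, x, v, ha, hx, hc, haS, hxS, hv, .inr (.inr rfl)⟩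
    · obtain ⟨a, ha, haS⟩ := n0.2 (.inr (.inr ⟨v, hc, hv⟩))
      exact .inl ⟨a, v, ha, hc, haS, hv, .inr rfl⟩
  · intro h
    refine ⟨⟨fun h1 v hv => ?_, fun h1 v hv => ?_⟩,
      ⟨fun h1 => ⟨fun v hv => ?_, fun v hv => ?_, fun v hv => ?_⟩, fun ⟨h1, h2, h3⟩ v hv => ?_⟩⟩ <;>
    · by_contra hS
      rcases h v hS with ⟨a, p, ha, hp, haS, hpS, hvv⟩ | ⟨a, x, y, ha, hx, hy, haS, hxS, hyS, hvv⟩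
      · rcases hvv with rfl | rfl <;> simp_all
      · rcases hvv with rfl | rfl | rfl <;> simp_all

/-- A class with at most two vertices is covered by a pair from that class. The pair is a face, and
a face that contains class 0, 1 or 2 contains another nonempty class as well, for which the pair has
no room. -/
theorem three_le_card_fiber [Finite V] {κ : V → Fin 4} (hpairs : ∀ u v : V, {u, v} ∈ splitFaces κ)
    (h0 : ∃ v, κ v = 0) (h1 : ∃ v, κ v = 1) (h2 : ∃ v, κ v = 2) (i : Fin 4) (hi : i ≠ 3) :
    3 ≤ Nat.card {v // κ v = i} := by
  by_contra hlt
  have hlt' : ¬ 2 < {v | κ v = i}.ncard := by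
    rw [← Nat.card_coe_set_eq]
    exact fun h => hlt h
  have hcover : ∀ u, κ u = i → ∃ v, κ v = i ∧ ∀ w, κ w = i → w ∈ ({u, v} : Set V) := by
    intro u hu
    by_cases hall : ∀ w, κ w = i → w = u
    · exact ⟨u, hu, fun w hw => .inl (hall w hw)⟩
    · push Not at hall
      obtain ⟨v, hv, hvu⟩ := hall
      refine ⟨v, hv, fun w hw => ?_⟩
      by_contra hw'
      simp only [Set.mem_insert_iff, Set.mem_singleton_iff, not_or] at hw'
      exact hlt' ((Set.two_lt_ncard (Set.toFinite _)).2 ⟨u, hu, v, hv, w, hw, hvu.symm, fun h =>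
        hw'.1 h.symm,
        fun h => hw'.2 h.symm⟩)
  have hne : ∀ {u v w : V}, κ u = i → κ v = i → κ w ≠ i → w ∉ ({u, v} : Set V) := by
    rintro u v w hu hv hw (rfl | rfl)
    · exact hw hu
    · exact hw hv
  obtain ⟨a, ha⟩ := h0
  obtain ⟨x, hx⟩ := h1
  obtain ⟨y, hy⟩ := h2
  have hc : i = 0 ∨ i = 1 ∨ i = 2 := by omega
  rcases hc with rfl | rfl | rfl
  · obtain ⟨v, hv, hall⟩ := hcover a ha
    have hs := hpairs a v
    exact hne ha hv (by rw [hx]; decide) ((hs.2.1 hall).1 x hx)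
  · obtain ⟨v, hv, hall⟩ := hcover x hx
    have hs := hpairs x v
    exact hne hx hv (by rw [hy]; decide) (hs.1.1 hall y hy)
  · obtain ⟨v, hv, hall⟩ := hcover y hy
    have hs := hpairs y v
    exact hne hy hv (by rw [hx]; decide) (hs.1.2 hall x hx)

theorem exists_four_coloring (A P Q : V → Prop) : ∃ κ : V → Fin 4, (∀ v, κ v = 0 ↔ A v) ∧
    (∀ v, κ v = 1 ↔ ¬ A v ∧ ¬ P v ∧ Q v) ∧ (∀ v, κ v = 2 ↔ ¬ A v ∧ ¬ P v ∧ ¬ Q v) ∧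
    (∀ v, κ v = 3 ↔ ¬ A v ∧ P v) := by
  classical
  refine ⟨fun v => if A v then 0 else if P v then 3 else if Q v then 1 else 2, ?_, ?_, ?_, ?_⟩ <;>
  · intro v
    by_cases h1 : A v <;> by_cases h2 : P v <;> by_cases h3 : Q v <;> simp [h1, h2, h3]

-- Here `𝒞` plays the family of cofacets and `A` the reducing class. The hypotheses say in turn: a
-- cofacet has one vertex in `A`, which is exchangeable; excess two; facets are incomparable; the
-- diamond property at a simplicial facet; the empty set and the pairs are faces; a facet all of
-- whose vertex subsets are faces misses at least three vertices.
set_option maxHeartbeats 1000000 in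
theorem exists_coloring [Finite V] {𝒞 : Set (Set V)} {A : Set V} (hne : 𝒞.Nonempty)
    (hA : ∀ C ∈ 𝒞, ∃ b ∈ A, b ∈ C ∧ ∀ a ∈ A, a ∈ C → a = b)
    (hswap : ∀ C ∈ 𝒞, ∀ b ∈ A, b ∈ C → ∀ a ∈ A, insert a (C \ {b}) ∈ 𝒞)
    (hcard : ∀ C ∈ 𝒞, C.ncard ≤ 3)
    (hanti : ∀ C ∈ 𝒞, ∀ C' ∈ 𝒞, C ⊆ C' → C = C')
    (htriple : ∀ C ∈ 𝒞, C.ncard = 3 → ∀ z, z ∉ C → ∃ C' ∈ 𝒞, C' ≠ C ∧ C' ⊆ insert z C ∧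
      ∀ C'' ∈ 𝒞, C'' ⊆ insert z C → C'' = C ∨ C'' = C')
    (hempty : ClosedFor 𝒞 ∅) (hpairs : ∀ u v : V, ClosedFor 𝒞 {u, v})
    (hthree : ∀ C ∈ 𝒞, (∀ S, (∀ v ∈ C, v ∉ S) → ClosedFor 𝒞 S) → 3 ≤ C.ncard) :
    ∃ κ : V → Fin 4, (∀ i, i ≠ 3 → 3 ≤ Nat.card {v // κ v = i}) ∧
      ∀ S, ClosedFor 𝒞 S ↔ S ∈ splitFaces κ := by
  classical
  -- Without three-element cofacets, each vertex outside a set `S` disjoint from `C` lies in a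
  -- cofacet disjoint from `S`: a vertex of `A` is swapped into `C`, and any other `v` lies in a
  -- cofacet that, swapped to contain `b`, can only be {b, v}. So every such `S` is closed and
  -- `hthree` applies.
  have hexc : ∃ C ∈ 𝒞, C.ncard = 3 := by
    by_contra hno
    push Not at hno
    obtain ⟨C, hC⟩ := hne
    obtain ⟨b, hb, hbC, -⟩ := hA C hC
    refine hno C hC (le_antisymm (hcard C hC) (hthree C hC fun S hS v hv => ?_))
    by_cases hvA : v ∈ A
    · refine ⟨_, hswap C hC b hb hbC v hvA, by simp, ?_⟩
      rintro u (rfl | ⟨hu, -⟩)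
      · exact hv
      · exact hS u hu
    · obtain ⟨C', hC', hvC', -⟩ := hempty v (by simp)
      obtain ⟨b', hb', hb'C', -⟩ := hA C' hC'
      have hC'' := hswap C' hC' b' hb' hb'C' b hb
      refine ⟨_, hC'', .inr ⟨hvC', fun h => hvA (h ▸ hb')⟩, fun u hu => ?_⟩
      have hvb : v ≠ b := fun h => hvA (h ▸ hb)
      by_contra huS
      have hub : u ≠ b := fun h => hS b hbC (h ▸ huS)
      have huv : u ≠ v := fun h => hv (h ▸ huS)
      have h3 : 2 < (insert b (C' \ {b'})).ncard :=
        (Set.two_lt_ncard (Set.toFinite _)).2 ⟨b, by simp, v, .inr ⟨hvC', fun h => hvA (h ▸ hb')⟩,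
          u, hu,
          hvb.symm, hub.symm, huv.symm⟩
      exact hno _ hC'' (le_antisymm (hcard _ hC'') h3)
  obtain ⟨C₀, hC₀, hC₀3⟩ := hexc
  obtain ⟨b, hb, hbC₀, hbu⟩ := hA C₀ hC₀
  have hsing : ({b} : Set V) ∉ 𝒞 := by
    intro h
    have := hanti _ h _ hC₀ (by simpa using hbC₀)
    rw [← this] at hC₀3
    simp at hC₀3
  have hshape : ∀ C ∈ 𝒞, b ∈ C → (∃ p, p ∉ A ∧ C = {b, p}) ∨
      (∃ x y, x ∉ A ∧ y ∉ A ∧ x ≠ y ∧ C = {b, x, y}) := by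
    intro C hC hbC
    obtain ⟨b', hb', hb'C, huniq⟩ := hA C hC
    obtain rfl := huniq b hb hbC
    have hCb : C = insert b (C \ {b}) := by simp [Set.insert_eq_of_mem hbC]
    have hnA : ∀ v ∈ C \ {b}, v ∉ A := fun v hv hvA => hv.2 (huniq v hvA hv.1)
    have hle : (C \ {b}).ncard ≤ 2 := by
      have := Set.ncard_sdiff_singleton_add_one hbC
      have := hcard C hC
      omega
    have h012 : (C \ {b}).ncard = 0 ∨ (C \ {b}).ncard = 1 ∨ (C \ {b}).ncard = 2 := by omega
    rcases h012 with h | h | h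
    · rw [Set.ncard_eq_zero] at h
      rw [h] at hCb
      exact absurd (hCb ▸ hC) (by simpa using hsing)
    · obtain ⟨p, hp⟩ := Set.ncard_eq_one.1 h
      refine .inl ⟨p, hnA p (by simp [hp]), ?_⟩
      rw [hCb, hp]
    · obtain ⟨x, y, hxy, hp⟩ := Set.ncard_eq_two.1 h
      refine .inr ⟨x, y, hnA x (by simp [hp]), hnA y (by simp [hp]), hxy, ?_⟩
      rw [hCb, hp]
  -- By exchangeability it suffices to study the cofacets through the fixed vertex `b`: they are
  -- given by the vertices in `P` and the edges of `adj`.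
  let P : V → Prop := fun p => p ∉ A ∧ {b, p} ∈ 𝒞
  let adj : V → V → Prop := fun x y => x ∉ A ∧ y ∉ A ∧ x ≠ y ∧ {b, x, y} ∈ 𝒞
  have hadj_symm : ∀ {x y}, adj x y → adj y x := fun {x y} h =>
    ⟨h.2.1, h.1, h.2.2.1.symm, by rw [Set.pair_comm y x]; exact h.2.2.2⟩
  have hncard : ∀ {x y}, adj x y → ({b, x, y} : Set V).ncard = 3 := by
    rintro x y ⟨hx, hy, hxy, -⟩
    exact Set.ncard_eq_three.2 ⟨b, x, y, fun h => hx (h ▸ hb), fun h => hy (h ▸ hb), hxy, rfl⟩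
  have hPadj : ∀ {x y}, adj x y → ¬ P x := by
    intro x y h hP
    have h1 := hanti _ hP.2 _ h.2.2.2 (by
      rintro v (rfl | rfl) <;> simp)
    have : y ∈ ({b, x} : Set V) := by rw [h1]; simp
    rcases this with h' | h'
    · exact h.2.1 (h' ▸ hb)
    · exact h.2.2.1 h'.symm
  -- Inside {z, b, x, y} there is exactly one cofacet besides {b, x, y}. It contains `z` by
  -- incomparability and `b` because it must meet `A`; as `z` is not in `P`, it is {b, z, x} or {b,
  -- z, y}, and not both occur.
  have htri : ∀ {x y z}, adj x y → z ∉ A → ¬ P z → z ≠ x → z ≠ y →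
      (adj z x ∨ adj z y) ∧ ¬ (adj z x ∧ adj z y) := by
    intro x y z h hz hPz hzx hzy
    have hzb : z ≠ b := fun h => hz (h ▸ hb)
    have hzC : z ∉ ({b, x, y} : Set V) := by simp [hzx, hzy, hzb]
    obtain ⟨C', hC', hne', hsub, huniq⟩ := htriple _ h.2.2.2 (hncard h) z hzC
    constructor
    · have hzC' : z ∈ C' := by
        by_contra hzC'
        refine hne' (hanti _ hC' _ h.2.2.2 fun v hv => ?_)
        rcases hsub hv with rfl | hv'
        · exact absurd hv hzC'
        · exact hv'
      have hbC' : b ∈ C' := by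
        obtain ⟨b', hb', hb'C', -⟩ := hA C' hC'
        rcases hsub hb'C' with rfl | rfl | rfl | rfl
        · exact absurd hb' hz
        · exact hb'C'
        · exact absurd hb' h.1
        · exact absurd hb' h.2.1
      rcases hshape C' hC' hbC' with ⟨p, hp, rfl⟩ | ⟨u, v, hu, hv, huv, rfl⟩
      · rcases hzC' with h' | h'
        · exact absurd h' hzb
        · obtain rfl : z = p := h'
          exact absurd ⟨hz, hC'⟩ hPz
      · have hmem : ∀ w, w ∉ A → w ∈ ({b, u, v} : Set V) → w ≠ z → w = x ∨ w = y := by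
          intro w hw hw' hwz
          rcases hsub hw' with h' | h' | h' | h'
          · exact absurd h' hwz
          · exact absurd (h' ▸ hb) hw
          · exact .inl h'
          · exact .inr h'
        have hadj : adj u v := ⟨hu, hv, huv, hC'⟩
        rcases hzC' with h' | h' | h'
        · exact absurd h' hzb
        · obtain rfl : z = u := h'
          rcases hmem v hv (by simp) huv.symm with rfl | rfl
          · exact .inl hadj
          · exact .inr hadj
        · obtain rfl : z = v := h'
          rcases hmem u hu (by simp) huv with rfl | rfl
          · exact .inl (hadj_symm hadj)
          · exact .inr (hadj_symm hadj)
    · rintro ⟨h1, h2⟩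
      have hx : x ∉ ({b, z, y} : Set V) := by
        simp [hzx.symm, h.2.2.1, show x ≠ b from fun h' => h.1 (h' ▸ hb)]
      have hy : y ∉ ({b, z, x} : Set V) := by
        simp [hzy.symm, h.2.2.1.symm, show y ≠ b from fun h' => h.2.1 (h' ▸ hb)]
      have e1 := (huniq _ h1.2.2.2 (by
        rintro v (rfl | rfl | rfl) <;> simp)).resolve_left (fun h' => hy (by rw [h']; simp))
      have e2 := (huniq _ h2.2.2.2 (by
        rintro v (rfl | rfl | rfl) <;> simp)).resolve_left (fun h' => hx (by rw [h']; simp))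
      exact hy (by rw [e1, ← e2]; simp)
  obtain ⟨x₀, y₀, h₀⟩ : ∃ x y, adj x y := by
    rcases hshape C₀ hC₀ hbC₀ with ⟨p, hp, rfl⟩ | ⟨x, y, hx, hy, hxy, rfl⟩
    · have := Set.ncard_pair (a := b) (b := p) (fun h => hp (h ▸ hb))
      omega
    · exact ⟨x, y, hx, hy, hxy, hC₀⟩
  -- One side of the bipartition is the neighbourhood of `y₀`; the other consists of the remaining
  -- vertices outside `A` and `P`, including `y₀` itself.
  obtain ⟨κ, k0, k1', k2, k3'⟩ := exists_four_coloring (· ∈ A) P (adj · y₀)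
  have k3 : ∀ v, κ v = 3 ↔ P v := fun v => (k3' v).trans ⟨And.right, fun h => ⟨h.1, h⟩⟩
  have k1 : ∀ v, κ v = 1 ↔ adj v y₀ := fun v =>
    (k1' v).trans ⟨fun h => h.2.2, fun h => ⟨h.1, hPadj h, h⟩⟩
  have hP₀ : ¬ P y₀ := hPadj (hadj_symm h₀)
  have irr : ∀ x, ¬ adj x x := fun x h => h.2.2.1 rfl
  have hadj12 : ∀ x y, κ x = 1 → κ y = 2 → adj x y := by
    intro x y hx hy
    rw [k1] at hx
    rw [k2] at hy
    obtain ⟨hyA, hyP, hyn⟩ := hy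
    by_cases hyy : y = y₀
    · rw [hyy]; exact hx
    · have hyx : y ≠ x := fun h => hyn (h ▸ hx)
      exact hadj_symm ((htri hx hyA hyP hyx hyy).1.resolve_right hyn)
  have hadjκ : ∀ x y, adj x y → (κ x = 1 ∧ κ y = 2) ∨ (κ x = 2 ∧ κ y = 1) := by
    intro x y h
    have hxP := hPadj h
    have hyP := hPadj (hadj_symm h)
    by_cases hx : adj x y₀ <;> by_cases hy : adj y y₀
    · exfalso
      have e1 : y₀ ≠ x := fun e => irr x (e ▸ hx)
      have e2 : y₀ ≠ y := fun e => irr y (e ▸ hy)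
      exact (htri h h₀.2.1 hP₀ e1 e2).2 ⟨hadj_symm hx, hadj_symm hy⟩
    · exact .inl ⟨(k1 x).2 hx, (k2 y).2 ⟨h.2.1, hyP, hy⟩⟩
    · exact .inr ⟨(k2 x).2 ⟨h.1, hxP, hx⟩, (k1 y).2 hy⟩
    · exfalso
      have e1 : y₀ ≠ x := fun e => hy (e ▸ hadj_symm h)
      have e2 : y₀ ≠ y := fun e => hx (e ▸ h)
      rcases (htri h h₀.2.1 hP₀ e1 e2).1 with h' | h'
      · exact hx (hadj_symm h')
      · exact hy (hadj_symm h')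
  have hmem : ∀ C, C ∈ 𝒞 ↔ (∃ a p, κ a = 0 ∧ κ p = 3 ∧ C = {a, p}) ∨
      (∃ a x y, κ a = 0 ∧ κ x = 1 ∧ κ y = 2 ∧ C = {a, x, y}) := by
    intro C
    constructor
    · intro hC
      obtain ⟨a, ha, haC, huniq⟩ := hA C hC
      have hC' := hswap C hC a ha haC b hb
      -- Exchanging `a` for `b` and back returns `C`, because `b` was in `C` only if `b = a`.
      have hback : C = insert a (insert b (C \ {a}) \ {b}) := by
        ext v
        by_cases hva : v = a
        · simp [hva, haC]
        · by_cases hvb : v = b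
          · subst hvb
            simp only [Set.mem_insert_iff, hva, false_or, Set.mem_sdiff, true_or,
              Set.mem_singleton_iff, not_true, and_false, iff_false]
            exact fun hv => hva (huniq _ hb hv)
          · simp [hva, hvb]
      rcases hshape _ hC' (by simp) with ⟨p, hp, hp'⟩ | ⟨x, y, hx, hy, hxy, hp'⟩
      · refine .inl ⟨a, p, (k0 a).2 ha, (k3 p).2 ⟨hp, hp' ▸ hC'⟩, ?_⟩
        rw [hback, hp']
        have : p ≠ b := fun h => hp (h ▸ hb)
        ext v
        simp only [Set.mem_insert_iff, Set.mem_sdiff, Set.mem_singleton_iff]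
        grind
      · have hadj : adj x y := ⟨hx, hy, hxy, hp' ▸ hC'⟩
        have hCeq : C = {a, x, y} := by
          rw [hback, hp']
          have : x ≠ b := fun h => hx (h ▸ hb)
          have : y ≠ b := fun h => hy (h ▸ hb)
          ext v
          simp only [Set.mem_insert_iff, Set.mem_sdiff, Set.mem_singleton_iff]
          grind
        rcases hadjκ x y hadj with ⟨h1, h2⟩ | ⟨h1, h2⟩
        · exact .inr ⟨a, x, y, (k0 a).2 ha, h1, h2, hCeq⟩
        · exact .inr ⟨a, y, x, (k0 a).2 ha, h2, h1, by rw [hCeq, Set.pair_comm]⟩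
    · have hsw : ∀ (a : V) (D : Set V), a ∈ A → (∀ v ∈ D, v ∉ A) → insert b D ∈ 𝒞 →
          insert a D ∈ 𝒞 := by
        intro a D ha hD h
        have := hswap _ h b hb (by simp) a ha
        rwa [Set.insert_sdiff_self_of_notMem (fun hbD => hD b hbD hb)] at this
      rintro (⟨a, p, ha, hp, rfl⟩ | ⟨a, x, y, ha, hx, hy, rfl⟩)
      · have hp := (k3 p).1 hp
        exact hsw a {p} ((k0 a).1 ha) (by rintro v rfl; exact hp.1) hp.2
      · have hadj := hadj12 x y hx hy
        exact hsw a {x, y} ((k0 a).1 ha) (by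
          rintro v (rfl | rfl)
          · exact hadj.1
          · exact hadj.2.1) hadj.2.2.2
  have hclosed : ∀ S, ClosedFor 𝒞 S ↔ S ∈ splitFaces κ := by
    intro S
    rw [mem_splitFaces_iff]
    refine forall₂_congr fun v hv => ?_
    constructor
    · rintro ⟨C, hC, hvC, hdisj⟩
      rcases (hmem C).1 hC with ⟨a, p, ha, hp, rfl⟩ | ⟨a, x, y, ha, hx, hy, rfl⟩
      · exact .inl ⟨a, p, ha, hp, hdisj a (by simp), hdisj p (by simp), hvC⟩
      · exact .inr ⟨a, x, y, ha, hx, hy, hdisj a (by simp), hdisj x (by simp), hdisj y (by simp),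
          hvC⟩
    · rintro (⟨a, p, ha, hp, haS, hpS, hvv⟩ | ⟨a, x, y, ha, hx, hy, haS, hxS, hyS, hvv⟩)
      · refine ⟨_, (hmem _).2 (.inl ⟨a, p, ha, hp, rfl⟩), hvv, ?_⟩
        rintro u (rfl | rfl)
        exacts [haS, hpS]
      · refine ⟨_, (hmem _).2 (.inr ⟨a, x, y, ha, hx, hy, rfl⟩), hvv, ?_⟩
        rintro u (rfl | rfl | rfl)
        exacts [haS, hxS, hyS]
  refine ⟨κ, three_le_card_fiber (fun u v => (hclosed _).1 (hpairs u v)) ⟨b, (k0 b).2 hb⟩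
    ⟨x₀, (k1 x₀).2 h₀⟩ ⟨y₀, (k2 y₀).2 ⟨h₀.2.1, hP₀, irr y₀⟩⟩, hclosed⟩

end Coloring

end CellPM

namespace CellPM

/-! ### Faces, vertices and facets in the lattice -/

section Lattice

variable {M : Type*} [PartialOrder M]

namespace IsGradedPM

variable (h : IsGradedPM M)
include h

theorem exists_other_covBy {x y z : M} (hxy : x ⋖ y) (hyz : y ⋖ z) :
    ∃ y', y' ≠ y ∧ x ⋖ y' ∧ y' ⋖ z ∧ ∀ t, x < t → t < z → t = y ∨ t = y' := by
  have := h.finite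
  obtain ⟨y', h1, h2, h3, h4⟩ := h.exists_other x y z hxy hyz
  have e1 := h.rank_of_covBy hxy
  have e2 := h.rank_of_covBy hyz
  have e3 := rank_lt_rank h2
  have e4 := rank_lt_rank h3
  exact ⟨y', h1, h.covBy_iff.2 ⟨h2.le, by omega⟩, h.covBy_iff.2 ⟨h3.le, by omega⟩, h4⟩

/-- Every element of an interval is a meet of its coatoms. Descending induction: if `y` is neither
`z` nor a coatom, a diamond above `y` exhibits it as the meet of two covers, each of which lies
above `x` by induction. -/
theorem le_of_forall_coatom {x y z : M} (hy : y ≤ z) (hx : x ≤ z)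
    (hc : ∀ c, c ⋖ z → y ≤ c → x ≤ c) : x ≤ y := by
  have := h.finite
  induction y using WellFoundedGT.induction with
  | ind y ih =>
    rcases hy.eq_or_lt with rfl | hlt
    · exact hx
    obtain ⟨y₁, hyy₁, hy₁⟩ := exists_covBy_le_of_lt hlt
    rcases hy₁.eq_or_lt with rfl | hlt₁
    · exact hc y hyy₁ le_rfl
    obtain ⟨u, hyu, hu⟩ := exists_covBy_le_of_lt hlt₁
    obtain ⟨y₂, hne, h1, h2, -⟩ := h.exists_other_covBy hyy₁ hyu
    have e1 := ih y₁ hyy₁.lt hy₁ fun c hcz hyc => hc c hcz (hyy₁.le.trans hyc)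
    have e2 := ih y₂ h1.lt (h2.le.trans hu) fun c hcz hyc => hc c hcz (h1.le.trans hyc)
    exact (isGLB_of_covBy h.exists_inf hne h2 hyu h1 hyy₁).2 (by simp [e1, e2])

/-- Dual to the coatom statement: an element of rank at least two is the join of two elements it
covers, supplied by a diamond below it. -/
theorem le_of_forall_vertex {x y : M} (hv : ∀ v, IsVertex v → v ≤ x → v ≤ y) : x ≤ y := by
  have := h.finite
  induction x using WellFoundedLT.induction with
  | ind x ih =>
    obtain ⟨b, hb⟩ := h.exists_isBot
    rcases (hb x).eq_or_lt with rfl | hlt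
    · exact hb y
    obtain ⟨y₁, hby₁, hy₁⟩ := exists_le_covBy_of_lt hlt
    rcases hby₁.eq_or_lt with rfl | hlt₁
    · exact hv x (by rw [IsVertex, h.rank_of_covBy hy₁, rank_of_isBot hb]) le_rfl
    obtain ⟨w, -, hw⟩ := exists_le_covBy_of_lt hlt₁
    obtain ⟨y₂, hne, h1, h2, -⟩ := h.exists_other_covBy hw hy₁
    have e1 := ih y₁ hy₁.lt fun v hv' hvy => hv v hv' (hvy.trans hy₁.le)
    have e2 := ih y₂ h2.lt fun v hv' hvy => hv v hv' (hvy.trans h2.le)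
    obtain ⟨j, hj⟩ := h.exists_sup y₁ y₂
    have f1 : j ≤ x := hj.2 (by simp [hy₁.le, h2.le])
    have f2 : y₁ ≤ j := hj.1 (by simp)
    have f3 : y₂ ≤ j := hj.1 (by simp)
    have f4 : j ≤ y := hj.2 (by simp [e1, e2])
    rcases hy₁.eq_or_eq f2 f1 with rfl | rfl
    · have := h.rank_of_covBy hy₁
      have := h.rank_of_covBy h2
      exact absurd (eq_of_le_of_rank_le f3 (by omega)) hne
    · exact f4

end IsGradedPM

/-- The set of vertices below an element. -/
def vertexSet (x : M) : Set {v : M // IsVertex v} := {v | v.1 ≤ x}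

@[simp] theorem mem_vertexSet {x : M} {v : {v : M // IsVertex v}} : v ∈ vertexSet x ↔ v.1 ≤ x :=
  Iff.rfl

/-- The vertex sets of the complements of facets. -/
def cofacets (M : Type*) [PartialOrder M] [OrderTop M] : Set (Set {v : M // IsVertex v}) :=
  {C | ∃ F : M, F ⋖ ⊤ ∧ C = (vertexSet F)ᶜ}

namespace IsGradedPM

variable (h : IsGradedPM M)
include h

theorem vertexSet_subset_iff {x y : M} : vertexSet x ⊆ vertexSet y ↔ x ≤ y :=
  ⟨fun hs => h.le_of_forall_vertex fun v hv hvx => hs (a := ⟨v, hv⟩) hvx,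
    fun hxy _ hv => le_trans hv hxy⟩

theorem vertexSet_injective : Function.Injective (vertexSet : M → _) := fun _ _ hxy =>
  le_antisymm (h.vertexSet_subset_iff.1 hxy.le) (h.vertexSet_subset_iff.1 hxy.ge)

theorem ncard_vertexSet_lt {x y : M} (hxy : x < y) :
    (vertexSet x).ncard < (vertexSet y).ncard := by
  have := h.finite
  exact Set.ncard_lt_ncard ⟨h.vertexSet_subset_iff.2 hxy.le,
    fun hs => hxy.not_ge (h.vertexSet_subset_iff.1 hs)⟩ (Set.toFinite _)

theorem rank_le_ncard (x : M) : rank x ≤ (vertexSet x).ncard := by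
  have := h.finite
  induction x using WellFoundedLT.induction with
  | ind x ih =>
    obtain ⟨b, hb⟩ := h.exists_isBot
    rcases (hb x).eq_or_lt with rfl | hlt
    · rw [rank_of_isBot hb]; omega
    · obtain ⟨w, -, hw⟩ := exists_le_covBy_of_lt hlt
      have := ih w hw.lt
      have := h.rank_of_covBy hw
      have := h.ncard_vertexSet_lt hw.lt
      omega

/-- Adding the vertices of `f` one at a time produces a strictly increasing chain of faces. -/
theorem ncard_le_rank {f : M} (hf : ∀ S, S ⊆ vertexSet f → ∃ x : M, vertexSet x = S) :
    (vertexSet f).ncard ≤ rank f := by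
  classical
  have := h.finite
  have key : ∀ S : Finset {v : M // IsVertex v}, (S : Set {v : M // IsVertex v}) ⊆ vertexSet f →
      ∃ x, vertexSet x = (S : Set {v : M // IsVertex v}) ∧ S.card ≤ rank x := by
    intro S
    induction S using Finset.induction with
    | empty =>
      intro hS
      obtain ⟨x, hx⟩ := hf _ hS
      exact ⟨x, hx, by simp⟩
    | insert v S hv ih =>
      intro hS
      obtain ⟨x, hx⟩ := hf _ hS
      obtain ⟨w, hw, hle⟩ := ih (subset_trans (by simp) hS)
      refine ⟨x, hx, ?_⟩
      have hwx : w < x := by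
        refine lt_of_le_of_ne (h.vertexSet_subset_iff.1 (by rw [hw, hx]; simp)) ?_
        rintro rfl
        rw [hw] at hx
        have : v ∈ S := by
          have : v ∈ (S : Set {v : M // IsVertex v}) := by rw [hx]; simp
          simpa using this
        exact hv this
      have := rank_lt_rank hwx
      rw [Finset.card_insert_of_notMem hv]
      omega
  obtain ⟨x, hx, hle⟩ := key (Set.toFinite (vertexSet f)).toFinset (by simp)
  simp only [Set.Finite.coe_toFinset] at hx
  rw [h.vertexSet_injective hx] at hle
  rwa [Set.ncard_eq_toFinset_card _ (Set.toFinite _)]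

/-- The bottom is the meet of the coatoms of `f`, so one of these avoids `v`. Its rank forces it to
have at least all but one of the vertices of `f`. -/
theorem exists_covBy_vertexSet_eq_diff {f : M} (hf : (vertexSet f).ncard = rank f)
    {v : {v : M // IsVertex v}} (hv : v.1 ≤ f) : ∃ y, y ⋖ f ∧ vertexSet y = vertexSet f \ {v} := by
  have := h.finite
  obtain ⟨b, hb⟩ := h.exists_isBot
  have hvb : ¬ v.1 ≤ b := fun hle => by
    have h1 := rank_le_rank hle
    have h2 : rank v.1 = 1 := v.2
    have h3 := rank_of_isBot hb
    omega
  have : ¬ ∀ c, c ⋖ f → b ≤ c → v.1 ≤ c := fun hc => hvb (h.le_of_forall_coatom (hb f) hv hc)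
  push Not at this
  obtain ⟨y, hy, -, hvy⟩ := this
  refine ⟨y, hy, Set.eq_of_subset_of_ncard_le ?_ ?_⟩
  · intro w hw
    exact ⟨le_trans hw hy.le, fun e => hvy (by rw [← Set.mem_singleton_iff.1 e]; exact hw)⟩
  · have h1 := Set.ncard_sdiff_singleton_add_one (s := vertexSet f) (a := v) hv
    have h2 := h.rank_le_ncard y
    have h3 := h.rank_of_covBy hy
    omega

variable [OrderTop M]

/-- Closedness says that `S` is an intersection of vertex sets of facets. The corresponding face is
a maximal lower bound of the facets containing `S`; conversely each face is the meet of the facets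
above it. -/
theorem closedFor_cofacets_iff {S : Set {v : M // IsVertex v}} :
    ClosedFor (cofacets M) S ↔ ∃ x : M, vertexSet x = S := by
  have := h.finite
  constructor
  · intro hS
    obtain ⟨b, hb⟩ := h.exists_isBot
    obtain ⟨x, hx⟩ := (Set.toFinite {x : M | ∀ F, F ⋖ ⊤ → S ⊆ vertexSet F → x ≤ F}).exists_maximal
      ⟨b, fun F _ _ => hb F⟩
    have hx1 : ∀ F, F ⋖ ⊤ → S ⊆ vertexSet F → x ≤ F := hx.1
    refine ⟨x, Set.Subset.antisymm (fun v hv => ?_) (fun v hv => ?_)⟩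
    · by_contra hvS
      obtain ⟨_, ⟨F, hF, rfl⟩, hvF, hdisj⟩ := hS v hvS
      refine hvF (le_trans hv (hx1 F hF fun u hu => ?_))
      by_contra huF
      exact hdisj u huF hu
    · obtain ⟨j, hj⟩ := h.exists_sup x v.1
      have hxj : x ≤ j := hj.1 (by simp)
      have hvj : v.1 ≤ j := hj.1 (by simp)
      have : j ≤ x := hx.2 (y := j) (fun F hF hSF => hj.2 (by
        rintro a (rfl | rfl)
        · exact hx1 F hF hSF
        · exact hSF hv)) hxj
      exact le_trans hvj this
  · rintro ⟨x, rfl⟩ v hv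
    have : ¬ ∀ c, c ⋖ ⊤ → x ≤ c → v.1 ≤ c := fun hc =>
      hv (h.le_of_forall_coatom le_top le_top hc)
    push Not at this
    obtain ⟨F, hF, hxF, hvF⟩ := this
    exact ⟨_, ⟨F, hF, rfl⟩, hvF, fun u hu hux => hu (le_trans hux hxF)⟩

theorem nonempty_orderIso_of_closedFor {R : Set (Set {v : M // IsVertex v})}
    (hR : ∀ S, ClosedFor (cofacets M) S ↔ S ∈ R) : Nonempty (M ≃o R) := by
  let f : M → R := fun x => ⟨vertexSet x, (hR _).1 (h.closedFor_cofacets_iff.2 ⟨x, rfl⟩)⟩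
  have hf : Function.Bijective f := by
    constructor
    · intro x y hxy
      exact h.vertexSet_injective (congrArg Subtype.val hxy)
    · rintro ⟨S, hS⟩
      obtain ⟨x, hx⟩ := h.closedFor_cofacets_iff.1 ((hR S).2 hS)
      exact ⟨x, Subtype.ext hx⟩
  exact ⟨⟨Equiv.ofBijective f hf, h.vertexSet_subset_iff⟩⟩

section Symmetric

variable {A : Set M} (hAv : ∀ a ∈ A, IsVertex a)
  (hA : ∀ a ∈ A, ∀ b ∈ A, a ≠ b →
    ∃ φ : M ≃o M, φ a = b ∧ φ b = a ∧ ∀ v, IsVertex v → v ≠ a → v ≠ b → φ v = v)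
include hAv hA

/-- `F'` is the image of `F` under the transposition of `a` and `b`, and `y` is the meet of the two.
A face strictly above `y` and below `F` must contain `a`, hence all vertices of `F`, so `y` is a
ridge. -/
theorem exists_swapped_facet {F a b : M} (hF : F ⋖ ⊤) (ha : a ∈ A) (haF : a ≤ F) (hb : b ∈ A)
    (hbF : ¬ b ≤ F) : ∃ F' y, F' ⋖ ⊤ ∧ y ⋖ F ∧ y ⋖ F' ∧
      (∀ v, IsVertex v → (v ≤ F' ↔ v = b ∨ (v ≤ F ∧ v ≠ a))) ∧
      (∀ v, IsVertex v → (v ≤ y ↔ v ≤ F ∧ v ≠ a)) := by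
  have := h.finite
  have hab : a ≠ b := fun e => hbF (e ▸ haF)
  obtain ⟨φ, h1, h2, h3⟩ := hA a ha b hb hab
  have hF' : φ F ⋖ ⊤ := by
    have := (apply_covBy_apply_iff φ).2 hF
    rwa [φ.map_top] at this
  have hvF : ∀ v, IsVertex v → (v ≤ φ F ↔ v = b ∨ (v ≤ F ∧ v ≠ a)) := by
    intro v hv
    by_cases hva : v = a
    · rw [hva, ← h2, φ.le_iff_le, h2]
      simp [hbF, hab]
    · by_cases hvb : v = b
      · rw [hvb, ← h1, φ.le_iff_le]
        simp [haF]
      · nth_rw 1 [← h3 v hv hva hvb]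
        rw [φ.le_iff_le]
        simp [hva, hvb]
  obtain ⟨y, hy⟩ := h.exists_inf F (φ F)
  have hvy : ∀ v, IsVertex v → (v ≤ y ↔ v ≤ F ∧ v ≠ a) := by
    intro v hv
    rw [le_isGLB_iff hy]
    have : v ∈ lowerBounds {F, φ F} ↔ v ≤ F ∧ v ≤ φ F := by simp [lowerBounds]
    rw [this, hvF v hv]
    constructor
    · rintro ⟨e1, rfl | e2⟩
      · exact absurd e1 hbF
      · exact e2
    · exact fun e => ⟨e.1, .inr e⟩
  have hyF : y ≤ F := hy.1 (by simp)
  have hyF' : y ≤ φ F := hy.1 (by simp)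
  have hyc : y ⋖ F := by
    have hay : ¬ a ≤ y := fun e => ((hvy a (hAv a ha)).1 e).2 rfl
    refine ⟨lt_of_le_of_ne hyF (fun e => hay (e ▸ haF)), fun t hyt htF => ?_⟩
    have hat : a ≤ t := by
      by_contra hat
      refine hyt.not_ge (h.le_of_forall_vertex fun v hv hvt => (hvy v hv).2
        ⟨hvt.trans htF.le, fun e => hat (e ▸ hvt)⟩)
    refine htF.not_ge (h.le_of_forall_vertex fun v hv hvF => ?_)
    by_cases hva : v = a
    · rwa [hva]
    · exact ((hvy v hv).2 ⟨hvF, hva⟩).trans hyt.le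
  refine ⟨φ F, y, hF', hyc, h.covBy_iff.2 ⟨hyF', ?_⟩, hvF, hvy⟩
  have e1 := h.rank_of_covBy hyc
  rw [rank_orderIso, e1]

/-- Swapping `a` with `b` or with `b'` leads across the same ridge, `F` without `a`. Only one facet
other than `F` contains that ridge, so the two swapped facets agree. -/
theorem missing_unique {F a b b' : M} (hF : F ⋖ ⊤) (ha : a ∈ A) (haF : a ≤ F) (hb : b ∈ A)
    (hbF : ¬ b ≤ F) (hb' : b' ∈ A) (hbF' : ¬ b' ≤ F) : b = b' := by
  obtain ⟨F₁, y₁, h1, h2, h3, h4, h5⟩ := h.exists_swapped_facet hAv hA hF ha haF hb hbF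
  obtain ⟨F₂, y₂, k1, k2, k3, k4, k5⟩ := h.exists_swapped_facet hAv hA hF ha haF hb' hbF'
  have hy : y₁ = y₂ := le_antisymm
    (h.le_of_forall_vertex fun v hv hvy => (k5 v hv).2 ((h5 v hv).1 hvy))
    (h.le_of_forall_vertex fun v hv hvy => (h5 v hv).2 ((k5 v hv).1 hvy))
  subst hy
  obtain ⟨F₃, -, -, -, huniq⟩ := h.exists_other_covBy h2 hF
  have n1 : F₁ ≠ F := fun e => hbF (e ▸ (h4 b (hAv b hb)).2 (.inl rfl))
  have n2 : F₂ ≠ F := fun e => hbF' (e ▸ (k4 b' (hAv b' hb')).2 (.inl rfl))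
  have e1 := (huniq F₁ h3.lt h1.lt).resolve_left n1
  have e2 := (huniq F₂ k3.lt k1.lt).resolve_left n2
  have e3 := (h4 b (hAv b hb)).2 (.inl rfl)
  rw [e1, ← e2] at e3
  rcases (k4 b (hAv b hb)).1 e3 with e | e
  · exact e
  · exact absurd e.1 hbF

/-- Along a walk from a facet above `x`, suppose `F₁` contains some `a` in `A` and its neighbour
`F₂` contains none. Their common ridge must be `F₁` without `a`, so `F₂` is a swapped facet and
contains the vertex `b` after all. -/
theorem exists_mem_le_facet (hfac : ∀ F, F ⋖ ⊤ → ∃ a ∈ A, ¬ a ≤ F) {x : M} (hx : x ∈ A)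
    (hxt : x < ⊤) {F : M} (hF : F ⋖ ⊤) : ∃ a ∈ A, a ≤ F := by
  have := h.finite
  obtain ⟨F₀, hxF₀, hF₀⟩ := exists_le_covBy_of_lt hxt
  obtain ⟨o, ho⟩ := h.exists_isBot
  have hchain := h.connected o ⊤ F₀ F (ho _) hF₀ (ho _) hF
  induction hchain with
  | refl => exact ⟨x, hx, hxF₀⟩
  | @tail F₁ F₂ _ hadj ih =>
    obtain ⟨-, hF₁, -, hF₂, m, hm1, hm2⟩ := hadj
    obtain ⟨a, ha, haF⟩ := ih hF₁
    by_contra hno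
    push Not at hno
    obtain ⟨b, hb, hbF⟩ := hfac F₁ hF₁
    obtain ⟨F', y, h1, h2, h3, h4, h5⟩ := h.exists_swapped_facet hAv hA hF₁ ha haF hb hbF
    have hmy : m ≤ y := h.le_of_forall_vertex fun v hv hvm => (h5 v hv).2
      ⟨hvm.trans hm1.le, fun e => hno a ha (e ▸ hvm.trans hm2.le)⟩
    have e1 := h.rank_of_covBy hm1
    have e2 := h.rank_of_covBy h2
    obtain rfl := eq_of_le_of_rank_le hmy (by omega)
    obtain ⟨F₃, -, -, -, huniq⟩ := h.exists_other_covBy h2 hF₁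
    have n1 : F' ≠ F₁ := fun e => hbF (e ▸ (h4 b (hAv b hb)).2 (.inl rfl))
    have n2 : F₂ ≠ F₁ := fun e => hno a ha (e ▸ haF)
    have e3 := (huniq F' h3.lt h1.lt).resolve_left n1
    have e4 := (huniq F₂ hm2.lt hF₂.lt).resolve_left n2
    refine hno b hb ?_
    rw [e4, ← e3]
    exact (h4 b (hAv b hb)).2 (.inl rfl)

end Symmetric

end IsGradedPM

end Lattice

end CellPM

namespace CellPM

/-! ### From a reducible neighbourly pseudomanifold to a model -/

section Classification

variable {M : Type*} [PartialOrder M]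

theorem simClass_swap {x a b : M} (ha : a ∈ simClass x) (hb : b ∈ simClass x) (hab : a ≠ b) :
    ∃ φ : M ≃o M, φ a = b ∧ φ b = a ∧ ∀ v, IsVertex v → v ≠ a → v ≠ b → φ v = v := by
  obtain ⟨hav, ha⟩ := ha
  obtain ⟨hbv, hb⟩ := hb
  by_cases hxa : x = a
  · subst hxa
    exact hb.resolve_left hab
  by_cases hxb : x = b
  · subst hxb
    obtain ⟨φ, h1, h2, h3⟩ := ha.resolve_left hxa
    exact ⟨φ, h2, h1, fun v hv e1 e2 => h3 v hv e2 e1⟩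
  obtain ⟨φ, h1, h2, h3⟩ := ha.resolve_left hxa
  obtain ⟨ψ, k1, k2, k3⟩ := hb.resolve_left hxb
  -- The transposition (a b) is the conjugate (x a)(x b)(x a).
  refine ⟨(φ.trans ψ).trans φ, ?_, ?_, ?_⟩
  · simp [h2, k1, h3 b hbv (Ne.symm hxb) hab.symm]
  · simp [h3 b hbv (Ne.symm hxb) hab.symm, k2, h1]
  · intro v hv hva hvb
    by_cases hvx : v = x
    · subst hvx
      simp [h1, h2, k3 a hav (Ne.symm hxa) hab]
    · simp [h3 v hv hvx hva, k3 v hv hvx hvb]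

theorem IsGradedPM.vertexSet_of_isVertex (h : IsGradedPM M) (v : {v : M // IsVertex v}) :
    vertexSet v.1 = {v} := by
  have := h.finite
  ext w
  simp only [mem_vertexSet, Set.mem_singleton_iff]
  refine ⟨fun hle => Subtype.ext (eq_of_le_of_rank_le hle ?_), fun e => e ▸ le_rfl⟩
  have h1 : rank w.1 = 1 := w.2
  have h2 : rank v.1 = 1 := v.2
  omega

theorem IsGradedPM.vertexSet_edge (h : IsGradedPM M) {u v : {v : M // IsVertex v}} (huv : u ≠ v)
    {e : M} (he : rank e = 2) (hu : u.1 ≤ e) (hv : v.1 ≤ e) : vertexSet e = {u, v} := by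
  have := h.finite
  obtain ⟨o, ho⟩ := h.exists_isBot
  have ho0 := rank_of_isBot ho
  have hcov : ∀ w : {v : M // IsVertex v}, w.1 ≤ e → o ⋖ w.1 ∧ w.1 ⋖ e := by
    intro w hw
    have h1 : rank w.1 = 1 := w.2
    exact ⟨h.covBy_iff.2 ⟨ho _, by omega⟩, h.covBy_iff.2 ⟨hw, by omega⟩⟩
  obtain ⟨t, -, -, -, huniq⟩ := h.exists_other (o) u.1 e (hcov u hu).1 (hcov u hu).2
  have hvt : v.1 = t := (huniq v.1 (hcov v hv).1.lt (hcov v hv).2.lt).resolve_left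
    (fun e => huv (Subtype.ext e.symm))
  ext w
  simp only [mem_vertexSet, Set.mem_insert_iff, Set.mem_singleton_iff]
  constructor
  · intro hw
    exact (huniq w.1 (hcov w hw).1.lt (hcov w hw).2.lt).imp Subtype.ext
      (fun e => Subtype.ext (e.trans hvt.symm))
  · rintro (rfl | rfl)
    exacts [hu, hv]

/-- Rank one leaves room for one vertex and rank two for two, too few for excess two. Consequently a
vertex is never the top. -/
theorem IsGradedPM.three_le_rank_top [OrderTop M] (h : IsGradedPM M)
    (hn : Nat.card {v : M // IsVertex v} = rank (⊤ : M) + 2) : 3 ≤ rank (⊤ : M) := by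
  have := h.finite
  have := h.nontrivial
  obtain ⟨o, ho⟩ := h.exists_isBot
  have ho0 := rank_of_isBot ho
  have hcases : rank (⊤ : M) = 0 ∨ rank (⊤ : M) = 1 ∨ rank (⊤ : M) = 2 ∨ 3 ≤ rank (⊤ : M) := by
    omega
  rcases hcases with h0 | h1 | h2 | h3
  · obtain ⟨a, ha⟩ := exists_ne (⊤ : M)
    have := rank_lt_rank ha.lt_top
    omega
  · have : Subsingleton {v : M // IsVertex v} := by
      refine ⟨fun u v => Subtype.ext ?_⟩
      have e1 : rank u.1 = 1 := u.2
      have e2 : rank v.1 = 1 := v.2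
      rw [eq_of_le_of_rank_le (le_top (a := u.1)) (by omega),
        eq_of_le_of_rank_le (le_top (a := v.1)) (by omega)]
    have := Finite.card_le_one_iff_subsingleton.2 this
    omega
  · have hlt : o < ⊤ := lt_of_le_of_ne (ho _) (by rintro rfl; omega)
    have hd := h.isCellularPseudomanifold.diamond o ⊤ hlt (by omega)
    have hset : {y : M | o < y ∧ y < ⊤} = {v : M | IsVertex v} := by
      ext y
      simp only [Set.mem_ofPred_eq, IsVertex]
      constructor
      · rintro ⟨e1, e2⟩
        have := rank_lt_rank e1
        have := rank_lt_rank e2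
        omega
      · intro hy
        exact ⟨lt_of_le_of_ne (ho _) (by rintro rfl; omega),
          lt_of_le_of_ne le_top (by rintro rfl; omega)⟩
    rw [hset, ← Nat.card_coe_set_eq] at hd
    have : Nat.card {v : M // IsVertex v} = 2 := hd
    omega
  · exact h3

theorem exists_model_of_isReducible [OrderTop M] {d : ℤ}
    (hM : IsReducibleNeighbourlyExcessTwo M d) : ∃ n : Fin 4 → ℕ,
      (∀ i, i ≠ 3 → 3 ≤ n i) ∧ (n 0 + n 1 + n 2 + n 3 : ℤ) = d + 4 ∧
      Nonempty (M ≃o Model n) := by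
  have h := hM.isCellularPseudomanifold.isGradedPM
  have := h.finite
  have hdim := hM.dim_eq
  have hexc := hM.excess_eq
  rw [excess, hdim, ← Nat.card_coe_set_eq] at hexc
  rw [dim] at hdim
  have hcardZ : (Nat.card {v : M // IsVertex v} : ℤ) = d + 4 := by
    have : (Nat.card {v : M // IsVertex v} : ℤ) - d - 2 = 2 := hexc
    linarith
  have hcard : Nat.card {v : M // IsVertex v} = rank (⊤ : M) + 2 := by omega
  have hr := h.three_le_rank_top hcard
  obtain ⟨x, hxv, hx⟩ := hM.reducible
  obtain ⟨o, ho⟩ := h.exists_isBot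
  have hAv : ∀ a ∈ simClass x, IsVertex a := fun a ha => ha.1
  have hA : ∀ a ∈ simClass x, ∀ b ∈ simClass x, a ≠ b → ∃ φ : M ≃o M, φ a = b ∧ φ b = a ∧
    ∀ v, IsVertex v → v ≠ a → v ≠ b → φ v = v := fun a ha b hb hab => simClass_swap ha hb hab
  have hfac : ∀ F, F ⋖ ⊤ → ∃ a ∈ simClass x, ¬ a ≤ F := by
    intro F hF
    have := hx F (h.rank_of_covBy hF).symm
    rw [Set.not_subset] at this
    obtain ⟨a, ha, haF⟩ := this
    exact ⟨a, ha, fun e => haF ⟨ha.1, e⟩⟩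
  have hxA : x ∈ simClass x := ⟨hxv, .inl rfl⟩
  have hxt : x < ⊤ := lt_of_le_of_ne le_top (by
    rintro rfl
    have : rank (⊤ : M) = 1 := hxv
    omega)
  have hmeet : ∀ {F}, F ⋖ ⊤ → ∃ a ∈ simClass x, a ≤ F := fun hF =>
    h.exists_mem_le_facet hAv hA hfac hxA hxt hF
  have hmiss : ∀ {F}, F ⋖ ⊤ → ∀ b ∈ simClass x, ¬ b ≤ F → ∀ b' ∈ simClass x, ¬ b' ≤ F → b = b' := by
    intro F hF b hb hbF b' hb' hbF'
    obtain ⟨a, ha, haF⟩ := hmeet hF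
    exact h.missing_unique hAv hA hF ha haF hb hbF hb' hbF'
  have hcompl : ∀ F : M, (vertexSet F).ncard + (vertexSet F)ᶜ.ncard = rank (⊤ : M) + 2 := by
    intro F
    rw [Set.ncard_add_ncard_compl, hcard]
  obtain ⟨κ, hκ, hclosed⟩ := exists_coloring (𝒞 := cofacets M)
    (A := {v | v.1 ∈ simClass x})
    (by
      obtain ⟨F, -, hF⟩ := exists_le_covBy_of_lt hxt
      exact ⟨_, F, hF, rfl⟩)
    (by
      rintro _ ⟨F, hF, rfl⟩
      obtain ⟨b, hb, hbF⟩ := hfac F hF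
      exact ⟨⟨b, hAv b hb⟩, hb, hbF, fun a ha haF =>
        Subtype.ext (hmiss hF a.1 ha haF b hb hbF)⟩)
    (by
      rintro _ ⟨F, hF, rfl⟩ b hb hbF a ha
      by_cases hab : a = b
      · subst hab
        rw [Set.insert_sdiff_singleton, Set.insert_eq_of_mem hbF]
        exact ⟨F, hF, rfl⟩
      · have haF : a.1 ≤ F := by
          by_contra haF
          exact hab (Subtype.ext (hmiss hF a.1 ha haF b.1 hb hbF))
        obtain ⟨F', y, h1, -, -, h4, -⟩ := h.exists_swapped_facet hAv hA hF ha haF hb hbF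
        refine ⟨F', h1, ?_⟩
        ext v
        have := h4 v.1 v.2
        have e1 : v.1 = b.1 ↔ v = b := Subtype.ext_iff.symm
        have e2 : v.1 = a.1 ↔ v = a := Subtype.ext_iff.symm
        simp only [Set.mem_insert_iff, Set.mem_sdiff, Set.mem_compl_iff, mem_vertexSet,
          Set.mem_singleton_iff, this, e1, e2, ne_eq]
        by_cases hva : v = a
        · simp [hva, hab]
        · simp [hva]
          tauto)
    (by
      rintro _ ⟨F, hF, rfl⟩
      have h1 := h.rank_le_ncard F
      have h2 := h.rank_of_covBy hF
      have h3 := hcompl F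
      omega)
    (by
      rintro _ ⟨F, hF, rfl⟩ _ ⟨F', hF', rfl⟩ hsub
      have hle : F' ≤ F := h.vertexSet_subset_iff.1 (Set.compl_subset_compl.1 hsub)
      have h1 := h.rank_of_covBy hF
      have h2 := h.rank_of_covBy hF'
      rw [eq_of_le_of_rank_le hle (by omega)])
    (by
      rintro _ ⟨F, hF, rfl⟩ h3 z hz
      have hzF : z.1 ≤ F := by simpa using hz
      have h1 := h.rank_of_covBy hF
      have h2 := hcompl F
      -- A cofacet of size three means that `F` has as many vertices as its rank, so `F` without `z`
      -- is a ridge. The facets above this ridge are those whose cofacet lies in {z} together with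
      -- the cofacet of `F`.
      obtain ⟨y, hyF, hy⟩ := h.exists_covBy_vertexSet_eq_diff (f := F) (by omega) hzF
      obtain ⟨F', hne, hyF', hF', huniq⟩ := h.exists_other_covBy hyF hF
      have hsub : ∀ G : M, (vertexSet G)ᶜ ⊆ insert z (vertexSet F)ᶜ ↔ y ≤ G := by
        intro G
        rw [← h.vertexSet_subset_iff, hy]
        simp only [Set.subset_def, Set.mem_compl_iff, Set.mem_insert_iff, Set.mem_sdiff,
          Set.mem_singleton_iff]
        exact forall_congr' fun v => by tauto
      refine ⟨_, ⟨F', hF', rfl⟩, fun e => hne (h.vertexSet_injective (compl_injective e)),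
        (hsub F').2 hyF'.le, ?_⟩
      rintro _ ⟨G, hG, rfl⟩ hGsub
      have hyG : y < G := lt_of_le_of_ne ((hsub G).1 hGsub) (by
        rintro rfl
        have := h.rank_of_covBy hyF
        have := h.rank_of_covBy hG
        omega)
      exact (huniq G hyG hG.lt).imp (fun e => by rw [e]) (fun e => by rw [e]))
    (by
      refine h.closedFor_cofacets_iff.2 ⟨o, Set.eq_empty_iff_forall_notMem.2 fun v hv => ?_⟩
      have h1 : rank v.1 = 1 := v.2
      have h2 := rank_le_rank (show v.1 ≤ o from hv)
      have h3 := rank_of_isBot ho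
      omega)
    (by
      intro u v
      refine h.closedFor_cofacets_iff.2 ?_
      by_cases huv : u = v
      · exact ⟨u.1, by rw [h.vertexSet_of_isVertex, huv, Set.pair_eq_singleton]⟩
      · obtain ⟨e, he, hue, hve⟩ := hM.neighbourly u.1 v.1 u.2 v.2
          (fun e => huv (Subtype.ext e))
        exact ⟨e, h.vertexSet_edge huv he hue hve⟩)
    (by
      rintro _ ⟨F, hF, rfl⟩ hall
      have h1 := h.ncard_le_rank (f := F) fun S hS => h.closedFor_cofacets_iff.1
        (hall S fun v hv hvS => hv (hS hvS))
      have h2 := h.rank_of_covBy hF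
      have h3 := hcompl F
      omega)
  obtain ⟨e⟩ := h.nonempty_orderIso_of_closedFor hclosed
  obtain ⟨e'⟩ := nonempty_orderIso_model (κ := κ) (n := fun i => Nat.card {v // κ v = i})
    fun i => rfl
  refine ⟨_, hκ, ?_, ⟨e.trans e'⟩⟩
  rw [← hcardZ, ← Nat.card_congr (Equiv.sigmaFiberEquiv κ), Nat.card_sigma, Fin.sum_univ_four]
  push_cast
  ring

end Classification

end CellPM

namespace CellPM

/-! ### The two families are reducible, neighbourly and of excess two -/

section Converse

variable {V : Type*}

theorem mem_splitFaces_of_exists_notMem {κ : V → Fin 4} {S : Set V}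
    (h : ∀ i, i ≠ 3 → ∃ v, κ v = i ∧ v ∉ S) : S ∈ splitFaces κ := by
  obtain ⟨a, ha, haS⟩ := h 0 (by decide)
  obtain ⟨x, hx, hxS⟩ := h 1 (by decide)
  obtain ⟨y, hy, hyS⟩ := h 2 (by decide)
  exact ⟨iff_of_false (fun h => hxS (h x hx)) (fun h => hyS (h y hy)),
    iff_of_false (fun h => haS (h a ha)) (fun h => hxS (h.1 x hx))⟩

theorem mem_model_of_subset_pair {n : Fin 4 → ℕ} (hn : ∀ i, i ≠ 3 → 3 ≤ n i)
    {S : Set (Σ i, Fin (n i))} {u v : Σ i, Fin (n i)} (hS : S ⊆ {u, v}) :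
    S ∈ splitFaces (Sigma.fst : (Σ i, Fin (n i)) → Fin 4) := by
  refine mem_splitFaces_of_exists_notMem fun i hi => ?_
  have h3 := hn i hi
  by_contra hall
  push Not at hall
  have hmem : ∀ j : Fin (n i), (⟨i, j⟩ : Σ i, Fin (n i)) = u ∨ (⟨i, j⟩ : Σ i, Fin (n i)) = v :=
    fun j => hS (hall ⟨i, j⟩ rfl)
  have hinj : ∀ {j k : Fin (n i)}, (⟨i, j⟩ : Σ i, Fin (n i)) = ⟨i, k⟩ → j.1 = k.1 := by
    intro j k h
    have := sigma_mk_injective h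
    rw [this]
  have e0 := hmem ⟨0, by omega⟩
  have e1 := hmem ⟨1, by omega⟩
  have e2 := hmem ⟨2, by omega⟩
  rcases e0 with e0 | e0 <;> rcases e1 with e1 | e1 <;> rcases e2 with e2 | e2 <;>
    first
    | exact absurd (hinj (e0.trans e1.symm)) (by simp)
    | exact absurd (hinj (e0.trans e2.symm)) (by simp)
    | exact absurd (hinj (e1.trans e2.symm)) (by simp)

variable {M : Type*} [PartialOrder M]

theorem isReducible_of_orderIso_model [OrderTop M] {n : Fin 4 → ℕ} (hn : ∀ i, i ≠ 3 → 3 ≤ n i)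
    (h : IsGradedPM M) (e : M ≃o Model n) (hr : rank (⊤ : M) + 2 = n 0 + n 1 + n 2 + n 3) {d : ℤ}
    (hd : (rank (⊤ : M) : ℤ) - 2 = d) : IsReducibleNeighbourlyExcessTwo M d := by
  have := h.finite
  let V := Σ i, Fin (n i)
  let κ : V → Fin 4 := Sigma.fst
  let a₀ : V := ⟨0, ⟨0, by have := hn 0 (by decide); omega⟩⟩
  have hsub : ∀ {S : Set V} {u v : V}, S ⊆ {u, v} → S ∈ splitFaces κ := fun hS =>
    mem_model_of_subset_pair hn hS
  let o : M := e.symm ⟨∅, hsub (u := a₀) (v := a₀) (by simp)⟩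
  let pt : V → M := fun v => e.symm ⟨{v}, hsub (u := v) (v := v) (by simp)⟩
  have ho : IsBot o := fun x => e.symm_apply_le.2 (Set.empty_subset (e x : Set V))
  have hlt : ∀ {S T : Set V} (hS : S ∈ splitFaces κ) (hT : T ∈ splitFaces κ), S ⋖ T →
      e.symm ⟨S, hS⟩ ⋖ e.symm ⟨T, hT⟩ := by
    intro S T hS hT hST
    rw [apply_covBy_apply_iff]
    exact ⟨hST.lt, fun c h1 h2 => hST.2 (c := c.1) h1 h2⟩
  have hptv : ∀ v, IsVertex (pt v) := by
    intro v
    have hc : o ⋖ pt v := hlt _ _ (by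
      have := Set.covBy_insert (Set.notMem_empty v)
      rwa [insert_empty_eq] at this)
    rw [IsVertex, h.rank_of_covBy hc, rank_of_isBot ho]
  have hpt_le : ∀ {v : V} {x : M}, pt v ≤ x ↔ v ∈ (e x : Set V) := by
    intro v x
    have : pt v ≤ x ↔ ({v} : Set V) ⊆ (e x : Set V) := e.symm_apply_le
    rw [this, Set.singleton_subset_iff]
  have hpt_inj : Function.Injective pt := by
    intro u v huv
    have := e.symm.injective huv
    exact Set.singleton_injective (congrArg Subtype.val this)
  have hvert : ∀ x, IsVertex x ↔ ∃ v, pt v = x := by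
    intro x
    refine ⟨fun hx => ?_, fun ⟨v, hv⟩ => hv ▸ hptv v⟩
    have hx1 : rank x = 1 := hx
    rcases Set.eq_empty_or_nonempty (e x : Set V) with h0 | ⟨v, hv⟩
    · have : x = o := by
        rw [← e.symm_apply_apply x]
        exact congrArg e.symm (Subtype.ext h0)
      rw [this, rank_of_isBot ho] at hx1
      omega
    · have h1 : rank (pt v) = 1 := hptv v
      exact ⟨v, eq_of_le_of_rank_le (hpt_le.2 hv) (by omega)⟩
  have hcount : {x : M | IsVertex x}.ncard = n 0 + n 1 + n 2 + n 3 := by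
    have : {x : M | IsVertex x} = Set.range pt := by
      ext x
      exact hvert x
    rw [this, ← Set.image_univ, Set.ncard_image_of_injective _ hpt_inj, Set.ncard_univ,
      Nat.card_sigma, Fin.sum_univ_four]
    simp
  refine ⟨h.isCellularPseudomanifold, ?_, ?_, ?_, hd⟩
  · refine ⟨pt a₀, hptv a₀, fun F hF hsubF => ?_⟩
    -- Transpositions of vertices of colour 0 preserve the colouring and so induce automorphisms.
    -- Hence the class of `a₀` contains all of colour 0, and a face above that class contains every
    -- vertex.
    have hall : ∀ v : V, κ v = 0 → v ∈ (e F : Set V) := by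
      intro v hv
      classical
      have hsw : ∀ u, κ (Equiv.swap a₀ v u) = κ u := by
        intro u
        rw [Equiv.swap_apply_def]
        split_ifs with h1 h2
        · rw [h1, hv]
        · rw [h2, hv]
        · rfl
      let φ : M ≃o M := (e.trans (splitFacesCongr (Equiv.swap a₀ v) hsw)).trans e.symm
      have hφ : ∀ u, φ (pt u) = pt (Equiv.swap a₀ v u) := by
        intro u
        change e.symm (splitFacesCongr _ hsw (e (e.symm _))) = e.symm _
        rw [e.apply_symm_apply]
        exact congrArg e.symm (Subtype.ext Set.image_singleton)
      have hmem : pt v ∈ simClass (pt a₀) := by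
        refine ⟨hptv v, .inr ⟨φ, by rw [hφ, Equiv.swap_apply_left],
          by rw [hφ, Equiv.swap_apply_right], fun w hw h1 h2 => ?_⟩⟩
        obtain ⟨u, rfl⟩ := (hvert w).1 hw
        rw [hφ, Equiv.swap_apply_of_ne_of_ne (fun e => h1 (by rw [e])) (fun e => h2 (by rw [e]))]
      exact hpt_le.1 (hsubF hmem).2
    obtain ⟨h1, h2, h3⟩ := (e F).2.2.1 hall
    have huniv : ∀ v : V, v ∈ (e F : Set V) := by
      intro v
      have hc : κ v = 0 ∨ κ v = 1 ∨ κ v = 2 ∨ κ v = 3 := by omega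
      rcases hc with hc | hc | hc | hc
      exacts [hall v hc, h1 v hc, h2 v hc, h3 v hc]
    have htop : ⊤ ≤ F := h.le_of_forall_vertex fun w hw _ => by
      obtain ⟨u, rfl⟩ := (hvert w).1 hw
      exact hpt_le.2 (huniv u)
    rw [IsFacet, top_le_iff.1 htop] at hF
    omega
  · intro x y hx hy hxy
    obtain ⟨u, rfl⟩ := (hvert x).1 hx
    obtain ⟨v, rfl⟩ := (hvert y).1 hy
    have huv : u ≠ v := fun e => hxy (by rw [e])
    have hc : pt v ⋖ e.symm ⟨{u, v}, hsub le_rfl⟩ := hlt _ _ (Set.covBy_insert (by simpa using huv))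
    have h1 : rank (pt v) = 1 := hptv v
    refine ⟨_, by rw [h.rank_of_covBy hc, h1], hpt_le.2 ?_, hpt_le.2 ?_⟩
    · rw [e.apply_symm_apply]; simp
    · rw [e.apply_symm_apply]; simp
  · rw [excess, hcount, dim, ← hr]
    push_cast
    ring

theorem isGradedPM_stdSphere {b : ℤ} (hb : -1 ≤ b) :
    IsGradedPM (StdSphere b) ∧ rank (⊤ : StdSphere b) = (b + 2).toNat := by
  have : Nonempty (Fin (b + 2).toNat) := ⟨⟨0, by omega⟩⟩
  exact ⟨isGradedPM_finset _, by rw [rank_top_finset, Fintype.card_fin]⟩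

theorem isReducible_of_familyOne [OrderTop M] {d b₁ b₂ b₃ : ℤ} (hp : ParamsOne d b₁ b₂ b₃)
    (e : M ≃o FamilyOne b₁ b₂ b₃) : IsReducibleNeighbourlyExcessTwo M d := by
  obtain ⟨h1, h2, h3, hs⟩ := hp
  obtain ⟨g1, r1⟩ := isGradedPM_stdSphere (b := b₁) (by omega)
  obtain ⟨g2, r2⟩ := isGradedPM_stdSphere (b := b₂) (by omega)
  obtain ⟨g3, r3⟩ := isGradedPM_stdSphere (b := b₃) (by omega)
  have r4 := rank_top_join g1 g2
  have r5 := rank_top_join (g1.join g2) g3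
  have rt : rank (⊤ : M) = rank (⊤ : FamilyOne b₁ b₂ b₃) := by
    rw [← rank_orderIso e, e.map_top]
  have rt' : rank (⊤ : FamilyOne b₁ b₂ b₃) + 2 =
      (b₁ + 2).toNat + (b₂ + 2).toNat + (b₃ + 2).toNat := by
    rw [r1, r2] at r4
    rw [r3] at r5
    change rank (⊤ : Join (Join (StdSphere b₁) (StdSphere b₂)) (StdSphere b₃)) + 2 = _
    omega
  obtain ⟨f⟩ := familyOne_orderIso b₁ b₂ b₃
  refine isReducible_of_orderIso_model (n := numsOne b₁ b₂ b₃) ?_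
    (((g1.join g2).join g3).of_orderIso e.symm) (e.trans f) ?_ ?_
  · intro i hi
    fin_cases i <;> simp [numsOne] at hi ⊢ <;> omega
  · simp only [numsOne, rt, rt']
    simp
    ring
  · omega

theorem isReducible_of_familyTwo [OrderTop M] {d d₁ d₂ d₃ d₄ : ℤ} (hp : ParamsTwo d d₁ d₂ d₃ d₄)
    (e : M ≃o FamilyTwo d₁ d₂ d₃ d₄) : IsReducibleNeighbourlyExcessTwo M d := by
  obtain ⟨h1, h2, h3, h4, hs⟩ := hp
  obtain ⟨g1, r1⟩ := isGradedPM_stdSphere (b := d₁) (by omega)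
  obtain ⟨g2, r2⟩ := isGradedPM_stdSphere (b := d₂) (by omega)
  obtain ⟨g3, r3⟩ := isGradedPM_stdSphere (b := d₃) (by omega)
  obtain ⟨g4, r4⟩ := isGradedPM_stdSphere (b := d₄) (by omega)
  have r5 := rank_top_join g1 g2
  have r6 := rank_top_prod (g1.join g2) g3
  have r7 := rank_top_join ((g1.join g2).prod g3) g4
  have rt : rank (⊤ : M) = rank (⊤ : FamilyTwo d₁ d₂ d₃ d₄) := by
    rw [← rank_orderIso e, e.map_top]
  have rt' : rank (⊤ : FamilyTwo d₁ d₂ d₃ d₄) + 2 =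
      (d₁ + 2).toNat + (d₂ + 2).toNat + (d₃ + 2).toNat + (d₄ + 2).toNat := by
    rw [r1, r2] at r5
    rw [r3] at r6
    rw [r4] at r7
    change rank (⊤ : Join (Join (StdSphere d₁) (StdSphere d₂) × StdSphere d₃)
      (StdSphere d₄)) + 2 = _
    omega
  obtain ⟨f⟩ := familyTwo_orderIso d₁ d₂ d₃ d₄
  refine isReducible_of_orderIso_model (n := numsTwo d₁ d₂ d₃ d₄) ?_
    ((((g1.join g2).prod g3).join g4).of_orderIso e.symm) (e.trans f) ?_ ?_
  · intro i hi
    fin_cases i <;> simp [numsTwo] at hi ⊢ <;> omega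
  · simp only [numsTwo, rt, rt']
    simp
    ring
  · omega

end Converse

/-! ### The class sizes are isomorphism invariants -/

section Invariants

variable {V W : Type*}

/-- Singletons are the atoms, and an order isomorphism permutes atoms; this is what makes it come
from a bijection of the vertices. -/
theorem exists_map_singleton_eq {κ : V → Fin 4} {κ' : W → Fin 4} (e : splitFaces κ ≃o splitFaces κ')
    (h0 : ∅ ∈ splitFaces κ) (h0' : ∅ ∈ splitFaces κ') (h1 : ∀ v, {v} ∈ splitFaces κ)
    (h1' : ∀ v, {v} ∈ splitFaces κ') (v : V) : ∃ w, e ⟨{v}, h1 v⟩ = ⟨{w}, h1' w⟩ := by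
  have hbot : e ⟨∅, h0⟩ = ⟨∅, h0'⟩ := by
    apply le_antisymm
    · rw [← e.le_symm_apply]
      exact Set.empty_subset (e.symm ⟨∅, h0'⟩ : Set V)
    · exact Set.empty_subset (e ⟨∅, h0⟩ : Set W)
  have hne : (e ⟨{v}, h1 v⟩ : Set W).Nonempty := by
    rw [Set.nonempty_iff_ne_empty]
    intro hemp
    have : e ⟨{v}, h1 v⟩ = e ⟨∅, h0⟩ := by rw [hbot]; exact Subtype.ext hemp
    have := congrArg Subtype.val (e.injective this)
    exact Set.singleton_ne_empty v this
  obtain ⟨w, hw⟩ := hne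
  refine ⟨w, ?_⟩
  have hle : (⟨{w}, h1' w⟩ : splitFaces κ') ≤ e ⟨{v}, h1 v⟩ := Set.singleton_subset_iff.2 hw
  have hle' : (e.symm ⟨{w}, h1' w⟩ : Set V) ⊆ {v} := e.symm_apply_le.2 hle
  rcases Set.subset_singleton_iff_eq.1 hle' with hemp | hv
  · have : e.symm ⟨{w}, h1' w⟩ = ⟨∅, h0⟩ := Subtype.ext hemp
    rw [e.symm_apply_eq, hbot] at this
    exact absurd (congrArg Subtype.val this) (Set.singleton_ne_empty w)
  · have : e.symm ⟨{w}, h1' w⟩ = ⟨{v}, h1 v⟩ := Subtype.ext hv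
    rw [← this, e.apply_symm_apply]

theorem exists_vertex_equiv {κ : V → Fin 4} {κ' : W → Fin 4} (e : splitFaces κ ≃o splitFaces κ')
    (h0 : ∅ ∈ splitFaces κ) (h0' : ∅ ∈ splitFaces κ') (h1 : ∀ v, {v} ∈ splitFaces κ)
    (h1' : ∀ v, {v} ∈ splitFaces κ') :
    ∃ σ : V ≃ W, ∀ S, σ '' S ∈ splitFaces κ' ↔ S ∈ splitFaces κ := by
  choose f hf using exists_map_singleton_eq e h0 h0' h1 h1'
  choose g hg using exists_map_singleton_eq e.symm h0' h0 h1' h1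
  have hgf : ∀ v, g (f v) = v := by
    intro v
    have := hg (f v)
    rw [← hf, e.symm_apply_apply] at this
    exact (Set.singleton_injective (congrArg Subtype.val this)).symm
  have hfg : ∀ w, f (g w) = w := by
    intro w
    have := hf (g w)
    rw [← hg, e.apply_symm_apply] at this
    exact (Set.singleton_injective (congrArg Subtype.val this)).symm
  let σ : V ≃ W := ⟨f, g, hgf, hfg⟩
  have hmem : ∀ (S : splitFaces κ) v, v ∈ (S : Set V) ↔ σ v ∈ (e S : Set W) := by
    intro S v
    have : (⟨{v}, h1 v⟩ : splitFaces κ) ≤ S ↔ e ⟨{v}, h1 v⟩ ≤ e S := e.le_iff_le.symm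
    rw [hf] at this
    have h2 : ({v} : Set V) ⊆ S ↔ ({f v} : Set W) ⊆ (e S : Set W) := this
    rwa [Set.singleton_subset_iff, Set.singleton_subset_iff] at h2
  have himg : ∀ S : splitFaces κ, σ '' S = e S := by
    intro S
    ext w
    rw [σ.image_eq_preimage_symm, Set.mem_preimage, hmem, σ.apply_symm_apply]
  refine ⟨σ, fun S => ⟨fun hS => ?_, fun hS => ?_⟩⟩
  · have := himg (e.symm ⟨_, hS⟩)
    rw [e.apply_symm_apply] at this
    rw [← σ.injective.image_injective this]
    exact (e.symm ⟨_, hS⟩).2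
  · rw [himg ⟨S, hS⟩]
    exact (e ⟨S, hS⟩).2

/-- The complement of a finite set is full on exactly the colours that the set avoids, so membership
depends only on those colours and is a finite check. The same holds for triples. -/
theorem compl_pair_mem_splitFaces_iff (κ : V → Fin 4) (u v : V) :
    ({u, v} : Set V)ᶜ ∈ splitFaces κ ↔ (κ u = 0 ∧ κ v = 3) ∨ (κ u = 3 ∧ κ v = 0) := by
  have hfull : ∀ i, (∀ w, κ w = i → w ∈ ({u, v} : Set V)ᶜ) ↔ κ u ≠ i ∧ κ v ≠ i := by
    intro i
    constructor
    · intro h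
      exact ⟨fun hu => h u hu (by simp), fun hv => h v hv (by simp)⟩
    · rintro ⟨h1, h2⟩ w hw (rfl | rfl)
      exacts [h1 hw, h2 hw]
  simp only [splitFaces, Set.mem_ofPred_eq, hfull]
  generalize κ u = a
  generalize κ v = b
  revert a b
  decide

set_option synthInstance.maxSize 2000 in
set_option synthInstance.maxHeartbeats 200000 in
theorem compl_triple_mem_splitFaces_iff (κ : V → Fin 4) (u v w : V) :
    (({u, v, w} : Set V)ᶜ ∈ splitFaces κ ∧ ({u, v} : Set V)ᶜ ∉ splitFaces κ ∧
      ({u, w} : Set V)ᶜ ∉ splitFaces κ ∧ ({v, w} : Set V)ᶜ ∉ splitFaces κ) ↔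
      κ u ≠ 3 ∧ κ v ≠ 3 ∧ κ w ≠ 3 ∧ κ u ≠ κ v ∧ κ u ≠ κ w ∧ κ v ≠ κ w := by
  have hfull : ∀ i, (∀ x, κ x = i → x ∈ ({u, v, w} : Set V)ᶜ) ↔ κ u ≠ i ∧ κ v ≠ i ∧ κ w ≠ i := by
    intro i
    constructor
    · intro h
      exact ⟨fun hu => h u hu (by simp), fun hv => h v hv (by simp), fun hv => h w hv (by simp)⟩
    · rintro ⟨h1, h2, h3⟩ x hx (rfl | rfl | rfl)
      exacts [h1 hx, h2 hx, h3 hx]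
  rw [compl_pair_mem_splitFaces_iff, compl_pair_mem_splitFaces_iff, compl_pair_mem_splitFaces_iff]
  simp only [splitFaces, Set.mem_ofPred_eq, hfull]
  generalize κ u = a
  generalize κ v = b
  generalize κ w = c
  revert a b c
  decide

/-- The cofacets of size three recognise colour 3, as the vertices in none of them, and tell whether
two other vertices have the same colour. If colour 3 occurs, the cofacets of size two single out
colour 0. -/
theorem exists_perm_of_model_orderIso {n m : Fin 4 → ℕ} (hn : ∀ i, i ≠ 3 → 3 ≤ n i)
    (hm : ∀ i, i ≠ 3 → 3 ≤ m i) (e : Model n ≃o Model m) :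
    n 3 = m 3 ∧ ∃ π : Fin 4 → Fin 4, (∀ i, i ≠ 3 → π i ≠ 3 ∧ n i = m (π i)) ∧
      (∀ i j, i ≠ 3 → j ≠ 3 → i ≠ j → π i ≠ π j) ∧ (n 3 ≠ 0 → π 0 = 0) := by
  let u : ∀ i : Fin 4, i ≠ 3 → Σ i, Fin (n i) := fun i hi => ⟨i, ⟨0, by have := hn i hi; omega⟩⟩
  let u' : ∀ i : Fin 4, i ≠ 3 → Σ i, Fin (m i) := fun i hi => ⟨i, ⟨0, by have := hm i hi; omega⟩⟩
  obtain ⟨σ, hσ⟩ := exists_vertex_equiv e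
    (mem_model_of_subset_pair hn (u := u 0 (by decide)) (v := u 0 (by decide)) (by simp))
    (mem_model_of_subset_pair hm (u := u' 0 (by decide)) (v := u' 0 (by decide)) (by simp))
    (fun v => mem_model_of_subset_pair hn (u := v) (v := v) (by simp))
    (fun v => mem_model_of_subset_pair hm (u := v) (v := v) (by simp))
  have hpair : ∀ a b, (((σ a).1 = 0 ∧ (σ b).1 = 3) ∨ ((σ a).1 = 3 ∧ (σ b).1 = 0)) ↔
      ((a.1 = 0 ∧ b.1 = 3) ∨ (a.1 = 3 ∧ b.1 = 0)) := by
    intro a b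
    rw [← compl_pair_mem_splitFaces_iff Sigma.fst, ← compl_pair_mem_splitFaces_iff Sigma.fst,
      ← hσ, Set.image_compl_eq σ.bijective, Set.image_pair]
  have htriple : ∀ a b c, ((σ a).1 ≠ 3 ∧ (σ b).1 ≠ 3 ∧ (σ c).1 ≠ 3 ∧ (σ a).1 ≠ (σ b).1 ∧
      (σ a).1 ≠ (σ c).1 ∧ (σ b).1 ≠ (σ c).1) ↔
      (a.1 ≠ 3 ∧ b.1 ≠ 3 ∧ c.1 ≠ 3 ∧ a.1 ≠ b.1 ∧ a.1 ≠ c.1 ∧ b.1 ≠ c.1) := by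
    intro a b c
    rw [← compl_triple_mem_splitFaces_iff Sigma.fst, ← compl_triple_mem_splitFaces_iff Sigma.fst]
    simp only [← hσ, Set.image_compl_eq σ.bijective, Set.image_insert_eq, Set.image_singleton]
  have hex : ∀ i : Fin 4, i ≠ 3 → ∃ j k : Fin 4, j ≠ 3 ∧ k ≠ 3 ∧ i ≠ j ∧ i ≠ k ∧ j ≠ k := by decide
  have hex2 : ∀ i j : Fin 4, i ≠ 3 → j ≠ 3 → i ≠ j → ∃ k : Fin 4, k ≠ 3 ∧ i ≠ k ∧ j ≠ k := by decide
  have h3 : ∀ a, (σ a).1 = 3 ↔ a.1 = 3 := by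
    intro a
    rw [← not_iff_not]
    constructor
    · intro h
      obtain ⟨j, k, hj, hk, h1, h2, h3⟩ := hex _ h
      have := (htriple a (σ.symm (u' j hj)) (σ.symm (u' k hk))).1 (by
        simp only [σ.apply_symm_apply]
        exact ⟨h, hj, hk, h1, h2, h3⟩)
      exact this.1
    · intro h
      obtain ⟨j, k, hj, hk, h1, h2, h3⟩ := hex _ h
      exact ((htriple a (u j hj) (u k hk)).2 ⟨h, hj, hk, h1, h2, h3⟩).1
  have hne : ∀ a b, a.1 ≠ 3 → b.1 ≠ 3 → ((σ a).1 = (σ b).1 ↔ a.1 = b.1) := by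
    intro a b ha hb
    have ha' := (h3 a).not.2 ha
    have hb' := (h3 b).not.2 hb
    rw [← not_iff_not]
    constructor
    · intro h
      obtain ⟨k, hk, h1, h2⟩ := hex2 _ _ ha' hb' h
      have := (htriple a b (σ.symm (u' k hk))).1 (by
        simp only [σ.apply_symm_apply]
        exact ⟨ha', hb', hk, h, h1, h2⟩)
      exact this.2.2.2.1
    · intro h
      obtain ⟨k, hk, h1, h2⟩ := hex2 _ _ ha hb h
      exact ((htriple a b (u k hk)).2 ⟨ha, hb, hk, h, h1, h2⟩).2.2.2.1
  have hcard : ∀ i j : Fin 4, (∀ a, (σ a).1 = j ↔ a.1 = i) → n i = m j := by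
    intro i j hij
    rw [← card_sigma_fiber n i, ← card_sigma_fiber m j]
    exact Nat.card_congr (σ.subtypeEquiv fun a => (hij a).symm)
  refine ⟨hcard 3 3 h3, fun i => if hi : i = 3 then 3 else (σ (u i hi)).1, ?_, ?_, ?_⟩
  · intro i hi
    simp only [dif_neg hi]
    have hπ : (σ (u i hi)).1 ≠ 3 := (h3 _).not.2 hi
    refine ⟨hπ, hcard _ _ fun a => ?_⟩
    by_cases ha : a.1 = 3
    · have := (h3 a).2 ha
      rw [this, ha]
      exact iff_of_false hπ.symm hi.symm
    · exact hne a (u i hi) ha hi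
  · intro i j hi hj hij
    simp only [dif_neg hi, dif_neg hj]
    exact (hne (u i hi) (u j hj) hi hj).not.2 hij
  · intro hn3
    let p : Σ i, Fin (n i) := ⟨3, ⟨0, Nat.pos_of_ne_zero hn3⟩⟩
    have h0 : (0 : Fin 4) ≠ 3 := by decide
    simp only [dif_neg h0]
    have := (hpair (u 0 h0) p).2 (.inl ⟨rfl, rfl⟩)
    rcases this with h | h
    · exact h.1
    · exact absurd ((h3 _).1 h.1) h0

theorem numsOne_three_le {d b₁ b₂ b₃ : ℤ} (h : ParamsOne d b₁ b₂ b₃) (i : Fin 4) (hi : i ≠ 3) :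
    3 ≤ numsOne b₁ b₂ b₃ i := by
  obtain ⟨h1, h2, h3, hs⟩ := h
  fin_cases i <;> simp [numsOne] at hi ⊢ <;> omega

theorem numsTwo_three_le {d d₁ d₂ d₃ d₄ : ℤ} (h : ParamsTwo d d₁ d₂ d₃ d₄) (i : Fin 4)
    (hi : i ≠ 3) : 3 ≤ numsTwo d₁ d₂ d₃ d₄ i := by
  obtain ⟨h1, h2, h3, h4, hs⟩ := h
  fin_cases i <;> simp [numsTwo] at hi ⊢ <;> omega

theorem three_cases {i : Fin 4} (hi : i ≠ 3) : i = 0 ∨ i = 1 ∨ i = 2 := by omega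

theorem familyOne_injective {d b₁ b₂ b₃ c₁ c₂ c₃ : ℤ} (hb : ParamsOne d b₁ b₂ b₃)
    (hc : ParamsOne d c₁ c₂ c₃) (e : FamilyOne b₁ b₂ b₃ ≃o FamilyOne c₁ c₂ c₃) :
    b₁ = c₁ ∧ b₂ = c₂ ∧ b₃ = c₃ := by
  obtain ⟨f⟩ := familyOne_orderIso b₁ b₂ b₃
  obtain ⟨g⟩ := familyOne_orderIso c₁ c₂ c₃
  obtain ⟨-, π, h1, h2, -⟩ := exists_perm_of_model_orderIso (numsOne_three_le hb)
    (numsOne_three_le hc) ((f.symm.trans e).trans g)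
  obtain ⟨e0, n0⟩ := h1 0 (by decide)
  obtain ⟨e1, n1⟩ := h1 1 (by decide)
  obtain ⟨e2, n2⟩ := h1 2 (by decide)
  have d1 := h2 0 1 (by decide) (by decide) (by decide)
  have d2 := h2 0 2 (by decide) (by decide) (by decide)
  have d3 := h2 1 2 (by decide) (by decide) (by decide)
  obtain ⟨hb1, hb2, hb3, hbs⟩ := hb
  obtain ⟨hc1, hc2, hc3, hcs⟩ := hc
  rcases three_cases e0 with k0 | k0 | k0 <;> rcases three_cases e1 with k1 | k1 | k1 <;>
    rcases three_cases e2 with k2 | k2 | k2 <;> rw [k0] at n0 d1 d2 <;> rw [k1] at n1 d1 d3 <;>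
    rw [k2] at n2 d2 d3 <;> first
    | exact absurd rfl d1
    | exact absurd rfl d2
    | exact absurd rfl d3
    | (simp [numsOne] at n0 n1 n2; omega)

theorem familyTwo_injective {d d₁ d₂ d₃ d₄ e₁ e₂ e₃ e₄ : ℤ} (hb : ParamsTwo d d₁ d₂ d₃ d₄)
    (hc : ParamsTwo d e₁ e₂ e₃ e₄) (e : FamilyTwo d₁ d₂ d₃ d₄ ≃o FamilyTwo e₁ e₂ e₃ e₄) :
    d₁ = e₁ ∧ d₂ = e₂ ∧ d₃ = e₃ ∧ d₄ = e₄ := by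
  obtain ⟨f⟩ := familyTwo_orderIso d₁ d₂ d₃ d₄
  obtain ⟨g⟩ := familyTwo_orderIso e₁ e₂ e₃ e₄
  obtain ⟨n3, π, h1, h2, h3⟩ := exists_perm_of_model_orderIso (numsTwo_three_le hb)
    (numsTwo_three_le hc) ((f.symm.trans e).trans g)
  obtain ⟨e0, n0⟩ := h1 0 (by decide)
  obtain ⟨e1, n1⟩ := h1 1 (by decide)
  obtain ⟨e2, n2⟩ := h1 2 (by decide)
  have d1 := h2 0 1 (by decide) (by decide) (by decide)
  have d2 := h2 0 2 (by decide) (by decide) (by decide)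
  have d3 := h2 1 2 (by decide) (by decide) (by decide)
  obtain ⟨hb1, hb2, hb3, hb4, hbs⟩ := hb
  obtain ⟨hc1, hc2, hc3, hc4, hcs⟩ := hc
  have k0 := h3 (by simp [numsTwo]; omega)
  rw [k0] at n0 d1 d2
  rcases three_cases e1 with k1 | k1 | k1 <;>
    rcases three_cases e2 with k2 | k2 | k2 <;> rw [k1] at n1 d1 d3 <;>
    rw [k2] at n2 d2 d3 <;> first
    | exact absurd rfl d1
    | exact absurd rfl d2
    | exact absurd rfl d3
    | (simp [numsTwo] at n0 n1 n2 n3; omega)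

theorem familyOne_familyTwo_isEmpty {d b₁ b₂ b₃ d₁ d₂ d₃ d₄ : ℤ} (hb : ParamsOne d b₁ b₂ b₃)
    (hc : ParamsTwo d d₁ d₂ d₃ d₄) : IsEmpty (FamilyOne b₁ b₂ b₃ ≃o FamilyTwo d₁ d₂ d₃ d₄) := by
  refine ⟨fun e => ?_⟩
  obtain ⟨f⟩ := familyOne_orderIso b₁ b₂ b₃
  obtain ⟨g⟩ := familyTwo_orderIso d₁ d₂ d₃ d₄
  obtain ⟨n3, -⟩ := exists_perm_of_model_orderIso (numsOne_three_le hb)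
    (numsTwo_three_le hc) ((f.symm.trans e).trans g)
  obtain ⟨hc1, hc2, hc3, hc4, hcs⟩ := hc
  simp [numsOne, numsTwo] at n3
  omega

end Invariants

end CellPM

namespace CellPM

/-! ### Realization by convex polytopes -/

section Polytopes

/-- `R` consists of all vertices together with the sets cut out by the supporting hyperplanes of a
full-dimensional point configuration around the origin. -/
def Realizable {V : Type*} [Fintype V] (R : Set (Set V)) : Prop :=
  ∃ (E : Type) (_ : AddCommGroup E) (_ : Module ℝ E) (_ : FiniteDimensional ℝ E)
    (p : V → E) (w : V → ℝ), (∀ v, 0 < w v) ∧ ∑ v, w v = 1 ∧ ∑ v, w v • p v = 0 ∧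
    Submodule.span ℝ (Set.range p) = ⊤ ∧
    ∀ S, S ∈ R ↔ S = Set.univ ∨ ∃ l : E →ₗ[ℝ] ℝ, ∀ v, l (p v) ≤ 1 ∧ (l (p v) = 1 ↔ v ∈ S)

section Supporting

variable {V E : Type*} [Fintype V] [AddCommGroup E] [Module ℝ E] {p : V → E} {w : V → ℝ}

theorem sum_weighted_eq_zero (h0 : ∑ v, w v • p v = 0) (l : E →ₗ[ℝ] ℝ) :
    ∑ v, w v * l (p v) = 0 := by
  have := congrArg l h0
  simpa using this

theorem ne_univ_of_supporting (h1 : ∑ v, w v = 1) (h0 : ∑ v, w v • p v = 0) {l : E →ₗ[ℝ] ℝ}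
    {S : Set V} (hl : ∀ v, l (p v) ≤ 1 ∧ (l (p v) = 1 ↔ v ∈ S)) : S ≠ Set.univ := by
  rintro rfl
  have h := sum_weighted_eq_zero h0 l
  have h2 : ∀ v, l (p v) = 1 := fun v => (hl v).2.2 trivial
  simp only [h2, mul_one, h1] at h
  exact one_ne_zero h

/-- The origin is a positive combination of the points, so the maximum `c` is nonnegative. If it
vanishes, the functional is zero on all points; otherwise dividing by `c` normalizes it. -/
theorem eq_univ_or_exists_supporting (hw : ∀ v, 0 < w v) (h1 : ∑ v, w v = 1)
    (h0 : ∑ v, w v • p v = 0) {l : E →ₗ[ℝ] ℝ} {c : ℝ} {S : Set V}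
    (hl : ∀ v, l (p v) ≤ c ∧ (l (p v) = c ↔ v ∈ S)) :
    S = Set.univ ∨ ∃ l : E →ₗ[ℝ] ℝ, ∀ v, l (p v) ≤ 1 ∧ (l (p v) = 1 ↔ v ∈ S) := by
  have h := sum_weighted_eq_zero h0 l
  have hc : 0 ≤ c := by
    rw [← h, ← one_mul c, ← h1, Finset.sum_mul]
    exact Finset.sum_le_sum fun v _ => mul_le_mul_of_nonneg_left (hl v).1 (hw v).le
  rcases hc.eq_or_lt with rfl | hc
  · left
    have hnonneg : ∀ v ∈ Finset.univ, 0 ≤ -(w v * l (p v)) := fun v _ => by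
      have := mul_nonneg (hw v).le (neg_nonneg.2 (hl v).1)
      linarith
    have hz := (Finset.sum_eq_zero_iff_of_nonneg hnonneg).1 (by rw [Finset.sum_neg_distrib, h,
      neg_zero])
    refine Set.eq_univ_of_forall fun v => (hl v).2.1 ?_
    have := hz v (Finset.mem_univ _)
    rw [neg_eq_zero, mul_eq_zero] at this
    exact this.resolve_left (hw v).ne'
  · right
    refine ⟨c⁻¹ • l, fun v => ?_⟩
    rw [LinearMap.smul_apply, smul_eq_mul, inv_mul_le_iff₀ hc, mul_one, inv_mul_eq_one₀ hc.ne',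
      eq_comm]
    exact hl v

end Supporting

theorem Realizable.empty_mem {V : Type*} [Fintype V] {R : Set (Set V)} (h : Realizable R) :
    ∅ ∈ R := by
  obtain ⟨E, _, _, _, p, w, -, -, -, -, hR⟩ := h
  exact (hR _).2 (.inr ⟨0, fun v => by simp⟩)

/-- The simplex is placed in functions modulo constants, where the unit vectors have barycentre
zero. Linear functionals are then weights on the vertices with total zero. -/
theorem realizable_univ (V : Type) [Fintype V] [Nonempty V] :
    Realizable (Set.univ : Set (Set V)) := by
  classical
  let L : Submodule ℝ (V → ℝ) := Submodule.span ℝ {fun _ => 1}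
  have hcard : (0 : ℝ) < Fintype.card V := by exact_mod_cast Fintype.card_pos
  refine ⟨(V → ℝ) ⧸ L, inferInstance, inferInstance, inferInstance,
    fun v => L.mkQ (Pi.single v 1), fun _ => (Fintype.card V : ℝ)⁻¹, fun _ => inv_pos.2 hcard,
    by simp, ?_, ?_, ?_⟩
  · rw [← Finset.smul_sum, ← map_sum, Finset.univ_sum_single (fun _ : V => (1 : ℝ))]
    have : L.mkQ (fun _ => 1) = 0 := by
      rw [Submodule.mkQ_apply, Submodule.Quotient.mk_eq_zero]
      exact Submodule.subset_span rfl
    rw [this, smul_zero]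
  · have hb : Submodule.span ℝ (Set.range fun v : V => (Pi.single v 1 : V → ℝ)) = ⊤ := by
      have h := (Pi.basisFun ℝ V).span_eq
      rwa [show (Pi.basisFun ℝ V : V → V → ℝ) = fun v => Pi.single v 1 from
        funext fun v => Pi.basisFun_apply ℝ V v] at h
    have : (Set.range fun v : V => L.mkQ (Pi.single v 1)) =
        L.mkQ '' Set.range fun v : V => (Pi.single v 1 : V → ℝ) := by
      rw [← Set.range_comp]; rfl
    rw [this, Submodule.span_image, hb, Submodule.map_top, Submodule.range_mkQ]
  · intro S
    refine ⟨fun _ => or_iff_not_imp_left.2 fun hS => ?_, fun _ => trivial⟩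
    obtain ⟨u, hu⟩ := (Set.ne_univ_iff_exists_notMem S).1 hS
    let k : ℝ := ((Finset.univ.filter (· ∉ S)).card : ℝ)
    have hk : 0 < k := by
      have : 0 < (Finset.univ.filter (· ∉ S)).card := Finset.card_pos.2 ⟨u, by simpa using hu⟩
      exact Nat.cast_pos.2 this
    -- The weight is 1 on `S` and a smaller constant off `S`, chosen so that the total vanishes.
    let c : V → ℝ := fun v => 1 - if v ∉ S then Fintype.card V / k else 0
    let f : (V → ℝ) →ₗ[ℝ] ℝ := ∑ v, c v • LinearMap.proj v
    have hf : ∀ x, f x = ∑ v, c v * x v := by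
      intro x
      simp [f]
    have hLf : L ≤ LinearMap.ker f := by
      rw [Submodule.span_singleton_le_iff_mem, LinearMap.mem_ker, hf]
      simp only [c, mul_one, Finset.sum_sub_distrib, ← Finset.sum_filter, Finset.sum_const,
        nsmul_eq_mul, Finset.card_univ]
      change (Fintype.card V : ℝ) - k * (Fintype.card V / k) = 0
      field_simp
      ring
    refine ⟨L.liftQ f hLf, fun v => ?_⟩
    have hv : L.liftQ f hLf (L.mkQ (Pi.single v 1)) = c v := by
      rw [Submodule.mkQ_apply, Submodule.liftQ_apply, hf]
      simp [Pi.single_apply]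
    rw [hv]
    have hpos : 0 < Fintype.card V / k := div_pos hcard hk
    by_cases hvS : v ∈ S
    · simp [c, hvS]
    · simp [c, hvS, hpos.ne', hpos.le]

/-- This is the free sum: the two polytopes lie in complementary subspaces and share the origin as
an interior point. A supporting functional is a pair of supporting functionals, so both parts are
proper together. -/
theorem Realizable.join {V W : Type*} [Fintype V] [Fintype W] {R : Set (Set V)} {Q : Set (Set W)}
    (hR : Realizable R) (hQ : Realizable Q) : Realizable (joinFaces R Q) := by
  obtain ⟨E, _, _, _, p, w, hw, h1, h0, hs, hR⟩ := hR
  obtain ⟨F, _, _, _, q, w', hw', h1', h0', hs', hQ⟩ := hQ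
  refine ⟨E × F, inferInstance, inferInstance, inferInstance,
    Sum.elim (fun v => (p v, 0)) (fun v => (0, q v)),
    Sum.elim (fun v => w v / 2) (fun v => w' v / 2), ?_, ?_, ?_, ?_, ?_⟩
  · rintro (v | v)
    exacts [half_pos (hw v), half_pos (hw' v)]
  · simp only [Fintype.sum_sum_type, Sum.elim_inl, Sum.elim_inr, ← Finset.sum_div, h1, h1']
    norm_num
  · have e1 : ∀ v, (w v / 2) • ((p v, 0) : E × F) = LinearMap.inl ℝ E F
      ((1 / 2 : ℝ) • w v • p v) := by
      intro v; simp [smul_smul, div_eq_inv_mul]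
    have e2 : ∀ v, (w' v / 2) • ((0, q v) : E × F) = LinearMap.inr ℝ E F
      ((1 / 2 : ℝ) • w' v • q v) := by
      intro v; simp [smul_smul, div_eq_inv_mul]
    simp only [Fintype.sum_sum_type, Sum.elim_inl, Sum.elim_inr, e1, e2, ← map_sum,
      ← Finset.smul_sum, h0, h0', smul_zero, map_zero, add_zero]
  · rw [Set.Sum.elim_range, Submodule.span_union]
    have e1 : (Set.range fun v => ((p v, 0) : E × F)) = LinearMap.inl ℝ E F '' Set.range p := by
      rw [← Set.range_comp]; rfl
    have e2 : (Set.range fun v => ((0, q v) : E × F)) = LinearMap.inr ℝ E F '' Set.range q := by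
      rw [← Set.range_comp]; rfl
    rw [e1, e2, Submodule.span_image, Submodule.span_image, hs, hs', Submodule.map_top,
      Submodule.map_top, LinearMap.sup_range_inl_inr]
  · intro S
    constructor
    · rintro ⟨⟨hS1, hS2⟩, hS⟩
      rcases (hR _).1 hS1 with hu | ⟨l, hl⟩
      · left
        have hu' := hS.1 hu
        refine Set.eq_univ_of_forall ?_
        rintro (v | v)
        · exact Set.eq_univ_iff_forall.1 hu v
        · exact Set.eq_univ_iff_forall.1 hu' v
      · right
        have hne := ne_univ_of_supporting h1 h0 hl
        obtain ⟨l', hl'⟩ := ((hQ _).1 hS2).resolve_left fun h => hne (hS.2 h)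
        refine ⟨l.coprod l', ?_⟩
        rintro (v | v)
        · simpa using hl v
        · simpa using hl' v
    · rintro (rfl | ⟨l, hl⟩)
      · exact ⟨⟨(hR _).2 (.inl rfl), (hQ _).2 (.inl rfl)⟩, by simp⟩
      · have hl1 : ∀ v, (l ∘ₗ LinearMap.inl ℝ E F) (p v) ≤ 1 ∧
            ((l ∘ₗ LinearMap.inl ℝ E F) (p v) = 1 ↔ v ∈ Sum.inl ⁻¹' S) := fun v => hl (.inl v)
        have hl2 : ∀ v, (l ∘ₗ LinearMap.inr ℝ E F) (q v) ≤ 1 ∧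
            ((l ∘ₗ LinearMap.inr ℝ E F) (q v) = 1 ↔ v ∈ Sum.inr ⁻¹' S) := fun v => hl (.inr v)
        exact ⟨⟨(hR _).2 (.inr ⟨_, hl1⟩), (hQ _).2 (.inr ⟨_, hl2⟩)⟩,
          iff_of_false (ne_univ_of_supporting h1 h0 hl1) (ne_univ_of_supporting h1' h0' hl2)⟩

/-- This is the geometric join: the two polytopes lie in skew subspaces at heights 1 and -1, so any
face of one spans a face with any face of the other. -/
theorem Realizable.prod {V W : Type*} [Fintype V] [Fintype W] {R : Set (Set V)} {Q : Set (Set W)}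
    (hR : Realizable R) (hQ : Realizable Q) : Realizable (prodFaces R Q) := by
  obtain ⟨E, _, _, _, p, w, hw, h1, h0, hs, hR⟩ := hR
  obtain ⟨F, _, _, _, q, w', hw', h1', h0', hs', hQ⟩ := hQ
  refine ⟨E × F × ℝ, inferInstance, inferInstance, inferInstance,
    Sum.elim (fun v => (p v, 0, 1)) (fun v => (0, q v, -1)),
    Sum.elim (fun v => w v / 2) (fun v => w' v / 2), ?_, ?_, ?_, ?_, ?_⟩
  · rintro (v | v)
    exacts [half_pos (hw v), half_pos (hw' v)]
  · simp only [Fintype.sum_sum_type, Sum.elim_inl, Sum.elim_inr, ← Finset.sum_div, h1, h1']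
    norm_num
  · have e1 : ∑ v, (w v / 2) • p v = 0 := by
      simp only [div_eq_inv_mul, mul_smul, ← Finset.smul_sum, h0, smul_zero]
    have e2 : ∑ v, (w' v / 2) • q v = 0 := by
      simp only [div_eq_inv_mul, mul_smul, ← Finset.smul_sum, h0', smul_zero]
    have e3 : ∑ v, w v / 2 = 1 / 2 := by rw [← Finset.sum_div, h1]
    have e4 : ∑ v, w' v / 2 = 1 / 2 := by rw [← Finset.sum_div, h1']
    refine Prod.ext ?_ (Prod.ext ?_ ?_)
    · simp [Fintype.sum_sum_type, Prod.fst_sum, e1]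
    · simp [Fintype.sum_sum_type, Prod.fst_sum, Prod.snd_sum, e2]
    · simp [Fintype.sum_sum_type, Prod.snd_sum, e3, e4]
  · set U := Submodule.span ℝ (Set.range (Sum.elim (fun v => ((p v, 0, 1) : E × F × ℝ))
      (fun v => (0, q v, -1)))) with hU
    have hUp : ∀ v, ((p v, 0, 1) : E × F × ℝ) ∈ U := fun v => Submodule.subset_span ⟨.inl v, rfl⟩
    have hUq : ∀ v, ((0, q v, -1) : E × F × ℝ) ∈ U := fun v => Submodule.subset_span ⟨.inr v, rfl⟩
    have ht : ((0, 0, 1) : E × F × ℝ) ∈ U := by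
      have : ((0, 0, 1) : E × F × ℝ) = ∑ v, w v • ((p v, 0, 1) : E × F × ℝ) := by
        refine Prod.ext ?_ (Prod.ext ?_ ?_)
        · simp [Prod.fst_sum, h0]
        · simp [Prod.fst_sum, Prod.snd_sum]
        · simp [Prod.snd_sum, h1]
      rw [this]
      exact Submodule.sum_mem _ fun v _ => Submodule.smul_mem _ _ (hUp v)
    have hx : ∀ x : E, ((x, 0, 0) : E × F × ℝ) ∈ U := by
      have : Submodule.span ℝ (Set.range p) ≤ U.comap (LinearMap.inl ℝ E (F × ℝ)) := by
        rw [Submodule.span_le]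
        rintro _ ⟨v, rfl⟩
        have := Submodule.sub_mem _ (hUp v) ht
        simpa using this
      rw [hs] at this
      exact fun x => this (Submodule.mem_top (x := x))
    have hy : ∀ y : F, ((0, y, 0) : E × F × ℝ) ∈ U := by
      have : Submodule.span ℝ (Set.range q) ≤
          U.comap (LinearMap.inr ℝ E (F × ℝ) ∘ₗ LinearMap.inl ℝ F ℝ) := by
        rw [Submodule.span_le]
        rintro _ ⟨v, rfl⟩
        have := Submodule.add_mem _ (hUq v) ht
        simpa using this
      rw [hs'] at this
      exact fun x => this (Submodule.mem_top (x := x))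
    rw [eq_top_iff]
    rintro ⟨x, y, t⟩ -
    have : ((x, y, t) : E × F × ℝ) = (x, 0, 0) + (0, y, 0) + t • (0, 0, 1) := by simp
    rw [this]
    exact Submodule.add_mem _ (Submodule.add_mem _ (hx x) (hy y)) (Submodule.smul_mem _ _ ht)
  · intro S
    constructor
    · rintro ⟨hS1, hS2⟩
      rcases (hR _).1 hS1 with hu | ⟨l, hl⟩ <;> rcases (hQ _).1 hS2 with hu' | ⟨l', hl'⟩
      · left
        refine Set.eq_univ_of_forall ?_
        rintro (v | v)
        · exact Set.eq_univ_iff_forall.1 hu v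
        · exact Set.eq_univ_iff_forall.1 hu' v
      · right
        -- The height equals 1 on all of `V`; on `W` the value is 2 l' - 1, which is at most 1 with
        -- equality exactly where l' = 1.
        refine ⟨(0 : E →ₗ[ℝ] ℝ).coprod (((2 : ℝ) • l').coprod LinearMap.id), ?_⟩
        rintro (v | v)
        · simpa using Set.eq_univ_iff_forall.1 hu v
        · have := hl' v
          simp only [Sum.elim_inr, LinearMap.coprod_apply, LinearMap.zero_apply,
            LinearMap.smul_apply, LinearMap.id_apply, smul_eq_mul]
          rw [Set.mem_preimage] at this
          rw [← this.2]
          exact ⟨by linarith [this.1], ⟨fun h => by linarith, fun h => by linarith⟩⟩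
      · right
        refine ⟨((2 : ℝ) • l).coprod ((0 : F →ₗ[ℝ] ℝ).coprod (-LinearMap.id)), ?_⟩
        rintro (v | v)
        · have := hl v
          simp only [Sum.elim_inl, LinearMap.coprod_apply, LinearMap.zero_apply,
            LinearMap.smul_apply, LinearMap.neg_apply, LinearMap.id_apply, smul_eq_mul]
          rw [Set.mem_preimage] at this
          rw [← this.2]
          exact ⟨by linarith [this.1], ⟨fun h => by linarith, fun h => by linarith⟩⟩
        · simpa using Set.eq_univ_iff_forall.1 hu' v
      · right
        refine ⟨l.coprod (l'.coprod 0), ?_⟩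
        rintro (v | v)
        · simpa using hl v
        · simpa using hl' v
    · rintro (rfl | ⟨l, hl⟩)
      · exact ⟨(hR _).2 (.inl rfl), (hQ _).2 (.inl rfl)⟩
      · have hsplit : ∀ x y t, l (x, y, t) = l (x, 0, 0) + l (0, y, 0) + t * l (0, 0, 1) := by
          intro x y t
          rw [← smul_eq_mul, ← map_smul, ← map_add, ← map_add]
          simp
        constructor
        · refine (hR _).2 (eq_univ_or_exists_supporting hw h1 h0
            (l := l ∘ₗ LinearMap.inl ℝ E (F × ℝ)) (c := 1 - l (0, 0, 1)) fun v => ?_)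
          have h := hl (.inl v)
          rw [Sum.elim_inl, hsplit (p v) 0 1, show l ((0 : E), (0 : F),
            (0 : ℝ)) = 0 from map_zero l,
            one_mul, add_zero] at h
          change l (p v, 0, 0) ≤ _ ∧ (l (p v, 0, 0) = _ ↔ _)
          rw [Set.mem_preimage, ← h.2]
          exact ⟨by linarith [h.1], ⟨fun h => by linarith, fun h => by linarith⟩⟩
        · refine (hQ _).2 (eq_univ_or_exists_supporting hw' h1' h0'
            (l := l ∘ₗ LinearMap.inr ℝ E (F × ℝ) ∘ₗ LinearMap.inl ℝ F ℝ)
            (c := 1 + l (0, 0, 1)) fun v => ?_)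
          have h := hl (.inr v)
          rw [Sum.elim_inr, hsplit 0 (q v) (-1),
            show l ((0 : E), (0 : F), (0 : ℝ)) = 0 from map_zero l, zero_add] at h
          change l (0, q v, 0) ≤ _ ∧ (l (0, q v, 0) = _ ↔ _)
          rw [Set.mem_preimage, ← h.2]
          exact ⟨by linarith [h.1], ⟨fun h => by linarith, fun h => by linarith⟩⟩

/-- An exposed face is sent to the set of configuration points on it. This reflects inclusion
because a point of the face is a convex combination of configuration points, and those with nonzero
weight also maximize the functional and so lie on the face. -/
theorem Realizable.polytopal {V : Type*} [Fintype V] {R : Set (Set V)} (h : Realizable R)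
    {M : Type*} [PartialOrder M] (e : M ≃o R) : Polytopal M := by
  have hempty := h.empty_mem
  obtain ⟨E, _, _, _, p, w, hw, h1, h0, hs, hR⟩ := h
  let φ : E ≃ₗ[ℝ] EuclideanSpace ℝ (Fin (Module.finrank ℝ E)) :=
    LinearEquiv.ofFinrankEq _ _ (by simp)
  let P : V → EuclideanSpace ℝ (Fin (Module.finrank ℝ E)) := fun v => φ (p v)
  let K := convexHull ℝ (Set.range P)
  have hPK : ∀ v, P v ∈ K := fun v => subset_convexHull ℝ _ ⟨v, rfl⟩
  have hK : Convex ℝ K := convex_convexHull ℝ _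
  have hPspan : Submodule.span ℝ (Set.range P) = ⊤ := by
    have : Set.range P = (φ : E →ₗ[ℝ] _) '' Set.range p := by rw [← Set.range_comp]; rfl
    rw [this, Submodule.span_image, hs, Submodule.map_top, LinearEquiv.range]
  have hzero : (0 : EuclideanSpace ℝ (Fin (Module.finrank ℝ E))) ∈ K := by
    have : ∑ v, w v • P v = 0 := by
      have := congrArg φ h0
      simpa [P] using this
    rw [← this]
    exact hK.sum_mem (fun v _ => (hw v).le) h1 fun v _ => hPK v
  have hmemR : ∀ F, IsExposed ℝ K F → {v | P v ∈ F} ∈ R := by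
    intro F hF
    rcases Set.eq_empty_or_nonempty F with rfl | hne
    · simpa using hempty
    · obtain ⟨l, hl⟩ := hF hne
      obtain ⟨x, hx⟩ := hne
      have hxF : x ∈ K ∧ ∀ y ∈ K, l y ≤ l x := by rw [hl] at hx; exact hx
      refine (hR _).2 (eq_univ_or_exists_supporting hw h1 h0
        (l := l.toLinearMap ∘ₗ φ.toLinearMap) (c := l x) fun v => ⟨hxF.2 _ (hPK v), ?_⟩)
      change l (P v) = l x ↔ P v ∈ F
      rw [hl]
      exact ⟨fun h => ⟨hPK v, fun y hy => h ▸ hxF.2 y hy⟩,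
        fun h => le_antisymm (hxF.2 _ (hPK v)) (h.2 x hxF.1)⟩
  let g : {F // IsExposed ℝ K F} → R := fun F => ⟨{v | P v ∈ F.1}, hmemR F.1 F.2⟩
  have hle : ∀ F F', g F ≤ g F' ↔ F ≤ F' := by
    rintro ⟨F, hF⟩ ⟨F', hF'⟩
    refine ⟨fun hg x hx => ?_, fun hFF v hv => hFF hv⟩
    have hxK : x ∈ K := hF.subset hx
    obtain ⟨l, hl⟩ := hF ⟨x, hx⟩
    have hmax : ∀ y ∈ K, l y ≤ l x := by
      have hxF : x ∈ F := hx
      rw [hl] at hxF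
      exact hxF.2
    obtain ⟨ι, _, u, z, hu0, hu1, hz, rfl⟩ := mem_convexHull_iff_exists_fintype.1 hxK
    have hzK : ∀ i, z i ∈ K := fun i => subset_convexHull ℝ _ (hz i)
    have hsum : ∑ i, u i * (l (∑ i, u i • z i) - l (z i)) = 0 := by
      simp only [mul_sub, Finset.sum_sub_distrib, ← Finset.sum_mul, hu1, one_mul]
      simp
    have heq := (Finset.sum_eq_zero_iff_of_nonneg fun i _ =>
      mul_nonneg (hu0 i) (sub_nonneg.2 (hmax _ (hzK i)))).1 hsum
    have hconv : Convex ℝ F' := hF'.convex hK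
    have := hconv.finsum_mem (w := u) (z := z) hu0 (by rw [finsum_eq_sum_of_fintype, hu1])
      (fun i hi => by
        have h2 := (mul_eq_zero.1 (heq i (Finset.mem_univ _))).resolve_left hi
        have hzF : z i ∈ F := by
          rw [hl]
          exact ⟨hzK i, fun y hy => (hmax y hy).trans (by linarith)⟩
        obtain ⟨v, hv⟩ := hz i
        have hvF : v ∈ (g ⟨F, hF⟩ : Set V) := by
          change P v ∈ F
          rwa [hv]
        have hvF' : P v ∈ F' := hg hvF
        rwa [hv] at hvF')
    rwa [finsum_eq_sum_of_fintype] at this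
  have hsurj : Function.Surjective g := by
    rintro ⟨S, hS⟩
    rcases (hR S).1 hS with rfl | ⟨l, hl⟩
    · exact ⟨⟨K, IsExposed.refl K⟩, Subtype.ext (Set.eq_univ_of_forall hPK)⟩
    · rcases Set.eq_empty_or_nonempty S with rfl | ⟨s, hs⟩
      · exact ⟨⟨∅, isExposed_empty⟩, Subtype.ext (by simp [g])⟩
      · let l' : StrongDual ℝ (EuclideanSpace ℝ (Fin (Module.finrank ℝ E))) :=
          (l ∘ₗ (φ.symm : _ →ₗ[ℝ] E)).toContinuousLinearMap
        have hl' : ∀ v, l' (P v) = l (p v) := by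
          intro v
          simp [l', P]
        have hbound : ∀ y ∈ K, l' y ≤ 1 := by
          intro y hy
          have hsub : K ⊆ {y | l' y ≤ 1} := by
            refine convexHull_min ?_ (convex_halfSpace_le l'.toLinearMap.isLinear 1)
            rintro _ ⟨v, rfl⟩
            change l' (P v) ≤ 1
            rw [hl']
            exact (hl v).1
          exact hsub hy
        refine ⟨⟨l'.toExposed K, ContinuousLinearMap.toExposed.isExposed⟩, Subtype.ext ?_⟩
        ext v
        change (P v ∈ K ∧ ∀ y ∈ K, l' y ≤ l' (P v)) ↔ v ∈ S
        rw [← (hl v).2, ← hl']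
        constructor
        · rintro ⟨-, hy⟩
          refine le_antisymm (hbound _ (hPK v)) ?_
          have := hy _ (hPK s)
          rwa [hl' s, (hl s).2.2 hs] at this
        · intro hv
          exact ⟨hPK v, fun y hy => hv ▸ hbound y hy⟩
  have hinj : Function.Injective g := fun F F' h =>
    le_antisymm ((hle _ _).1 h.le) ((hle _ _).1 h.ge)
  refine ⟨_, Set.range P, Set.finite_range P, ?_, ⟨e.trans (RelIso.mk
    (Equiv.ofBijective g ⟨hinj, hsurj⟩) (fun {F F'} => hle F F') :
      {F // IsExposed ℝ K F} ≃o R).symm⟩⟩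
  -- The affine span of the points contains the origin, so it is the linear span, which is the whole
  -- space.
  rw [interior_convexHull_nonempty_iff_affineSpan_eq_top]
  have hne : (Set.range P).Nonempty := by
    rw [← convexHull_nonempty_iff (𝕜 := ℝ)]
    exact ⟨0, hzero⟩
  rw [AffineSubspace.affineSpan_eq_top_iff_vectorSpan_eq_top_of_nonempty _ _ _ hne, eq_top_iff,
    ← hPspan, Submodule.span_le]
  rintro _ ⟨v, rfl⟩
  have h0' : (0 : EuclideanSpace ℝ (Fin (Module.finrank ℝ E))) ∈ affineSpan ℝ (Set.range P) :=
    convexHull_subset_affineSpan _ hzero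
  have hv : P v ∈ affineSpan ℝ (Set.range P) := subset_affineSpan ℝ _ ⟨v, rfl⟩
  have := AffineSubspace.vsub_mem_direction hv h0'
  rw [direction_affineSpan] at this
  simpa using this

theorem polytopal_familyOne {d b₁ b₂ b₃ : ℤ} (h : ParamsOne d b₁ b₂ b₃) :
    Polytopal (FamilyOne b₁ b₂ b₃) := by
  obtain ⟨h1, h2, h3, hs⟩ := h
  have : Nonempty (Fin (b₁ + 2).toNat) := ⟨⟨0, by omega⟩⟩
  have : Nonempty (Fin (b₂ + 2).toNat) := ⟨⟨0, by omega⟩⟩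
  have : Nonempty (Fin (b₃ + 2).toNat) := ⟨⟨0, by omega⟩⟩
  exact (((realizable_univ _).join (realizable_univ _)).join (realizable_univ _)).polytopal
    (joinFacesIso (univ_mem_joinFaces (Set.mem_univ _) (Set.mem_univ _)) (Set.mem_univ _)
      (joinFacesIso (Set.mem_univ _) (Set.mem_univ _) (finsetIso _) (finsetIso _)) (finsetIso _))

theorem polytopal_familyTwo {d d₁ d₂ d₃ d₄ : ℤ} (h : ParamsTwo d d₁ d₂ d₃ d₄) :
    Polytopal (FamilyTwo d₁ d₂ d₃ d₄) := by
  obtain ⟨h1, h2, h3, h4, hs⟩ := h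
  have : Nonempty (Fin (d₁ + 2).toNat) := ⟨⟨0, by omega⟩⟩
  have : Nonempty (Fin (d₂ + 2).toNat) := ⟨⟨0, by omega⟩⟩
  have : Nonempty (Fin (d₃ + 2).toNat) := ⟨⟨0, by omega⟩⟩
  have : Nonempty (Fin (d₄ + 2).toNat) := ⟨⟨0, by omega⟩⟩
  exact ((((realizable_univ _).join (realizable_univ _)).prod (realizable_univ _)).join
    (realizable_univ _)).polytopal
    (joinFacesIso (univ_mem_prodFaces (univ_mem_joinFaces (Set.mem_univ _) (Set.mem_univ _))
      (Set.mem_univ _)) (Set.mem_univ _) (prodFacesIso (joinFacesIso (Set.mem_univ _)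
        (Set.mem_univ _) (finsetIso _) (finsetIso _)) (finsetIso _)) (finsetIso _))

end Polytopes

end CellPM

namespace CellPM

/-! ### Symmetries of the colours and normalized parameters -/

section Recoloring

theorem splitFaces_swap_one_two {V : Type*} (κ : V → Fin 4) :
    splitFaces (Equiv.swap 1 2 ∘ κ) = splitFaces κ := by
  have key : ∀ v i, (Equiv.swap (1 : Fin 4) 2 ∘ κ) v = i ↔ κ v = Equiv.swap 1 2 i := by
    intro v i
    rw [Function.comp_apply, Equiv.swap_apply_eq_iff]
  have e0 : Equiv.swap (1 : Fin 4) 2 0 = 0 := by decide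
  have e1 : Equiv.swap (1 : Fin 4) 2 1 = 2 := by decide
  have e2 : Equiv.swap (1 : Fin 4) 2 2 = 1 := by decide
  have e3 : Equiv.swap (1 : Fin 4) 2 3 = 3 := by decide
  ext S
  simp only [splitFaces, Set.mem_ofPred_eq, key, e0, e1, e2, e3]
  tauto

/-- Without colour 3 the conditions merely say that a face contains all three classes or none, which
is symmetric in 0, 1, 2. -/
theorem splitFaces_swap_zero_one {V : Type*} (κ : V → Fin 4) (h : ∀ v, κ v ≠ 3) :
    splitFaces (Equiv.swap 0 1 ∘ κ) = splitFaces κ := by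
  have key : ∀ v i, (Equiv.swap (0 : Fin 4) 1 ∘ κ) v = i ↔ κ v = Equiv.swap 0 1 i := by
    intro v i
    rw [Function.comp_apply, Equiv.swap_apply_eq_iff]
  have e0 : Equiv.swap (0 : Fin 4) 1 0 = 1 := by decide
  have e1 : Equiv.swap (0 : Fin 4) 1 1 = 0 := by decide
  have e2 : Equiv.swap (0 : Fin 4) 1 2 = 2 := by decide
  have e3 : Equiv.swap (0 : Fin 4) 1 3 = 3 := by decide
  ext S
  have h3 : ∀ v, κ v = 3 → v ∈ S := fun v hv => absurd hv (h v)
  simp only [splitFaces, Set.mem_ofPred_eq, key, e0, e1, e2, e3]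
  tauto

theorem model_orderIso_of_perm {n : Fin 4 → ℕ} (π : Equiv.Perm (Fin 4))
    (h : splitFaces (π ∘ (Sigma.fst : (Σ i, Fin (n i)) → Fin 4)) = splitFaces Sigma.fst) :
    Nonempty (Model n ≃o Model (n ∘ π.symm)) := by
  unfold Model
  rw [← h]
  refine nonempty_orderIso_model fun i => ?_
  rw [Function.comp_apply, ← card_sigma_fiber n (π.symm i)]
  exact Nat.card_congr (Equiv.subtypeEquivRight fun v => by
    rw [Function.comp_apply, Equiv.eq_symm_apply])

theorem model_swap_one_two (a x y p : ℕ) : Nonempty (Model ![a, x, y, p] ≃o Model ![a, y, x,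
    p]) := by
  have := model_orderIso_of_perm (n := ![a, x, y, p]) (Equiv.swap 1 2) (splitFaces_swap_one_two _)
  rwa [show ![a, x, y, p] ∘ (Equiv.swap (1 : Fin 4) 2).symm = ![a, y, x, p] by
    ext i; fin_cases i <;> rfl] at this

theorem model_swap_zero_one (a x y : ℕ) : Nonempty (Model ![a, x, y, 0] ≃o Model ![x, a, y,
    0]) := by
  have := model_orderIso_of_perm (n := ![a, x, y, 0]) (Equiv.swap 0 1)
    (splitFaces_swap_zero_one _ (by
      rintro ⟨i, j⟩ (rfl : i = 3)
      exact j.elim0))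
  rwa [show ![a, x, y, 0] ∘ (Equiv.swap (0 : Fin 4) 1).symm = ![x, a, y, 0] by
    ext i; fin_cases i <;> rfl] at this

theorem exists_sorted_model (a x y : ℕ) : ∃ a' x' y', x' ≤ y' ∧ y' ≤ a' ∧
    ({a', x', y'} : Multiset ℕ) = {a, x, y} ∧ Nonempty (Model ![a, x, y, 0] ≃o Model ![a', x', y',
      0]) := by
  have s12 : ∀ {a x y b c d}, Nonempty (Model ![a, x, y, 0] ≃o Model ![b, c, d, 0]) →
      Nonempty (Model ![a, x, y, 0] ≃o Model ![b, d, c, 0]) := by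
    rintro a x y b c d ⟨e⟩
    exact ⟨e.trans (model_swap_one_two b c d 0).some⟩
  have s01 : ∀ {a x y b c d}, Nonempty (Model ![a, x, y, 0] ≃o Model ![b, c, d, 0]) →
      Nonempty (Model ![a, x, y, 0] ≃o Model ![c, b, d, 0]) := by
    rintro a x y b c d ⟨e⟩
    exact ⟨e.trans (model_swap_zero_one b c d).some⟩
  have r : Nonempty (Model ![a, x, y, 0] ≃o Model ![a, x, y, 0]) := ⟨OrderIso.refl _⟩
  have m1 : ∀ b c d : ℕ, ({b, d, c} : Multiset ℕ) = {b, c, d} := fun b c d => by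
    rw [Multiset.pair_comm]
  have m2 : ∀ b c d : ℕ, ({c, b, d} : Multiset ℕ) = {b, c, d} := fun b c d =>
    Multiset.cons_swap c b {d}
  rcases le_total x y with h1 | h1 <;> rcases le_total a x with h2 | h2 <;>
    rcases le_total a y with h3 | h3
  · exact ⟨y, a, x, h2, h1, (m2 a y x).trans (m1 a x y), s01 (s12 r)⟩
  · exact ⟨y, a, x, h2, h1, (m2 a y x).trans (m1 a x y), s01 (s12 r)⟩
  · exact ⟨y, x, a, h2, h3, ((m2 x y a).trans (m1 x a y)).trans (m2 a x y), s01 (s12 (s01 r))⟩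
  · exact ⟨a, x, y, h1, h3, rfl, r⟩
  · exact ⟨x, a, y, h3, h1, m2 _ _ _, s01 r⟩
  · exact ⟨x, y, a, h3, h2, by rw [m1, m2], s12 (s01 r)⟩
  · exact ⟨a, y, x, h1, h2, m1 _ _ _, s12 r⟩
  · exact ⟨a, y, x, h1, h2, m1 _ _ _, s12 r⟩

theorem exists_family_of_isReducible {M : Type*} [PartialOrder M] [OrderTop M] {d : ℤ}
    (hM : IsReducibleNeighbourlyExcessTwo M d) :
    (∃ b₁ b₂ b₃ : ℤ, ParamsOne d b₁ b₂ b₃ ∧ Nonempty (M ≃o FamilyOne b₁ b₂ b₃)) ∨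
    (∃ d₁ d₂ d₃ d₄ : ℤ, ParamsTwo d d₁ d₂ d₃ d₄ ∧ Nonempty (M ≃o FamilyTwo d₁ d₂ d₃ d₄)) := by
  obtain ⟨n, hn, hsum, ⟨e⟩⟩ := exists_model_of_isReducible hM
  have h0 := hn 0 (by decide)
  have h1 := hn 1 (by decide)
  have h2 := hn 2 (by decide)
  obtain ⟨a, x, y, p, rfl⟩ : ∃ a x y p, n = ![a, x, y, p] :=
    ⟨n 0, n 1, n 2, n 3, by ext i; fin_cases i <;> rfl⟩
  change 3 ≤ a at h0
  change 3 ≤ x at h1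
  change 3 ≤ y at h2
  change (a + x + y + p : ℤ) = d + 4 at hsum
  rcases Nat.eq_zero_or_pos p with rfl | hp
  · left
    obtain ⟨a', x', y', l1, l2, hmul, ⟨f⟩⟩ := exists_sorted_model a x y
    have hs : a' + x' + y' = a + x + y := by
      have := congrArg Multiset.sum hmul
      simp at this
      omega
    have hx' : 3 ≤ x' := by
      have : x' ∈ ({a, x, y} : Multiset ℕ) := by rw [← hmul]; simp
      simp at this
      omega
    refine ⟨x' - 2, y' - 2, a' - 2, ⟨by omega, by omega, by omega, by omega⟩, ?_⟩
    obtain ⟨g⟩ := familyOne_orderIso (x' - 2) (y' - 2) (a' - 2)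
    have : numsOne (x' - 2) (y' - 2) (a' - 2) = ![a', x', y', 0] := by simp [numsOne]
    rw [this] at g
    exact ⟨(e.trans f).trans g.symm⟩
  · right
    have : ∃ x' y', 3 ≤ x' ∧ x' ≤ y' ∧ x' + y' = x + y ∧
        Nonempty (Model ![a, x, y, p] ≃o Model ![a, x', y', p]) := by
      rcases le_total x y with h | h
      · exact ⟨x, y, h1, h, rfl, ⟨OrderIso.refl _⟩⟩
      · exact ⟨y, x, h2, h, add_comm _ _, model_swap_one_two a x y p⟩
    obtain ⟨x', y', hx', l1, hs, ⟨f⟩⟩ := this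
    refine ⟨x' - 2, y' - 2, p - 2, a - 2, ⟨by omega, by omega, by omega, by omega, by omega⟩, ?_⟩
    obtain ⟨g⟩ := familyTwo_orderIso (x' - 2) (y' - 2) (p - 2) (a - 2)
    have : numsTwo (x' - 2) (y' - 2) (p - 2) (a - 2) = ![a, x', y', p] := by simp [numsTwo]
    rw [this] at g
    exact ⟨(e.trans f).trans g.symm⟩

end Recoloring

/-! ### Counting the parameters -/

section Count

theorem encard_eq_add {α β γ : Type*} {S : Set α} {A : Set β} {B : Set γ} (f : β → α) (g : γ → α)
    (hf : Function.Injective f) (hg : Function.Injective g) (hS : S = f '' A ∪ g '' B)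
    (hd : ∀ a ∈ A, ∀ b ∈ B, f a ≠ g b) : S.encard = A.encard + B.encard := by
  rw [hS, Set.encard_union_eq, hf.encard_image, hg.encard_image]
  rw [Set.disjoint_left]
  rintro _ ⟨a, ha, rfl⟩ ⟨b, hb, h⟩
  exact hd a ha b hb h.symm

/-- Partitions of `n` into two positive parts. -/
def pairsWithSum (n : ℤ) : Set (ℤ × ℤ) := {p | 1 ≤ p.1 ∧ p.1 ≤ p.2 ∧ p.1 + p.2 = n}

/-- Partitions of `n` into three positive parts. -/
def triplesWithSum (n : ℤ) : Set (ℤ × ℤ × ℤ) :=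
  {p | 1 ≤ p.1 ∧ p.1 ≤ p.2.1 ∧ p.2.1 ≤ p.2.2 ∧ p.1 + p.2.1 + p.2.2 = n}

/-- Partitions into two positive parts together with a part that is at least `-1`. -/
def mixedTriplesWithSum (n : ℤ) : Set (ℤ × ℤ × ℤ) :=
  {p | 1 ≤ p.1 ∧ p.1 ≤ p.2.1 ∧ -1 ≤ p.2.2 ∧ p.1 + p.2.1 + p.2.2 = n}

/-- The parameter quadruples of the second family. -/
def quadruplesWithSum (n : ℤ) : Set (ℤ × ℤ × ℤ × ℤ) :=
  {p | 1 ≤ p.1 ∧ p.1 ≤ p.2.1 ∧ -1 ≤ p.2.2.1 ∧ 1 ≤ p.2.2.2 ∧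
    p.1 + p.2.1 + p.2.2.1 + p.2.2.2 = n}

theorem encard_pairsWithSum (n : ℕ) : (pairsWithSum n).encard = (n / 2 : ℕ) := by
  induction n using Nat.twoStepInduction with
  | zero =>
    rw [Set.encard_eq_zero.2]
    · simp
    · ext ⟨a, b⟩
      simp [pairsWithSum]
      omega
  | one =>
    rw [Set.encard_eq_zero.2]
    · simp
    · ext ⟨a, b⟩
      simp [pairsWithSum]
      omega
  | more n ih _ =>
    rw [encard_eq_add (A := pairsWithSum n) (B := {((1, n + 1) : ℤ × ℤ)})
      (fun p => (p.1 + 1, p.2 + 1)) id ?_ Function.injective_id ?_ ?_, ih, Set.encard_singleton]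
    · rw [show (n + 2) / 2 = n / 2 + 1 by omega]
      push_cast
      rfl
    · rintro ⟨a, b⟩ ⟨c, d⟩ h
      simpa using h
    · ext ⟨a, b⟩
      simp only [-existsAndEq, Nat.cast_add, Nat.cast_ofNat, pairsWithSum, Set.mem_ofPred_eq,
        Set.mem_union, Set.mem_image, Prod.exists,
        Prod.mk.injEq, Set.mem_singleton_iff, id]
      constructor
      · rintro ⟨h1, h2, h3⟩
        -- Either the smaller part is 1, or both parts can be lowered by one.
        by_cases ha : a = 1
        · exact .inr ⟨a, b, ⟨ha, by omega⟩, rfl, rfl⟩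
        · exact .inl ⟨a - 1, b - 1, by omega, by omega, by omega⟩
      · rintro (⟨c, e, h1, h2, h3⟩ | ⟨c, e, h1, h2, h3⟩) <;> omega
    · rintro ⟨a, b⟩ h _ rfl h'
      simp only [pairsWithSum, Set.mem_ofPred_eq, id, Prod.mk.injEq] at h h'
      omega

theorem sq_mod_three (k : ℕ) : k ^ 2 % 3 = 0 ∨ k ^ 2 % 3 = 1 := by
  have : k % 3 = 0 ∨ k % 3 = 1 ∨ k % 3 = 2 := by omega
  rcases this with h | h | h <;> simp [Nat.pow_mod, h]

theorem triple_count_step (n : ℕ) :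
    ((n + 3) ^ 2 + 6) / 12 = (n ^ 2 + 6) / 12 + (n + 2) / 2 := by
  have hk := sq_mod_three (n / 2)
  obtain ⟨k, rfl | rfl⟩ : ∃ k, n = 2 * k ∨ n = 2 * k + 1 := ⟨n / 2, by omega⟩
  · rw [show 2 * k / 2 = k by omega] at hk
    have e1 : (2 * k + 3) ^ 2 = 4 * k ^ 2 + 12 * k + 9 := by ring
    have e2 : (2 * k) ^ 2 = 4 * k ^ 2 := by ring
    rw [e1, e2]
    generalize k ^ 2 = q at *
    omega
  · rw [show (2 * k + 1) / 2 = k by omega] at hk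
    have hk' := sq_mod_three (k + 2)
    have e0 : (k + 2) ^ 2 = k ^ 2 + 4 * k + 4 := by ring
    have e1 : (2 * k + 1 + 3) ^ 2 = 4 * k ^ 2 + 16 * k + 16 := by ring
    have e2 : (2 * k + 1) ^ 2 = 4 * k ^ 2 + 4 * k + 1 := by ring
    rw [e0] at hk'
    rw [e1, e2]
    have hk2 : (k ^ 2 + k) % 3 = 0 ∨ (k ^ 2 + k) % 3 = 2 := by
      have : k % 3 = 0 ∨ k % 3 = 1 ∨ k % 3 = 2 := by omega
      rcases this with h | h | h <;> simp [Nat.add_mod, Nat.pow_mod, h]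
    generalize k ^ 2 = q at *
    omega

/-- Partitions with all parts at least two reduce to the sum `n - 3`; those with smallest part 1 are
the pairs of sum `n - 1`. -/
theorem encard_triplesWithSum (n : ℕ) :
    (triplesWithSum n).encard = ((n ^ 2 + 6) / 12 : ℕ) := by
  induction n using Nat.strong_induction_on with
  | _ n ih =>
    rcases lt_or_ge n 3 with hn | hn
    · have : triplesWithSum n = ∅ := by
        ext ⟨a, b, c⟩
        simp [triplesWithSum]
        omega
      rw [this, Set.encard_empty]
      interval_cases n <;> rfl
    · obtain ⟨m, rfl⟩ := Nat.exists_eq_add_of_le' hn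
      rw [encard_eq_add (A := triplesWithSum m) (B := pairsWithSum ((m + 2 : ℕ) : ℤ))
        (fun p => (p.1 + 1, p.2.1 + 1, p.2.2 + 1)) (fun p => (1, p.1, p.2)) ?_ ?_ ?_ ?_,
        ih m (by omega), encard_pairsWithSum, triple_count_step]
      · push_cast; rfl
      · rintro ⟨a, b, c⟩ ⟨a', b', c'⟩ h
        simpa using h
      · rintro ⟨a, b⟩ ⟨a', b'⟩ h
        simpa using h
      · ext ⟨a, b, c⟩
        simp only [-existsAndEq, Nat.cast_add, Nat.cast_ofNat, triplesWithSum, pairsWithSum,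
          Set.mem_ofPred_eq, Set.mem_union, Set.mem_image,
          Prod.exists, Prod.mk.injEq]
        constructor
        · rintro ⟨h1, h2, h3, h4⟩
          by_cases ha : a = 1
          · exact .inr ⟨b, c, by omega, ha.symm, rfl, rfl⟩
          · exact .inl ⟨a - 1, b - 1, c - 1, by omega, by omega, by omega, by omega⟩
        · rintro (⟨a', b', c', h1, h2, h3, h4⟩ | ⟨b', c', h1, h2, h3, h4⟩) <;> omega
      · rintro ⟨a, b, c⟩ h ⟨a', b'⟩ _ h'
        simp only [triplesWithSum, Set.mem_ofPred_eq, Prod.mk.injEq] at h h'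
        omega

theorem mixed_count_step (n : ℕ) : (n + 2) ^ 2 / 4 = (n + 1) ^ 2 / 4 + (n + 2) / 2 := by
  obtain ⟨k, rfl | rfl⟩ : ∃ k, n = 2 * k ∨ n = 2 * k + 1 := ⟨n / 2, by omega⟩
  · have e1 : (2 * k + 2) ^ 2 = 4 * k ^ 2 + 8 * k + 4 := by ring
    have e2 : (2 * k + 1) ^ 2 = 4 * k ^ 2 + 4 * k + 1 := by ring
    rw [e1, e2]
    omega
  · have e1 : (2 * k + 1 + 2) ^ 2 = 4 * k ^ 2 + 12 * k + 9 := by ring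
    have e2 : (2 * k + 1 + 1) ^ 2 = 4 * k ^ 2 + 8 * k + 4 := by ring
    rw [e1, e2]
    omega

/-- The last part is lowered by one until it is -1, where the other two parts form a pair of sum one
more than the total. -/
theorem encard_mixedTriplesWithSum (n : ℕ) :
    (mixedTriplesWithSum n).encard = ((n + 1) ^ 2 / 4 : ℕ) := by
  induction n with
  | zero =>
    have : mixedTriplesWithSum (0 : ℕ) = ∅ := by
      ext ⟨a, b, c⟩
      simp [mixedTriplesWithSum]
      omega
    rw [this, Set.encard_empty]
    rfl
  | succ n ih =>
    rw [encard_eq_add (A := mixedTriplesWithSum n) (B := pairsWithSum ((n + 2 : ℕ) : ℤ))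
      (fun p => (p.1, p.2.1, p.2.2 + 1)) (fun p => (p.1, p.2, -1)) ?_ ?_ ?_ ?_,
      ih, encard_pairsWithSum, mixed_count_step]
    · push_cast; rfl
    · rintro ⟨a, b, c⟩ ⟨a', b', c'⟩ h
      simpa using h
    · rintro ⟨a, b⟩ ⟨a', b'⟩ h
      simpa using h
    · ext ⟨a, b, c⟩
      simp only [-existsAndEq, Nat.cast_add, Nat.cast_one, Nat.cast_ofNat, mixedTriplesWithSum,
        pairsWithSum, Set.mem_ofPred_eq, Set.mem_union, Set.mem_image,
        Prod.exists, Prod.mk.injEq]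
      constructor
      · rintro ⟨h1, h2, h3, h4⟩
        by_cases hc : c = -1
        · exact .inr ⟨a, b, by omega, rfl, rfl, hc.symm⟩
        · exact .inl ⟨a, b, c - 1, by omega, by omega, by omega, by omega⟩
      · rintro (⟨a', b', c', h1, h2, h3, h4⟩ | ⟨b', c', h1, h2, h3, h4⟩) <;> omega
    · rintro ⟨a, b, c⟩ h ⟨a', b'⟩ _ h'
      simp only [mixedTriplesWithSum, Set.mem_ofPred_eq, Prod.mk.injEq] at h h'
      omega

/-- The number of parameter quadruples with given sum. -/
def quadCount : ℕ → ℕ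
  | 0 => 0
  | n + 1 => quadCount n + (n + 1) ^ 2 / 4

theorem encard_quadruplesWithSum (n : ℕ) :
    (quadruplesWithSum n).encard = (quadCount n : ℕ) := by
  induction n with
  | zero =>
    have : quadruplesWithSum (0 : ℕ) = ∅ := by
      ext ⟨a, b, c, e⟩
      simp [quadruplesWithSum]
      omega
    rw [this, Set.encard_empty]
    rfl
  | succ n ih =>
    rw [encard_eq_add (A := quadruplesWithSum n) (B := mixedTriplesWithSum n)
      (fun p => (p.1, p.2.1, p.2.2.1, p.2.2.2 + 1)) (fun p => (p.1, p.2.1, p.2.2, 1)) ?_ ?_ ?_ ?_,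
      ih, encard_mixedTriplesWithSum, quadCount]
    · push_cast; rfl
    · rintro ⟨a, b, c, e⟩ ⟨a', b', c', e'⟩ h
      simpa using h
    · rintro ⟨a, b, c⟩ ⟨a', b', c'⟩ h
      simpa using h
    · ext ⟨a, b, c, e⟩
      simp only [-existsAndEq, Nat.cast_add, Nat.cast_one, quadruplesWithSum, mixedTriplesWithSum,
        Set.mem_ofPred_eq, Set.mem_union,
        Set.mem_image, Prod.exists, Prod.mk.injEq]
      constructor
      · rintro ⟨h1, h2, h3, h4, h5⟩
        by_cases he : e = 1
        · exact .inr ⟨a, b, c, by omega, rfl, rfl, rfl, he.symm⟩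
        · exact .inl ⟨a, b, c, e - 1, by omega, by omega, by omega, by omega, by omega⟩
      · rintro (⟨a', b', c', e', h1, h2, h3, h4, h5⟩ | ⟨a', b', c', h1, h2, h3, h4, h5⟩) <;> omega
    · rintro ⟨a, b, c, e⟩ h ⟨a', b', c'⟩ _ h'
      simp only [quadruplesWithSum, Set.mem_ofPred_eq, Prod.mk.injEq] at h h'
      omega

/-- Summing the quarter squares: 24 times the sum is six times the sum of squares, corrected by 6
for each odd term rounded down. -/
theorem quadCount_closed (n : ℕ) :
    24 * quadCount n + 6 * ((n + 1) / 2) = n * (n + 1) * (2 * n + 1) := by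
  induction n with
  | zero => rfl
  | succ n ih =>
    rw [quadCount]
    obtain ⟨k, rfl | rfl⟩ : ∃ k, n = 2 * k ∨ n = 2 * k + 1 := ⟨n / 2, by omega⟩
    · rw [show (2 * k + 1) ^ 2 / 4 = k ^ 2 + k by
        rw [show (2 * k + 1) ^ 2 = 4 * (k ^ 2 + k) + 1 by ring]; omega,
        show (2 * k + 1 + 1) / 2 = k + 1 by omega]
      rw [show (2 * k + 1) / 2 = k by omega] at ih
      linarith
    · rw [show (2 * k + 1 + 1) ^ 2 / 4 = (k + 1) ^ 2 by
        rw [show (2 * k + 1 + 1) ^ 2 = 4 * (k + 1) ^ 2 by ring]; omega,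
        show (2 * k + 1 + 1 + 1) / 2 = k + 1 by omega]
      rw [show (2 * k + 1 + 1) / 2 = k + 1 by omega] at ih
      linarith

theorem floor_formula (m : ℕ) : ((((m + 2) ^ 2 + 6) / 12 + quadCount m : ℕ) : ℤ) =
    ⌊((((m + 4 : ℤ) : ℚ) ^ 2 - 6 * ((m + 4 : ℤ) : ℚ) + 10) * (2 * ((m + 4 : ℤ)
      : ℚ) - 7) + 9) / 24⌋ := by
  have hq := quadCount_closed m
  have hN : ((((m + 4 : ℤ) : ℚ) ^ 2 - 6 * ((m + 4 : ℤ) : ℚ) + 10) *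
      (2 * ((m + 4 : ℤ) : ℚ) - 7) + 9) =
      ((m * (m + 1) * (2 * m + 1) + 2 * m ^ 2 + 5 * m + 11 : ℕ) : ℚ) := by
    push_cast
    ring
  -- With d = m + 4 the numerator is the cubic of `quadCount_closed` plus 2m² + 5m + 11. The
  -- remaining quadratic accounts for the three-part partitions; residues of squares modulo 3 settle
  -- the rounding.
  rw [hN, show (24 : ℚ) = ((24 : ℕ) : ℚ) by norm_num, Rat.floor_natCast_div_natCast, ← hq]
  norm_cast
  obtain ⟨k, rfl | rfl⟩ : ∃ k, m = 2 * k ∨ m = 2 * k + 1 := ⟨m / 2, by omega⟩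
  · have hk := sq_mod_three (k + 1)
    have e0 : (k + 1) ^ 2 = k ^ 2 + 2 * k + 1 := by ring
    have e1 : (2 * k + 2) ^ 2 = 4 * k ^ 2 + 8 * k + 4 := by ring
    have e2 : (2 * k) ^ 2 = 4 * k ^ 2 := by ring
    rw [e0] at hk
    rw [e1, e2]
    generalize k ^ 2 = q at *
    generalize quadCount (2 * k) = c at *
    omega
  · have hk := sq_mod_three k
    have e1 : (2 * k + 1 + 2) ^ 2 = 4 * k ^ 2 + 12 * k + 9 := by ring
    have e2 : (2 * k + 1) ^ 2 = 4 * k ^ 2 + 4 * k + 1 := by ring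
    rw [e1, e2]
    generalize k ^ 2 = q at *
    generalize quadCount (2 * k + 1) = c at *
    omega

theorem encard_params (d : ℤ) : ∃ c : ℕ,
    (triplesWithSum (d - 2)).encard + (quadruplesWithSum (d - 4)).encard = c ∧
    (2 ≤ d → (c : ℤ) = ⌊(((d : ℚ) ^ 2 - 6 * d + 10) * (2 * d - 7) + 9) / 24⌋) := by
  have hq : d < 4 → quadruplesWithSum (d - 4) = ∅ := by
    intro hd
    ext ⟨a, b, c, e⟩
    simp [quadruplesWithSum]
    omega
  have ht : d < 4 → triplesWithSum (d - 2) = ∅ := by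
    intro hd
    ext ⟨a, b, c⟩
    simp [triplesWithSum]
    omega
  rcases lt_or_ge d 4 with hd | hd
  -- No parameters exist for d < 4; at d = 2 and d = 3 the quotients are 3/24 and 8/24, whose floors
  -- are 0.
  · refine ⟨0, by rw [hq hd, ht hd]; simp, fun h2 => ?_⟩
    have : d = 2 ∨ d = 3 := by omega
    rcases this with rfl | rfl
    · rw [eq_comm, Int.floor_eq_iff]; norm_num
    · rw [eq_comm, Int.floor_eq_iff]; norm_num
  · obtain ⟨m, rfl⟩ : ∃ m : ℕ, d = m + 4 := ⟨(d - 4).toNat, by omega⟩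
    refine ⟨((m + 2) ^ 2 + 6) / 12 + quadCount m, ?_, fun _ => floor_formula m⟩
    rw [show (m + 4 - 2 : ℤ) = ((m + 2 : ℕ) : ℤ) by push_cast; ring, encard_triplesWithSum,
      show (m + 4 - 4 : ℤ) = m by ring, encard_quadruplesWithSum]
    push_cast
    rfl

/-- The isomorphism class of a poset, in a higher universe. -/
def liftClass (M : Type) [PartialOrder M] [OrderTop M] : Quotient isoSetoid.{u} :=
  Quotient.mk _ ⟨ULift.{u} M⟩

theorem liftClass_eq_iff {M N : Type} [PartialOrder M] [OrderTop M] [PartialOrder N] [OrderTop N] :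
    liftClass.{u} M = liftClass.{u} N ↔ Nonempty (M ≃o N) := by
  refine Quotient.eq.trans ⟨fun ⟨e⟩ => ?_, fun ⟨e⟩ => ?_⟩
  · exact ⟨(ULift.orderIso.symm.trans e).trans ULift.orderIso⟩
  · exact ⟨(ULift.orderIso.trans e).trans ULift.orderIso.symm⟩

theorem isoClasses_eq (d : ℤ) : isoClasses.{u} d =
    (fun p : ℤ × ℤ × ℤ => liftClass.{u} (FamilyOne p.1 p.2.1 p.2.2)) '' triplesWithSum (d - 2) ∪
    (fun p : ℤ × ℤ × ℤ × ℤ => liftClass.{u} (FamilyTwo p.1 p.2.1 p.2.2.1 p.2.2.2)) ''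
      quadruplesWithSum (d - 4) := by
  ext q
  constructor
  · rintro ⟨M, hM, rfl⟩
    rcases exists_family_of_isReducible hM with ⟨b₁, b₂, b₃, hp, ⟨e⟩⟩ | ⟨d₁, d₂, d₃, d₄, hp, ⟨e⟩⟩
    · exact .inl ⟨(b₁, b₂, b₃), hp, Quotient.sound ⟨ULift.orderIso.trans e.symm⟩⟩
    · exact .inr ⟨(d₁, d₂, d₃, d₄), hp, Quotient.sound ⟨ULift.orderIso.trans e.symm⟩⟩
  · rintro (⟨p, hp, rfl⟩ | ⟨p, hp, rfl⟩)
    · exact ⟨_, isReducible_of_familyOne hp ULift.orderIso, rfl⟩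
    · exact ⟨_, isReducible_of_familyTwo hp ULift.orderIso, rfl⟩

theorem encard_isoClasses (d : ℤ) : (isoClasses.{u} d).encard =
    (triplesWithSum (d - 2)).encard + (quadruplesWithSum (d - 4)).encard := by
  rw [isoClasses_eq, Set.encard_union_eq, Set.InjOn.encard_image, Set.InjOn.encard_image]
  · rintro p hp q hq h
    obtain ⟨e⟩ := liftClass_eq_iff.1 h
    obtain ⟨h1, h2, h3, h4⟩ := familyTwo_injective (d := d) hp hq e
    exact Prod.ext h1 (Prod.ext h2 (Prod.ext h3 h4))
  · rintro p hp q hq h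
    obtain ⟨e⟩ := liftClass_eq_iff.1 h
    obtain ⟨h1, h2, h3⟩ := familyOne_injective (d := d) hp hq e
    exact Prod.ext h1 (Prod.ext h2 h3)
  · rw [Set.disjoint_left]
    rintro _ ⟨p, hp, rfl⟩ ⟨q, hq, h⟩
    obtain ⟨e⟩ := liftClass_eq_iff.1 h
    exact (familyOne_familyTwo_isEmpty (d := d) hp hq).false e.symm

end Count

end CellPM

theorem corollary5p1 (d : ℤ) :
    -- the classification
    (∀ (M : Type u) [PartialOrder M] [OrderTop M],
      CellPM.IsReducibleNeighbourlyExcessTwo M d ↔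
        (∃ b₁ b₂ b₃ : ℤ, CellPM.ParamsOne d b₁ b₂ b₃ ∧
          Nonempty (M ≃o CellPM.FamilyOne b₁ b₂ b₃)) ∨
        (∃ d₁ d₂ d₃ d₄ : ℤ, CellPM.ParamsTwo d d₁ d₂ d₃ d₄ ∧
          Nonempty (M ≃o CellPM.FamilyTwo d₁ d₂ d₃ d₄))) ∧
    -- all members of the two families are polytopal
    (∀ b₁ b₂ b₃ : ℤ, CellPM.ParamsOne d b₁ b₂ b₃ →
      CellPM.Polytopal (CellPM.FamilyOne b₁ b₂ b₃)) ∧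
    (∀ d₁ d₂ d₃ d₄ : ℤ, CellPM.ParamsTwo d d₁ d₂ d₃ d₄ →
      CellPM.Polytopal (CellPM.FamilyTwo d₁ d₂ d₃ d₄)) ∧
    -- they are mutually non-isomorphic
    (∀ b₁ b₂ b₃ c₁ c₂ c₃ : ℤ, CellPM.ParamsOne d b₁ b₂ b₃ → CellPM.ParamsOne d c₁ c₂ c₃ →
      Nonempty (CellPM.FamilyOne b₁ b₂ b₃ ≃o CellPM.FamilyOne c₁ c₂ c₃) →
      b₁ = c₁ ∧ b₂ = c₂ ∧ b₃ = c₃) ∧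
    (∀ d₁ d₂ d₃ d₄ e₁ e₂ e₃ e₄ : ℤ,
      CellPM.ParamsTwo d d₁ d₂ d₃ d₄ → CellPM.ParamsTwo d e₁ e₂ e₃ e₄ →
      Nonempty (CellPM.FamilyTwo d₁ d₂ d₃ d₄ ≃o CellPM.FamilyTwo e₁ e₂ e₃ e₄) →
      d₁ = e₁ ∧ d₂ = e₂ ∧ d₃ = e₃ ∧ d₄ = e₄) ∧
    (∀ b₁ b₂ b₃ d₁ d₂ d₃ d₄ : ℤ,
      CellPM.ParamsOne d b₁ b₂ b₃ → CellPM.ParamsTwo d d₁ d₂ d₃ d₄ →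
      IsEmpty (CellPM.FamilyOne b₁ b₂ b₃ ≃o CellPM.FamilyTwo d₁ d₂ d₃ d₄)) ∧
    -- their number
    (CellPM.isoClasses.{u} d).Finite ∧
    (2 ≤ d → ((CellPM.isoClasses.{u} d).ncard : ℤ) =
      ⌊(((d : ℚ) ^ 2 - 6 * d + 10) * (2 * d - 7) + 9) / 24⌋) := by
  obtain ⟨c, hc, hformula⟩ := CellPM.encard_params d
  rw [← CellPM.encard_isoClasses.{u}] at hc
  refine ⟨fun M _ _ => ⟨CellPM.exists_family_of_isReducible, ?_⟩,
    fun _ _ _ => CellPM.polytopal_familyOne, fun _ _ _ _ => CellPM.polytopal_familyTwo,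
    fun _ _ _ _ _ _ hb hc ⟨e⟩ => CellPM.familyOne_injective hb hc e,
    fun _ _ _ _ _ _ _ _ hb hc ⟨e⟩ => CellPM.familyTwo_injective hb hc e,
    fun _ _ _ _ _ _ _ => CellPM.familyOne_familyTwo_isEmpty,
    Set.finite_of_encard_eq_coe hc, fun hd => ?_⟩
  · rintro (⟨b₁, b₂, b₃, hp, ⟨e⟩⟩ | ⟨d₁, d₂, d₃, d₄, hp, ⟨e⟩⟩)
    exacts [CellPM.isReducible_of_familyOne hp e, CellPM.isReducible_of_familyTwo hp e]
  · rw [Set.ncard, hc, ← hformula hd]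
    rfl
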